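/- Let $n\in\{2,3\}$, let $\Omega\subset\mathbb{R}^n$ be a bounded domain, $V\in L^\infty(\Omega)$ (complex-valued) and $k>0$. Suppose that $v,w\in L^2(\Omega)$ are interior transmission eigenfunctions for $V$ and $k$, that is, \[ (\Delta+k^2)w=0 \ \text{ and } \ (\Delta+k^2(1+V))v=0 \ \text{ in } \Omega \text{ (in the sense of distributions)},\qquad v-w\in H^2_0(\Omega),\qquad \|w\|_{L^2(\Omega)}=1, \] where $H^2_0(\Omega)$ is the closure of $C_c^\infty(\Omega)$ in $H^2(\Omega)$. Let $x_c\in\partial\Omega$ be a vertex of $\Omega$ or (if $n=3$) a point on an edge of $\Omega$, in the following sense. (a) $n=2$, vertex: in some ball centred at $x_c$, $\Omega$ coincides with an open sector with apex $x_c$ and opening angle $\theta\in(0,2\pi)\setminus\{\pi\}$. (b) $n=3$, edge point: in some ball centred at $x_c$, $\Omega$ coincides with the product of such a sector and the line through $x_c$ orthogonal to its plane. (c) $n=3$, vertex: $x_c$ is not an edge point, and in some ball $B$ centred at $x_c$, $\Omega$ coincides with a connected cone with apex $x_c$ such that near every point of $(\partial\Omega\cap B)\setminus\{x_c\}$ the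 set $\Omega$ is either a half-space with that point on its boundary or a wedge as in (b), and at least one point of $B\setminus\{x_c\}$ is an edge point. In particular non-convex corners and edges ($\theta>\pi$) are allowed. Assume that $V$ is $C^\alpha$ for some $\alpha>0$ near $x_c$, i.e. $V\in C^\alpha(\overline{\Omega\cap B})$ for some ball $B$ centred at $x_c$, that $V(x_c)\ne 0$, and that $v$ or $w$ belongs to $H^2(\Omega\cap B')$ for some ball $B'$ centred at $x_c$. Then $v(x_c)=w(x_c)=0$: near $x_c$, both $v$ and $w$ have representatives that are continuous up to the boundary of $\Omega$, and these vanish at $x_c$. -/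

import Mathlib

open MeasureTheory Filter Set
open scoped Topology NNReal ENNReal ContDiff Laplacian

noncomputable section

/-- Complex-valued test functions on `U`: elements of `C_c^∞(U)`, extended by zero. -/
structure IsTestFunction {n : ℕ} (U : Set (EuclideanSpace ℝ (Fin n)))
    (φ : EuclideanSpace ℝ (Fin n) → ℂ) : Prop where
  contDiff : ContDiff ℝ ∞ φ
  hasCompactSupport : HasCompactSupport φ
  tsupport_subset : tsupport φ ⊆ U

/-- The classical partial derivative `∂ᵢ φ`. -/
def partialDeriv {n : ℕ} (i : Fin n) (φ : EuclideanSpace ℝ (Fin n) → ℂ) :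
    EuclideanSpace ℝ (Fin n) → ℂ :=
  fun x => fderiv ℝ φ x (EuclideanSpace.single i 1)

/-- `g` is the weak partial derivative `∂ᵢ f` on `U`. -/
def IsWeakPartial {n : ℕ} (U : Set (EuclideanSpace ℝ (Fin n))) (i : Fin n)
    (f g : EuclideanSpace ℝ (Fin n) → ℂ) : Prop :=
  ∀ φ, IsTestFunction U φ →
    ∫ x in U, f x * partialDeriv i φ x = - ∫ x in U, g x * φ x

/-- `f ∈ H²(U)`, with weak gradient `G` and weak Hessian `H`, all of them in `L²(U)`. -/
structure HasH2Derivs {n : ℕ} (U : Set (EuclideanSpace ℝ (Fin n)))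
    (f : EuclideanSpace ℝ (Fin n) → ℂ)
    (G : Fin n → EuclideanSpace ℝ (Fin n) → ℂ)
    (H : Fin n → Fin n → EuclideanSpace ℝ (Fin n) → ℂ) : Prop where
  memLp : MemLp f 2 (volume.restrict U)
  memLp_grad : ∀ i, MemLp (G i) 2 (volume.restrict U)
  memLp_hess : ∀ i j, MemLp (H i j) 2 (volume.restrict U)
  weak_grad : ∀ i, IsWeakPartial U i f (G i)
  weak_hess : ∀ i j, IsWeakPartial U j (G i) (H i j)

/-- The Sobolev space `H²(U)` of an open set `U`. -/
def MemH2 {n : ℕ} (U : Set (EuclideanSpace ℝ (Fin n)))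
    (f : EuclideanSpace ℝ (Fin n) → ℂ) : Prop :=
  ∃ G H, HasH2Derivs U f G H

/-- The space `H²₀(U)`: the closure of `C_c^∞(U)` in the norm of `H²(U)`. -/
def MemH20 {n : ℕ} (U : Set (EuclideanSpace ℝ (Fin n)))
    (f : EuclideanSpace ℝ (Fin n) → ℂ) : Prop :=
  ∃ G H, HasH2Derivs U f G H ∧
    ∃ φ : ℕ → EuclideanSpace ℝ (Fin n) → ℂ, (∀ m, IsTestFunction U (φ m)) ∧
      Tendsto (fun m => eLpNorm (φ m - f) 2 (volume.restrict U)) atTop (𝓝 0) ∧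
      (∀ i, Tendsto (fun m => eLpNorm (partialDeriv i (φ m) - G i) 2 (volume.restrict U))
        atTop (𝓝 0)) ∧
      (∀ i j, Tendsto (fun m => eLpNorm (partialDeriv j (partialDeriv i (φ m)) - H i j) 2
        (volume.restrict U)) atTop (𝓝 0))

/-- `(v, w)` is a pair of interior transmission eigenfunctions on `Ω` for the potential `V` and
the wavenumber `k`: `v, w ∈ L²(Ω)`, `(Δ + k²) w = 0` and `(Δ + k² (1 + V)) v = 0` in the sense of
distributions on `Ω`, `v - w ∈ H²₀(Ω)` and `‖w‖_{L²(Ω)} = 1`. -/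
structure IsTransmissionEigenpair {n : ℕ} (Ω : Set (EuclideanSpace ℝ (Fin n)))
    (V : EuclideanSpace ℝ (Fin n) → ℂ) (k : ℝ) (v w : EuclideanSpace ℝ (Fin n) → ℂ) :
    Prop where
  memLp_v : MemLp v 2 (volume.restrict Ω)
  memLp_w : MemLp w 2 (volume.restrict Ω)
  eq_w : ∀ φ, IsTestFunction Ω φ →
    ∫ x in Ω, w x * (Δ φ x + (k : ℂ) ^ 2 * φ x) = 0
  eq_v : ∀ φ, IsTestFunction Ω φ →
    ∫ x in Ω, v x * (Δ φ x + (k : ℂ) ^ 2 * (1 + V x) * φ x) = 0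
  sub_memH20 : MemH20 Ω (v - w)
  norm_w : eLpNorm w 2 (volume.restrict Ω) = 1

/-- The open sector (times the orthogonal complement of the plane spanned by `e₁`, `e₂`)
`{ y | (⟪e₁, y⟫, ⟪e₂, y⟫) = ρ (cos t, sin t) with ρ > 0 and 0 < t < θ }`. -/
def wedge {n : ℕ} (e₁ e₂ : EuclideanSpace ℝ (Fin n)) (θ : ℝ) :
    Set (EuclideanSpace ℝ (Fin n)) :=
  {y | ∃ ρ t : ℝ, 0 < ρ ∧ 0 < t ∧ t < θ ∧
    inner ℝ e₁ y = ρ * Real.cos t ∧ inner ℝ e₂ y = ρ * Real.sin t}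

/-- Near `x`, the set `Ω` is a wedge with `x` on its edge, of opening angle in `(0, 2π) \ {π}`.
In the plane: `x` is a vertex (corner) of `Ω`. In space: `x` lies on an edge of `Ω`. -/
def IsCornerOrEdgePoint {n : ℕ} (Ω : Set (EuclideanSpace ℝ (Fin n)))
    (x : EuclideanSpace ℝ (Fin n)) : Prop :=
  ∃ (e₁ e₂ : EuclideanSpace ℝ (Fin n)) (θ r : ℝ),
    ‖e₁‖ = 1 ∧ ‖e₂‖ = 1 ∧ inner ℝ e₁ e₂ = 0 ∧
    0 < θ ∧ θ < 2 * Real.pi ∧ θ ≠ Real.pi ∧ 0 < r ∧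
    Ω ∩ Metric.ball x r = {y | y - x ∈ wedge e₁ e₂ θ} ∩ Metric.ball x r

/-- Near `x`, the set `Ω` is an open half-space with `x` on its boundary. -/
def IsFlatBoundaryPoint {n : ℕ} (Ω : Set (EuclideanSpace ℝ (Fin n)))
    (x : EuclideanSpace ℝ (Fin n)) : Prop :=
  ∃ (ν : EuclideanSpace ℝ (Fin n)) (r : ℝ), ‖ν‖ = 1 ∧ 0 < r ∧
    Ω ∩ Metric.ball x r = {y | 0 < inner ℝ ν (y - x)} ∩ Metric.ball x r

/-- `x` is a vertex of the solid `Ω ⊆ ℝ³`: near `x`, the set `Ω` is a connected polyhedral cone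
(convex or not) with apex `x`, whose boundary away from the apex consists of flat points and of
edge points, the latter being present; and `x` is not itself an interior point of an edge.
(In the plane no point satisfies this: vertices there are `IsCornerOrEdgePoint`.) -/
def IsPolyhedralVertex {n : ℕ} (Ω : Set (EuclideanSpace ℝ (Fin n)))
    (x : EuclideanSpace ℝ (Fin n)) : Prop :=
  ¬ IsCornerOrEdgePoint Ω x ∧
  ∃ (K : Set (EuclideanSpace ℝ (Fin n))) (r : ℝ),
    IsConnected K ∧ (∀ t : ℝ, 0 < t → ∀ y ∈ K, t • y ∈ K) ∧ 0 < r ∧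
    Ω ∩ Metric.ball x r = {y | y - x ∈ K} ∩ Metric.ball x r ∧
    (∀ y ∈ frontier Ω ∩ Metric.ball x r, y ≠ x →
      IsFlatBoundaryPoint Ω y ∨ IsCornerOrEdgePoint Ω y) ∧
    ∃ y ∈ Metric.ball x r, y ≠ x ∧ IsCornerOrEdgePoint Ω y

/-- `f ∈ C^α(closure (Ω ∩ B))` for some ball `B` centred at `x`, up to a null set of `Ω ∩ B`. -/
def IsHolderNear {n : ℕ} (Ω : Set (EuclideanSpace ℝ (Fin n)))
    (f : EuclideanSpace ℝ (Fin n) → ℂ) (α : ℝ≥0) (x : EuclideanSpace ℝ (Fin n)) : Prop :=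
  ∃ r : ℝ, 0 < r ∧ ∃ (g : EuclideanSpace ℝ (Fin n) → ℂ) (C : ℝ≥0),
    HolderOnWith C α g (closure (Ω ∩ Metric.ball x r)) ∧
    f =ᵐ[volume.restrict (Ω ∩ Metric.ball x r)] g

/-- `f(x) = a` at a point `x` of the closure of `Ω`, for a function `f` given almost everywhere
on `Ω`: near `x`, `f` has a representative that is continuous up to the boundary of `Ω`, and the
value of this representative at `x` is `a`. -/
def HasValueAt {n : ℕ} (Ω : Set (EuclideanSpace ℝ (Fin n)))
    (f : EuclideanSpace ℝ (Fin n) → ℂ) (x : EuclideanSpace ℝ (Fin n)) (a : ℂ) : Prop :=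
  ∃ r : ℝ, 0 < r ∧ ∃ g : EuclideanSpace ℝ (Fin n) → ℂ,
    ContinuousOn g (closure Ω ∩ Metric.ball x r) ∧
    f =ᵐ[volume.restrict (Ω ∩ Metric.ball x r)] g ∧ g x = a

end

-- Put u = v - w. Extended by zero, u belongs to H² of the whole space, and Δu = -k²(u + V v) almost
-- everywhere in Ω. Below dimension four H² functions are continuous, which gives v and w boundary
-- values near x_c (`exists_hasValueAt`). At a corner or edge point the zero extension of u vanishes
-- on exterior balls accumulating there, so u tends to 0 (`tendsto_zero_of_corner`). Thus v and w
-- share a value a, and Δu tends to f₀ = -k² V(x_c) a. It remains to show f₀ = 0.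
--
-- This is a local fact about sectors (`eq_zero_of_solidSector`): if ΔU = F across a solid sector of
-- opening θ ≠ π, with U and F zero outside it near the apex, then the limit f₀ of F at the apex is
-- 0. Let b be the bisector, ζ the complex coordinate of the plane of the sector, and h = ζ² /
-- ‖x‖^(n+2), which is harmonic and homogeneous of degree -n. Test the equation with χ(x) h(x + εb);
-- its pole -εb lies outside the sector. The side with U stays bounded as ε → 0, because h is
-- harmonic and only derivatives of the cutoff χ survive
-- (`exists_norm_integral_mul_singularHarmonic_le`). The other side is f₀ ∫ χ h(· + εb) up to an
-- error o(log(1/ε)), and the degree -n makes this integral grow like L log(1/ε)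
-- (`IsShiftedCone.tendsto_div`). The coefficient L is a positive multiple of sin θ
-- (`integral_sub_mul_singularHarmonic_ne_zero`), so f₀ must vanish. The angle π is a genuine
-- exception: t²/2 on the half-space t > 0, extended by zero, is locally H² and has Laplacian 1
-- inside.
--
-- At a vertex in space, each edge is locally a ray issuing from the apex. The edge result applies
-- at the points of such a ray near the apex, and continuity up to the boundary carries the zero to
-- the apex.
--
-- The boundary values come from a second-order Taylor formula averaged against a smooth kernel,
-- which gives continuity up to the closure of any bounded convex open set
-- (`HasH2Derivs.exists_continuousOn_closure`). Corners, edges and flat points are covered by two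
-- overlapping convex pieces; at a vertex the limits along convex subcones are matched by
-- connectedness and made uniform by compactness (`exists_tendsto_apex`).

local notation "𝔼" n => EuclideanSpace ℝ (Fin n)

/-! ### Calculus of partial derivatives and test functions. -/

section PartialDerivatives

variable {n : ℕ}

lemma partialDeriv_mul {f g : (𝔼 n) → ℂ} {x : 𝔼 n} (hf : DifferentiableAt ℝ f x)
    (hg : DifferentiableAt ℝ g x) (i : Fin n) :
    partialDeriv i (fun y => f y * g y) x = partialDeriv i f x * g x + f x * partialDeriv i g x := by
  simp only [partialDeriv]
  rw [fderiv_fun_mul hf hg]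
  simp [mul_comm, add_comm]

lemma fderiv_apply_eq_sum_partialDeriv (f : (𝔼 n) → ℂ) (x y : 𝔼 n) :
    fderiv ℝ f x y = ∑ i, (y i : ℂ) * partialDeriv i f x := by
  conv_lhs => rw [← (EuclideanSpace.basisFun (Fin n) ℝ).sum_repr y]
  simp [partialDeriv, map_sum]

lemma partialDeriv_comp_homothety {f : (𝔼 n) → ℂ} (x : 𝔼 n) (c : ℝ) (ξ : 𝔼 n) (i : Fin n)
    (hf : DifferentiableAt ℝ f (x + c • (ξ - x))) :
    partialDeriv i (fun η => f (x + c • (η - x))) ξ = c * partialDeriv i f (x + c • (ξ - x)) := by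
  have h1 : HasFDerivAt (fun η : 𝔼 n => x + c • (η - x)) (c • ContinuousLinearMap.id ℝ (𝔼 n)) ξ :=
    (((hasFDerivAt_id ξ).sub_const x).const_smul c).const_add x
  have h2 := hf.hasFDerivAt.comp ξ h1
  have h3 : fderiv ℝ (fun η => f (x + c • (η - x))) ξ = _ := h2.fderiv
  simp [partialDeriv, h3]

lemma contDiff_partialDeriv {f : (𝔼 n) → ℂ} (hf : ContDiff ℝ ∞ f) (i : Fin n) :
    ContDiff ℝ ∞ (partialDeriv i f) :=
  (hf.fderiv_right (m := ∞) (by simp)).clm_apply contDiff_const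

lemma tsupport_partialDeriv_subset (f : (𝔼 n) → ℂ) (i : Fin n) :
    tsupport (partialDeriv i f) ⊆ tsupport f := by
  refine closure_minimal (fun x hx => ?_) (isClosed_tsupport f)
  by_contra h
  apply hx
  have : fderiv ℝ f x = 0 := by
    by_contra h'
    exact h (support_fderiv_subset ℝ h')
  simp [partialDeriv, this]

lemma IsTestFunction.partialDeriv {U : Set (𝔼 n)} {φ : (𝔼 n) → ℂ} (hφ : IsTestFunction U φ)
    (i : Fin n) : IsTestFunction U (partialDeriv i φ) where
  contDiff := contDiff_partialDeriv hφ.contDiff i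
  hasCompactSupport := hφ.hasCompactSupport.mono'
    ((subset_tsupport _).trans (tsupport_partialDeriv_subset φ i))
  tsupport_subset := (tsupport_partialDeriv_subset φ i).trans hφ.tsupport_subset

lemma IsTestFunction.mono {U U' : Set (𝔼 n)} {φ : (𝔼 n) → ℂ} (hφ : IsTestFunction U φ)
    (h : U ⊆ U') : IsTestFunction U' φ :=
  ⟨hφ.contDiff, hφ.hasCompactSupport, hφ.tsupport_subset.trans h⟩

lemma IsTestFunction.exists_bound {U : Set (𝔼 n)} {φ : (𝔼 n) → ℂ} (hφ : IsTestFunction U φ) :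
    ∃ M, 0 ≤ M ∧ ∀ x, ‖φ x‖ ≤ M := by
  obtain ⟨M, hM⟩ := hφ.contDiff.continuous.bounded_above_of_compact_support hφ.hasCompactSupport
  exact ⟨M, (norm_nonneg _).trans (hM 0), hM⟩

lemma laplacian_eq_sum_partialDeriv {f : (𝔼 n) → ℂ} (hf : ContDiff ℝ ∞ f) (x : 𝔼 n) :
    Δ f x = ∑ i, partialDeriv i (partialDeriv i f) x := by
  rw [InnerProductSpace.laplacian_eq_iteratedFDeriv_orthonormalBasis f
    (EuclideanSpace.basisFun (Fin n) ℝ)]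
  refine Finset.sum_congr rfl fun i _ => ?_
  rw [iteratedFDeriv_two_apply]
  have hd : DifferentiableAt ℝ (fderiv ℝ f) x :=
    ((hf.fderiv_right (m := ∞) (by simp)).differentiable (by simp)) x
  have h1 : fderiv ℝ (partialDeriv i f) x = _ :=
    fderiv_clm_apply hd (differentiableAt_const (EuclideanSpace.single i (1 : ℝ)))
  rw [partialDeriv, h1]
  simp

end PartialDerivatives

/-! ### Kernels transplanted by homotheties. -/

section ScaledKernel

variable {n : ℕ}

/-- The function `ρ`, transplanted by the homothety of ratio `s` centred at `x`, and normalized to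
have the same integral. -/
noncomputable def scaledKernel (ρ : (𝔼 n) → ℂ) (x : 𝔼 n) (s : ℝ) (ξ : 𝔼 n) : ℂ :=
  ((s⁻¹ ^ n : ℝ) : ℂ) * ρ (x + s⁻¹ • (ξ - x))

/-- The function `ρ` times the `i`-th coordinate centred at `x`. -/
noncomputable def coordMul (ρ : (𝔼 n) → ℂ) (x : 𝔼 n) (i : Fin n) (q : 𝔼 n) : ℂ :=
  ρ q * ((q i - x i : ℝ) : ℂ)

lemma IsTestFunction.coordMul {U : Set (𝔼 n)} {ρ : (𝔼 n) → ℂ} (hρ : IsTestFunction U ρ)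
    (x : 𝔼 n) (i : Fin n) : IsTestFunction U (coordMul ρ x i) where
  contDiff := by
    have h : ContDiff ℝ ∞ (fun q : 𝔼 n => q i - x i) := by fun_prop
    exact hρ.contDiff.mul (Complex.ofRealCLM.contDiff.comp h)
  hasCompactSupport := hρ.hasCompactSupport.mul_right
  tsupport_subset := (tsupport_mul_subset_left).trans hρ.tsupport_subset

/-- Contraction towards a point x of the closure keeps a convex open set inside itself, since s • q
+ (1 - s) • x is interior for interior q. Hence averages centred even at a boundary point only see
values of the function in `D`. -/
lemma IsTestFunction.comp_homothety {D : Set (𝔼 n)} (hD : IsOpen D) (hDc : Convex ℝ D)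
    {ρ : (𝔼 n) → ℂ} (hρ : IsTestFunction D ρ) {x : 𝔼 n} (hx : x ∈ closure D) {s : ℝ}
    (hs : 0 < s) (hs1 : s ≤ 1) : IsTestFunction D (fun ξ => ρ (x + s⁻¹ • (ξ - x))) := by
  have hK : IsCompact ((fun q => x + s • (q - x)) '' tsupport ρ) :=
    hρ.hasCompactSupport.isCompact.image (by fun_prop)
  have h0 : ∀ ξ, ξ ∉ (fun q => x + s • (q - x)) '' tsupport ρ →
      ρ (x + s⁻¹ • (ξ - x)) = 0 := by
    intro ξ hξ
    by_contra h
    refine hξ ⟨x + s⁻¹ • (ξ - x), subset_tsupport _ h, ?_⟩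
    simp [smul_smul, hs.ne']
  refine ⟨hρ.contDiff.comp (by fun_prop), HasCompactSupport.intro hK h0, ?_⟩
  refine (closure_minimal (fun ξ hξ => ?_) hK.isClosed).trans ?_
  · by_contra h
    exact hξ (h0 ξ h)
  · rintro _ ⟨q, hq, rfl⟩
    have hqD := hρ.tsupport_subset hq
    have := hDc.combo_interior_closure_mem_interior (x := q) (y := x) (by rwa [hD.interior_eq]) hx
      (a := s) (b := 1 - s) hs (by linarith) (by ring)
    rw [hD.interior_eq] at this
    convert this using 1
    simp only [smul_sub, sub_smul, one_smul]
    abel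

lemma hasDerivAt_scaledKernel {ρ : (𝔼 n) → ℂ} (hρ : Differentiable ℝ ρ) (x ξ : 𝔼 n) {s : ℝ}
    (hs : 0 < s) :
    HasDerivAt (fun s => scaledKernel ρ x s ξ)
      (-((s⁻¹ * s⁻¹ ^ n : ℝ) : ℂ) * (n * ρ (x + s⁻¹ • (ξ - x)) +
        fderiv ℝ ρ (x + s⁻¹ • (ξ - x)) (s⁻¹ • (ξ - x)))) s := by
  have h1 : HasDerivAt (fun s : ℝ => s⁻¹) (-(s ^ 2)⁻¹) s := hasDerivAt_inv hs.ne'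
  have h2 : HasDerivAt (fun s : ℝ => x + s⁻¹ • (ξ - x)) ((-(s ^ 2)⁻¹) • (ξ - x)) s :=
    (h1.smul_const _).const_add x
  have h3 := (hρ (x + s⁻¹ • (ξ - x))).hasFDerivAt.comp_hasDerivAt s h2
  have h4 : HasDerivAt (fun s : ℝ => ((s⁻¹ ^ n : ℝ) : ℂ)) ((-(n * (s⁻¹ * s⁻¹ ^ n)) : ℝ) : ℂ) s := by
    apply HasDerivAt.ofReal_comp
    refine (h1.fun_pow n).congr_deriv ?_
    generalize n = d
    rcases d with _ | m
    · simp
    · rw [Nat.add_sub_cancel, ← inv_pow]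
      ring
  have h5 := h4.mul h3
  refine h5.congr_deriv ?_
  simp only [Function.comp, map_smul]
  simp only [Complex.real_smul]
  push_cast
  ring

/-- The left side is the divergence of the transplanted field ρ(q)(q - x). Compared with
`hasDerivAt_scaledKernel`, it shows that the scale derivative of the kernel is minus the divergence
of the field whose components are the scaled kernels of `coordMul ρ x i`, so that it can be
integrated by parts weakly. -/
lemma sum_partialDeriv_coordMul {ρ : (𝔼 n) → ℂ} (hρ : ContDiff ℝ ∞ ρ) (x ξ : 𝔼 n) (s : ℝ) :
    ∑ i, partialDeriv i (fun η => coordMul ρ x i (x + s⁻¹ • (η - x))) ξ =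
      (s⁻¹ : ℝ) * (n * ρ (x + s⁻¹ • (ξ - x)) +
        fderiv ℝ ρ (x + s⁻¹ • (ξ - x)) (s⁻¹ • (ξ - x))) := by
  set q := x + s⁻¹ • (ξ - x) with hq
  have hd : Differentiable ℝ ρ := hρ.differentiable (by simp)
  have hc : ∀ i, Differentiable ℝ (fun q : 𝔼 n => ((q i - x i : ℝ) : ℂ)) := by
    intro i
    have h : Differentiable ℝ (fun q : 𝔼 n => q i - x i) := by fun_prop
    exact Complex.ofRealCLM.differentiable.comp h
  have h1 : ∀ i, partialDeriv i (fun η => coordMul ρ x i (x + s⁻¹ • (η - x))) ξ =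
      (s⁻¹ : ℝ) * (partialDeriv i ρ q * ((q i - x i : ℝ) : ℂ) + ρ q) := by
    intro i
    have hcm : Differentiable ℝ (coordMul ρ x i) := hd.mul (hc i)
    rw [partialDeriv_comp_homothety x s⁻¹ ξ i (hcm _)]
    have h2 : partialDeriv i (coordMul ρ x i) q = _ := partialDeriv_mul (hd q) (hc i q) i
    rw [h2]
    congr 2
    have h3 : partialDeriv i (fun q : 𝔼 n => ((q i - x i : ℝ) : ℂ)) q = 1 := by
      have h4 : HasFDerivAt (fun q : 𝔼 n => ((q i - x i : ℝ) : ℂ))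
          (Complex.ofRealCLM ∘L (EuclideanSpace.proj i : (𝔼 n) →L[ℝ] ℝ)) q :=
        Complex.ofRealCLM.hasFDerivAt.comp q
          ((EuclideanSpace.proj i : (𝔼 n) →L[ℝ] ℝ).hasFDerivAt.sub_const (x i))
      rw [partialDeriv, h4.fderiv]
      simp
    rw [h3, mul_one]
  rw [Finset.sum_congr rfl fun i _ => h1 i, ← Finset.mul_sum, Finset.sum_add_distrib,
    fderiv_apply_eq_sum_partialDeriv]
  have h6 : ∀ i, q i - x i = (s⁻¹ • (ξ - x)) i := by intro i; simp [hq]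
  simp only [h6, Finset.sum_const, Finset.card_univ, Fintype.card_fin, nsmul_eq_mul]
  rw [add_comm]
  congr 2
  exact Finset.sum_congr rfl fun i _ => mul_comm _ _

end ScaledKernel

/-! ### Averages against scaled kernels and their scale derivatives. -/

section KernelIntegrals

variable {n : ℕ}

lemma integrable_of_memLp_two {D : Set (𝔼 n)} (hDb : Bornology.IsBounded D) {v : (𝔼 n) → ℂ}
    (hv : MemLp v 2 (volume.restrict D)) : IntegrableOn v D := by
  have : IsFiniteMeasure (volume.restrict D) := ⟨by simpa using hDb.measure_lt_top⟩
  exact hv.integrable (by norm_num)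

lemma integral_comp_homothety {F : Type*} [NormedAddCommGroup F] [NormedSpace ℝ F]
    (f : (𝔼 n) → F) (x : 𝔼 n) {c : ℝ} (hc : 0 < c) :
    ∫ ξ, f (x + c • (ξ - x)) = (c ^ n)⁻¹ • ∫ q, f q := by
  have h1 : ∀ ξ, f (x + c • (ξ - x)) = (fun η => f (η + (x - c • x))) (c • ξ) := by
    intro ξ
    simp only [smul_sub]
    congr 1
    abel
  simp_rw [h1]
  rw [Measure.integral_comp_smul volume (fun η => f (η + (x - c • x))) c,
    integral_add_right_eq_self f]
  simp [abs_of_pos hc]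

lemma integrable_comp_homothety {F : Type*} [NormedAddCommGroup F]
    {f : (𝔼 n) → F} (hf : Integrable f) (x : 𝔼 n) {c : ℝ} (hc : 0 < c) :
    Integrable (fun ξ => f (x + c • (ξ - x))) := by
  have h1 : ∀ ξ, f (x + c • (ξ - x)) = (fun η => f (η + (x - c • x))) (c • ξ) := by
    intro ξ
    simp only [smul_sub]
    congr 1
    abel
  simp_rw [h1]
  exact (integrable_comp_smul_iff volume _ hc.ne').2 (hf.comp_add_right _)

lemma IsTestFunction.integrable_mul {U D : Set (𝔼 n)} {φ v : (𝔼 n) → ℂ}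
    (hφ : IsTestFunction U φ) (hv : IntegrableOn v D) :
    IntegrableOn (fun ξ => v ξ * φ ξ) D := by
  obtain ⟨M, -, hM⟩ := hφ.exists_bound
  exact hv.mul_bdd hφ.contDiff.continuous.aestronglyMeasurable (Eventually.of_forall hM)

lemma continuous_scaledKernel {ρ : (𝔼 n) → ℂ} (hρ : Continuous ρ) (x : 𝔼 n) (s : ℝ) :
    Continuous (scaledKernel ρ x s) := by
  unfold scaledKernel
  fun_prop

lemma norm_scaledKernel_le {ρ : (𝔼 n) → ℂ} {M : ℝ} (hM : ∀ q, ‖ρ q‖ ≤ M) (x : 𝔼 n) {s : ℝ}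
    (hs : 0 < s) (ξ : 𝔼 n) : ‖scaledKernel ρ x s ξ‖ ≤ s⁻¹ ^ n * M := by
  rw [scaledKernel, norm_mul, Complex.norm_real, Real.norm_of_nonneg (by positivity)]
  gcongr
  exact hM _

/-- Integration of `v` over `D` against the transplanted kernel. -/
noncomputable def kernelIntegral (D : Set (𝔼 n)) (v ρ : (𝔼 n) → ℂ) (x : 𝔼 n) (s : ℝ) : ℂ :=
  ∫ ξ in D, v ξ * scaledKernel ρ x s ξ

/-- After ξ = x + s(q - x) the average reads ∫ v(x + s(q - x)) ρ(q) dq, whose formal derivative is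
the average of ∇v · (q - x). As `v` is only weakly differentiable, the derivative is taken on the
kernel and then moved to `v`. The result has the same shape, so the lemma can be iterated. -/
lemma hasDerivAt_kernelIntegral {D : Set (𝔼 n)} (hD : IsOpen D) (hDc : Convex ℝ D)
    {v : (𝔼 n) → ℂ} {G : Fin n → (𝔼 n) → ℂ}
    (hv : IntegrableOn v D) (hvG : ∀ i, IsWeakPartial D i v (G i))
    {ρ : (𝔼 n) → ℂ} (hρ : IsTestFunction D ρ) {x : 𝔼 n} (hx : x ∈ closure D) {s : ℝ}
    (hs : 0 < s) (hs1 : s ≤ 1) :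
    HasDerivAt (kernelIntegral D v ρ x) (∑ i, kernelIntegral D (G i) (coordMul ρ x i) x s) s := by
  have hd : Differentiable ℝ ρ := hρ.contDiff.differentiable (by simp)
  -- The expression is a sum of derivatives of test functions, by the divergence formula at scale 1,
  -- hence bounded.
  obtain ⟨M, hM0, hM⟩ : ∃ M, 0 ≤ M ∧ ∀ q, ‖n * ρ q + fderiv ℝ ρ q (q - x)‖ ≤ M := by
    choose M hM0 hM using fun i => ((hρ.coordMul x i).partialDeriv i).exists_bound
    refine ⟨∑ i, M i, Finset.sum_nonneg fun i _ => hM0 i, fun q => ?_⟩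
    have h := sum_partialDeriv_coordMul hρ.contDiff x q 1
    simp only [inv_one, one_smul, add_sub_cancel, Complex.ofReal_one, one_mul] at h
    rw [← h]
    exact (norm_sum_le _ _).trans (Finset.sum_le_sum fun i _ => hM i q)
  obtain ⟨M₀, -, hM₀⟩ := hρ.exists_bound
  set F' : ℝ → (𝔼 n) → ℂ := fun t ξ => v ξ * (-((t⁻¹ * t⁻¹ ^ n : ℝ) : ℂ) *
    (n * ρ (x + t⁻¹ • (ξ - x)) + fderiv ℝ ρ (x + t⁻¹ • (ξ - x)) (t⁻¹ • (ξ - x)))) with hF'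
  have hcont : ∀ t : ℝ, Continuous (fun ξ : 𝔼 n => -((t⁻¹ * t⁻¹ ^ n : ℝ) : ℂ) *
    (n * ρ (x + t⁻¹ • (ξ - x)) + fderiv ℝ ρ (x + t⁻¹ • (ξ - x)) (t⁻¹ • (ξ - x)))) := by
    intro t
    have h1 : Continuous (fderiv ℝ ρ) := hρ.contDiff.continuous_fderiv (by simp)
    have h2 := hρ.contDiff.continuous
    fun_prop
  -- Scales t > s / 2 stay away from zero, which makes the dominating function independent of t.
  have hmain := hasDerivAt_integral_of_dominated_loc_of_deriv_le (𝕜 := ℝ)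
    (μ := volume.restrict D) (F := fun t ξ => v ξ * scaledKernel ρ x t ξ) (F' := F') (x₀ := s)
    (s := Ioi (s / 2)) (bound := fun ξ => ‖v ξ‖ * (((s / 2)⁻¹ * (s / 2)⁻¹ ^ n) * M))
    (Ioi_mem_nhds (by linarith))
    (Eventually.of_forall fun t => hv.aestronglyMeasurable.mul
      (continuous_scaledKernel hρ.contDiff.continuous x t).aestronglyMeasurable)
    (hv.mul_bdd
      (continuous_scaledKernel hρ.contDiff.continuous x s).aestronglyMeasurable
      (Eventually.of_forall fun ξ => norm_scaledKernel_le hM₀ x hs ξ))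
    (hv.aestronglyMeasurable.mul (hcont s).aestronglyMeasurable)
    (by
      refine Eventually.of_forall fun ξ t ht => ?_
      have ht' : s / 2 < t := ht
      have ht0 : 0 < t := by linarith
      rw [hF', norm_mul, norm_mul, norm_neg, Complex.norm_real,
        Real.norm_of_nonneg (by positivity)]
      have h2 := hM (x + t⁻¹ • (ξ - x))
      rw [add_sub_cancel_left] at h2
      have h3 : t⁻¹ ≤ (s / 2)⁻¹ := inv_anti₀ (by linarith) ht'.le
      gcongr)
    (hv.norm.mul_const _)
    (by
      refine Eventually.of_forall fun ξ t ht => ?_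
      have ht' : s / 2 < t := ht
      exact (hasDerivAt_scaledKernel hd x ξ (by linarith)).const_mul (v ξ))
  refine hmain.2.congr_deriv ?_
  have htest : ∀ i, IsTestFunction D (fun ξ => coordMul ρ x i (x + s⁻¹ • (ξ - x))) := fun i =>
    (hρ.coordMul x i).comp_homothety hD hDc hx hs hs1
  have h1 : ∀ ξ, F' s ξ = ∑ i, -((s⁻¹ ^ n : ℝ) : ℂ) *
      (v ξ * partialDeriv i (fun η => coordMul ρ x i (x + s⁻¹ • (η - x))) ξ) := by
    intro ξ
    rw [← Finset.mul_sum, ← Finset.mul_sum, sum_partialDeriv_coordMul hρ.contDiff, hF']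
    push_cast
    ring
  simp_rw [h1]
  rw [integral_finsetSum _ fun i _ => (((htest i).partialDeriv i).integrable_mul hv).const_mul _]
  refine Finset.sum_congr rfl fun i _ => ?_
  rw [integral_const_mul, hvG i _ (htest i), kernelIntegral, neg_mul_neg, ← integral_const_mul]
  refine integral_congr_ae (Eventually.of_forall fun ξ => ?_)
  simp only [scaledKernel]
  ring

lemma integrable_norm_sq {ρ : (𝔼 n) → ℂ} (hρ : Continuous ρ) (hρc : HasCompactSupport ρ) :
    Integrable (fun q => ‖ρ q‖ ^ 2) := by
  refine (hρ.norm.pow 2).integrable_of_hasCompactSupport (HasCompactSupport.intro hρc ?_)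
  intro x hx
  simp [image_eq_zero_of_notMem_tsupport hx]

/-- A Cauchy–Schwarz type estimate: the kernel has L² size of order s^(-n/2), and s · s^(-n/2) ≤
s^(-1/2) for n ≤ 3. This bound is integrable at s = 0, and it is where the restriction on the
dimension enters. -/
lemma mul_norm_kernelIntegral_le (hn : n < 4) {D : Set (𝔼 n)} {H ρ : (𝔼 n) → ℂ}
    (hH : MemLp H 2 (volume.restrict D)) (hρ : Continuous ρ) (hρc : HasCompactSupport ρ)
    {R : ℝ} (hR : ∫ q, ‖ρ q‖ ^ 2 ≤ R) (x : 𝔼 n) {s : ℝ} (hs : 0 < s) (hs1 : s ≤ 1) :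
    s * ‖kernelIntegral D H ρ x s‖ ≤ ((∫ ξ in D, ‖H ξ‖ ^ 2) + R) * (√s)⁻¹ := by
  set t := s⁻¹ with ht
  have ht1 : 1 ≤ t := (one_le_inv₀ hs).2 hs1
  have ht0 : 0 < t := by positivity
  -- The balancing weight s^(-n/2) for Young's inequality a²pr ≤ a p² + a³ r²: after rescaling, both
  -- terms on the right integrate to order a.
  set a := √(t ^ n) with ha
  have ha2 : a ^ 2 = t ^ n := Real.sq_sqrt (by positivity)
  have ha0 : 0 < a := Real.sqrt_pos.2 (by positivity)
  have hρ2 := integrable_norm_sq hρ hρc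
  have hH2 : IntegrableOn (fun ξ => ‖H ξ‖ ^ 2) D := by
    exact (memLp_two_iff_integrable_sq_norm hH.1).1 hH
  have hk := integrable_comp_homothety hρ2 x ht0
  have h1 : ‖kernelIntegral D H ρ x s‖ ≤
      ∫ ξ in D, (a * ‖H ξ‖ ^ 2 + a ^ 3 * ‖ρ (x + t • (ξ - x))‖ ^ 2) := by
    refine (norm_integral_le_integral_norm _).trans ?_
    refine integral_mono_of_nonneg (Eventually.of_forall fun ξ => norm_nonneg _)
      ((hH2.const_mul a).add (hk.integrableOn.const_mul (a ^ 3)))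
      (Eventually.of_forall fun ξ => ?_)
    simp only [scaledKernel, norm_mul, Complex.norm_real]
    rw [Real.norm_of_nonneg (by positivity), ← ht, ← ha2]
    set p := ‖H ξ‖
    set r := ‖ρ (x + t • (ξ - x))‖
    have hp : 0 ≤ p := norm_nonneg _
    have hr : 0 ≤ r := norm_nonneg _
    nlinarith [mul_nonneg ha0.le (sq_nonneg (p - a * r)), mul_nonneg ha0.le (sq_nonneg p),
      mul_nonneg ha0.le (sq_nonneg (a * r))]
  have h2 : ∫ ξ in D, (a * ‖H ξ‖ ^ 2 + a ^ 3 * ‖ρ (x + t • (ξ - x))‖ ^ 2) ≤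
      a * ((∫ ξ in D, ‖H ξ‖ ^ 2) + R) := by
    rw [integral_add (hH2.const_mul a) (hk.integrableOn.const_mul (a ^ 3)), integral_const_mul,
      integral_const_mul, mul_add]
    have h3 : ∫ ξ in D, ‖ρ (x + t • (ξ - x))‖ ^ 2 ≤ (t ^ n)⁻¹ * R := by
      refine (setIntegral_le_integral hk (Eventually.of_forall fun _ => by positivity)).trans ?_
      rw [integral_comp_homothety (fun q => ‖ρ q‖ ^ 2) x ht0, smul_eq_mul]
      gcongr
    have h4 : a ^ 3 * ((t ^ n)⁻¹ * R) = a * R := by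
      rw [← ha2]
      field_simp
    have h5 : a ^ 3 * ∫ ξ in D, ‖ρ (x + t • (ξ - x))‖ ^ 2 ≤ a * R := by
      rw [← h4]
      gcongr
    linarith
  have h6 : s * a ≤ (√s)⁻¹ := by
    have h7 : a ≤ t * √t := by
      rw [ha, show t * √t = √(t ^ 3) by
        rw [pow_succ, Real.sqrt_mul (by positivity), Real.sqrt_sq ht0.le]]
      exact Real.sqrt_le_sqrt (pow_le_pow_right₀ ht1 (by omega))
    calc s * a ≤ s * (t * √t) := by gcongr
      _ = (√s)⁻¹ := by rw [← mul_assoc, ht, mul_inv_cancel₀ hs.ne', one_mul, Real.sqrt_inv]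
  have h0 : 0 ≤ (∫ ξ in D, ‖H ξ‖ ^ 2) + R :=
    add_nonneg (integral_nonneg fun _ => by positivity)
      ((integral_nonneg fun _ => by positivity).trans hR)
  calc s * ‖kernelIntegral D H ρ x s‖ ≤ s * (a * ((∫ ξ in D, ‖H ξ‖ ^ 2) + R)) := by
        gcongr
        exact h1.trans h2
    _ = ((∫ ξ in D, ‖H ξ‖ ^ 2) + R) * (s * a) := by ring
    _ ≤ _ := by gcongr

lemma continuousOn_integral_mul {D S : Set (𝔼 n)} (hD : MeasurableSet D) {v : (𝔼 n) → ℂ}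
    (hv : IntegrableOn v D)
    {k : (𝔼 n) → (𝔼 n) → ℂ} (hk : Continuous (fun p : (𝔼 n) × (𝔼 n) => k p.1 p.2)) {M : ℝ}
    (hM : ∀ x ∈ S, ∀ ξ ∈ D, ‖k x ξ‖ ≤ M) :
    ContinuousOn (fun x => ∫ ξ in D, v ξ * k x ξ) S := by
  refine continuousOn_of_dominated (bound := fun ξ => ‖v ξ‖ * M) (fun x _ => ?_) (fun x hx => ?_)
    (hv.norm.mul_const M) (Eventually.of_forall fun ξ => ?_)
  · exact hv.aestronglyMeasurable.mul (hk.comp (f := fun ξ => (x, ξ))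
      (by fun_prop)).aestronglyMeasurable
  · filter_upwards [ae_restrict_mem hD] with ξ hξ
    rw [norm_mul]
    gcongr
    exact hM x hx ξ hξ
  · exact (continuous_const.mul (hk.comp (g := fun p : (𝔼 n) × (𝔼 n) => k p.1 p.2)
      (f := fun x => (x, ξ)) (by fun_prop))).continuousOn

end KernelIntegrals

/-! ### Continuity of H² functions up to the boundary of convex sets. -/

section ConvexSobolev

variable {n : ℕ}

/-- Transplanted kernels are an approximation of the identity at almost every point. -/
lemma ae_tendsto_integral_scaledKernel {f : (𝔼 n) → ℂ} (hf : LocallyIntegrable f) :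
    ∀ᵐ x : 𝔼 n, ∀ ρ : (𝔼 n) → ℂ, Continuous ρ → HasCompactSupport ρ →
      ∀ s : ℕ → ℝ, Tendsto s atTop (𝓝[>] 0) →
        Tendsto (fun m => ∫ ξ, f ξ * scaledKernel ρ x (s m) ξ) atTop (𝓝 (f x * ∫ q, ρ q)) := by
  filter_upwards [IsUnifLocDoublingMeasure.ae_tendsto_average_norm_sub volume hf 1]
    with x hx ρ hρ hρc s hs
  obtain ⟨M, hM⟩ := hρ.bounded_above_of_compact_support hρc
  have hM0 : 0 ≤ M := (norm_nonneg _).trans (hM 0)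
  obtain ⟨R, hR0, hR⟩ : ∃ R, 0 < R ∧ ∀ q, ρ q ≠ 0 → ‖q - x‖ ≤ R := by
    obtain ⟨R, hR⟩ := hρc.isBounded.subset_closedBall x
    refine ⟨max R 1, by positivity, fun q hq => ?_⟩
    have := hR (subset_tsupport _ hq)
    rw [Metric.mem_closedBall, dist_eq_norm] at this
    exact this.trans (le_max_left _ _)
  have hsR : Tendsto (fun m => s m * R) atTop (𝓝[>] 0) := by
    rw [tendsto_nhdsWithin_iff] at hs ⊢
    refine ⟨by simpa using hs.1.mul_const R, ?_⟩
    filter_upwards [hs.2] with m hm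
    exact mul_pos hm hR0
  have havg := hx (fun _ => x) (fun m => s m * R) hsR (by
    have := (tendsto_nhdsWithin_iff.1 hsR).2
    filter_upwards [this] with m hm
    have hm' : 0 < s m * R := hm
    simp [hm'.le])
  rw [tendsto_iff_norm_sub_tendsto_zero]
  -- The kernel is at most s^(-n) M and lives on a ball of radius sR, so the power of s cancels
  -- against the volume of the ball and leaves this constant times the mean oscillation, which tends
  -- to 0 at Lebesgue points.
  have hlim := havg.const_mul (M * R ^ n * volume.real (Metric.closedBall (0 : 𝔼 n) 1))
  rw [mul_zero] at hlim
  refine squeeze_zero' (Eventually.of_forall fun m => norm_nonneg _) ?_ hlim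
  filter_upwards [(tendsto_nhdsWithin_iff.1 hs).2] with m hm
  have hm0 : 0 < s m := hm
  set t := s m
  have hsupp : ∀ ξ, ξ ∉ Metric.closedBall x (t * R) → scaledKernel ρ x t ξ = 0 := by
    intro ξ hξ
    by_contra h
    apply hξ
    have h1 := hR _ (right_ne_zero_of_mul h)
    rw [add_sub_cancel_left, norm_smul, norm_inv, Real.norm_of_nonneg hm0.le,
      inv_mul_le_iff₀ hm0] at h1
    simpa [dist_eq_norm] using h1
  have hkc : Continuous (scaledKernel ρ x t) := continuous_scaledKernel hρ x t
  have hkcs : HasCompactSupport (scaledKernel ρ x t) :=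
    HasCompactSupport.intro (isCompact_closedBall x (t * R)) hsupp
  have hfk : Integrable (fun ξ => f ξ * scaledKernel ρ x t ξ) :=
    hf.integrable_smul_right_of_hasCompactSupport hkc hkcs
  have hk1 : ∫ ξ, scaledKernel ρ x t ξ = ∫ q, ρ q := by
    simp only [scaledKernel]
    rw [integral_const_mul, integral_comp_homothety ρ x (inv_pos.2 hm0), Complex.real_smul,
      ← mul_assoc, ← Complex.ofReal_mul, mul_inv_cancel₀ (by positivity), Complex.ofReal_one,
      one_mul]
  have h1 : (∫ ξ, f ξ * scaledKernel ρ x t ξ) - f x * ∫ q, ρ q =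
      ∫ ξ in Metric.closedBall x (t * R), (f ξ - f x) * scaledKernel ρ x t ξ := by
    rw [← hk1, ← integral_const_mul, ← integral_sub hfk
      ((hkc.integrable_of_hasCompactSupport hkcs).const_mul _)]
    rw [setIntegral_eq_integral_of_forall_compl_eq_zero
      (fun ξ hξ => by rw [hsupp ξ hξ, mul_zero])]
    exact integral_congr_ae (Eventually.of_forall fun ξ => by simp only; ring)
  rw [h1]
  have hint : IntegrableOn (fun ξ => ‖f ξ - f x‖) (Metric.closedBall x (t * R)) :=
    ((hf.integrableOn_isCompact (isCompact_closedBall _ _)).sub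
      (integrableOn_const (isCompact_closedBall _ _).measure_lt_top.ne)).norm
  have h2 : ‖∫ ξ in Metric.closedBall x (t * R), (f ξ - f x) * scaledKernel ρ x t ξ‖ ≤
      ∫ ξ in Metric.closedBall x (t * R), ‖f ξ - f x‖ * (t⁻¹ ^ n * M) := by
    refine (norm_integral_le_integral_norm _).trans
      (integral_mono_of_nonneg (Eventually.of_forall fun ξ => norm_nonneg _)
        (hint.mul_const _) (Eventually.of_forall fun ξ => ?_))
    simp only [norm_mul]
    gcongr
    exact norm_scaledKernel_le hM x hm0 ξ
  refine h2.trans (le_of_eq ?_)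
  have hvol : volume.real (Metric.closedBall x (t * R)) =
      (t * R) ^ n * volume.real (Metric.closedBall (0 : 𝔼 n) 1) := by
    rw [Measure.addHaar_real_closedBall' _ _ (by positivity)]
    simp
  have hvol0 : volume.real (Metric.closedBall x (t * R)) ≠ 0 := by
    rw [measureReal_def]
    exact (ENNReal.toReal_pos (Metric.measure_closedBall_pos _ _ (by positivity)).ne'
      (isCompact_closedBall _ _).measure_lt_top.ne).ne'
  rw [setAverage_eq, smul_eq_mul, integral_mul_const]
  have h3 : M * R ^ n * volume.real (Metric.closedBall (0 : 𝔼 n) 1) =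
      t⁻¹ ^ n * M * volume.real (Metric.closedBall x (t * R)) := by
    rw [hvol, mul_pow, inv_pow]
    field_simp
  rw [h3]
  field_simp

lemma exists_isTestFunction_integral_eq_one {D : Set (𝔼 n)} (hD : IsOpen D) (hne : D.Nonempty) :
    ∃ ρ, IsTestFunction D ρ ∧ ∫ q, ρ q = 1 := by
  obtain ⟨c, hc⟩ := hne
  obtain ⟨r, hr, hrD⟩ := Metric.nhds_basis_closedBall.mem_iff.1 (hD.mem_nhds hc)
  let b : ContDiffBump c := ⟨r / 2, r, by positivity, by linarith⟩
  refine ⟨fun x => (b.normed volume x : ℂ), ⟨?_, ?_, ?_⟩, ?_⟩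
  · exact Complex.ofRealCLM.contDiff.comp b.contDiff_normed
  · exact b.hasCompactSupport_normed.comp_left (g := ((↑) : ℝ → ℂ)) (by simp)
  · refine Subset.trans ?_ hrD
    rw [show r = b.rOut from rfl, ← b.tsupport_normed_eq (μ := volume)]
    exact closure_mono fun x hx h0 => hx (by simp [h0])
  · rw [integral_complex_ofReal, b.integral_normed, Complex.ofReal_one]

/-- `H²` functions on a bounded convex open set of dimension at most three have a representative
that is continuous up to the boundary. -/
theorem HasH2Derivs.exists_continuousOn_closure (hn : n < 4) {D : Set (𝔼 n)} (hD : IsOpen D)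
    (hDc : Convex ℝ D) (hDb : Bornology.IsBounded D) {v : (𝔼 n) → ℂ} {G : Fin n → (𝔼 n) → ℂ}
    {H : Fin n → Fin n → (𝔼 n) → ℂ} (h : HasH2Derivs D v G H) :
    ∃ g : (𝔼 n) → ℂ, ContinuousOn g (closure D) ∧ v =ᵐ[volume.restrict D] g := by
  rcases D.eq_empty_or_nonempty with rfl | hne
  · exact ⟨0, by simp, by simp [EventuallyEq]⟩
  obtain ⟨ρ, hρ, hρ1⟩ := exists_isTestFunction_integral_eq_one hD hne
  have hv := integrable_of_memLp_two hDb h.memLp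
  have hG := fun i => integrable_of_memLp_two hDb (h.memLp_grad i)
  have hH := fun i j => integrable_of_memLp_two hDb (h.memLp_hess i j)
  obtain ⟨d, hd0, hd⟩ : ∃ d, 0 ≤ d ∧ ∀ x ∈ closure D, ∀ q ∈ D, ∀ i, |q i - x i| ≤ d := by
    refine ⟨Metric.diam (closure D), Metric.diam_nonneg, fun x hx q hq i => ?_⟩
    have h1 := Metric.dist_le_diam_of_mem hDb.closure (subset_closure hq) hx
    rw [dist_eq_norm] at h1
    exact (PiLp.norm_apply_le (q - x) i).trans h1
  obtain ⟨M, hM0, hM⟩ := hρ.exists_bound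
  have hcm : ∀ x ∈ closure D, ∀ i, ∀ ρ' : (𝔼 n) → ℂ, IsTestFunction D ρ' → ∀ q,
      ‖coordMul ρ' x i q‖ ≤ d * ‖ρ' q‖ := by
    intro x hx i ρ' hρ' q
    rw [coordMul, norm_mul, Complex.norm_real, mul_comm]
    by_cases hq : ρ' q = 0
    · simp [hq]
    · gcongr
      exact hd x hx q (hρ'.tsupport_subset (subset_tsupport _ hq)) i
  -- The two coordinate factors are bounded by the diameter of the closure, which makes this L²
  -- bound uniform in the centre x.
  set R := d ^ 4 * ∫ q, ‖ρ q‖ ^ 2 with hR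
  have hRb : ∀ x ∈ closure D, ∀ i j, ∫ q, ‖coordMul (coordMul ρ x i) x j q‖ ^ 2 ≤ R := by
    intro x hx i j
    rw [hR, ← integral_const_mul]
    refine integral_mono_of_nonneg (Eventually.of_forall fun _ => by positivity)
      ((integrable_norm_sq hρ.contDiff.continuous hρ.hasCompactSupport).const_mul _)
      (Eventually.of_forall fun q => ?_)
    have h1 := hcm x hx j _ (hρ.coordMul x i) q
    have h2 := hcm x hx i _ hρ q
    calc ‖coordMul (coordMul ρ x i) x j q‖ ^ 2 ≤ (d * (d * ‖ρ q‖)) ^ 2 := by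
          gcongr
          exact h1.trans (by gcongr)
      _ = d ^ 4 * ‖ρ q‖ ^ 2 := by ring
  -- With N(s) the average of `v` at scale s, this is sN' - N, whose derivative is sN'': the
  -- gradient terms cancel and only the Hessian remains, with the factor s that makes it integrable.
  -- At almost every point of `D` it tends to -v(x) as s → 0, since sN' → 0 and ρ has integral 1.
  set Q : (𝔼 n) → ℝ → ℂ := fun x s =>
    s * (∑ i, kernelIntegral D (G i) (coordMul ρ x i) x s) - kernelIntegral D v ρ x s with hQ
  set C := ∑ i, ∑ j, ((∫ ξ in D, ‖H i j ξ‖ ^ 2) + R) with hC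
  have hQd : ∀ x ∈ closure D, ∀ s, 0 < s → s ≤ 1 → HasDerivAt (Q x)
      (s * ∑ i, ∑ j, kernelIntegral D (H i j) (coordMul (coordMul ρ x i) x j) x s) s := by
    intro x hx s hs hs1
    have h1 := hasDerivAt_kernelIntegral hD hDc hv h.weak_grad hρ hx hs hs1
    have h2 : HasDerivAt (fun s => ∑ i, kernelIntegral D (G i) (coordMul ρ x i) x s)
        (∑ i, ∑ j, kernelIntegral D (H i j) (coordMul (coordMul ρ x i) x j) x s) s :=
      HasDerivAt.fun_sum fun i _ => hasDerivAt_kernelIntegral hD hDc (hG i) (h.weak_hess i)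
        (hρ.coordMul x i) hx hs hs1
    have h3 : HasDerivAt (fun s : ℝ => (s : ℂ)) 1 s := (hasDerivAt_id s).ofReal_comp
    refine ((h3.mul h2).sub h1).congr_deriv ?_
    ring
  -- Integrating C s^(-1/2) gives a modulus of Cauchy convergence independent of x. The limit is
  -- therefore uniform on the closure, and continuous there.
  have hQb : ∀ x ∈ closure D, ∀ a b, 0 < a → a ≤ b → b ≤ 1 →
      ‖Q x b - Q x a‖ ≤ 2 * C * (√b - √a) := by
    intro x hx a b ha hab hb
    refine image_norm_le_of_norm_deriv_right_le_deriv_boundary' (f := fun s => Q x s - Q x a)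
      (B := fun s => 2 * C * (√s - √a)) (B' := fun s => C * (√s)⁻¹) (a := a) (b := b)
      (f' := fun s => s * ∑ i, ∑ j,
        kernelIntegral D (H i j) (coordMul (coordMul ρ x i) x j) x s)
      ?_ ?_ ?_ ?_ ?_ ?_ (right_mem_Icc.2 hab)
    · intro s hs
      exact ((hQd x hx s (ha.trans_le hs.1) (hs.2.trans hb)).sub_const _).continuousAt
        |>.continuousWithinAt
    · intro s hs
      exact ((hQd x hx s (ha.trans_le hs.1) (hs.2.le.trans hb)).sub_const _).hasDerivWithinAt
    · simp
    · fun_prop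
    · intro s hs
      have hs0 : 0 < s := ha.trans_le hs.1
      refine (((Real.hasDerivAt_sqrt hs0.ne').sub_const _).const_mul (2 * C)).hasDerivWithinAt
        |>.congr_deriv ?_
      field_simp
    · intro s hs
      have hs0 : 0 < s := ha.trans_le hs.1
      rw [norm_mul, Complex.norm_real, Real.norm_of_nonneg hs0.le]
      calc s * ‖∑ i, ∑ j, kernelIntegral D (H i j) (coordMul (coordMul ρ x i) x j) x s‖
          ≤ s * ∑ i, ∑ j, ‖kernelIntegral D (H i j) (coordMul (coordMul ρ x i) x j) x s‖ := by
            gcongr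
            exact (norm_sum_le _ _).trans (Finset.sum_le_sum fun i _ => norm_sum_le _ _)
        _ = ∑ i, ∑ j, s * ‖kernelIntegral D (H i j) (coordMul (coordMul ρ x i) x j) x s‖ := by
            simp_rw [Finset.mul_sum]
        _ ≤ ∑ i, ∑ j, ((∫ ξ in D, ‖H i j ξ‖ ^ 2) + R) * (√s)⁻¹ := by
            refine Finset.sum_le_sum fun i _ => Finset.sum_le_sum fun j _ => ?_
            have ht := (hρ.coordMul x i).coordMul x j
            exact mul_norm_kernelIntegral_le hn (h.memLp_hess i j) ht.contDiff.continuous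
              ht.hasCompactSupport (hRb x hx i j) x hs0 (hs.2.le.trans hb)
        _ = C * (√s)⁻¹ := by simp_rw [hC, Finset.sum_mul]
  have hC0 : 0 ≤ C := by
    refine Finset.sum_nonneg fun i _ => Finset.sum_nonneg fun j _ => ?_
    have : 0 ≤ ∫ ξ in D, ‖H i j ξ‖ ^ 2 := integral_nonneg fun _ => by positivity
    have : 0 ≤ ∫ q, ‖ρ q‖ ^ 2 := integral_nonneg fun _ => by positivity
    positivity
  set σ : ℕ → ℝ := fun m => 1 / ((m : ℝ) + 1) with hσ
  have hσ0 : ∀ m, 0 < σ m := fun m => by positivity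
  have hσ1 : ∀ m, σ m ≤ 1 := fun m => by
    rw [hσ]
    exact (div_le_one (by positivity)).2 (by simp)
  have hσlim : Tendsto σ atTop (𝓝 0) := tendsto_one_div_add_atTop_nhds_zero_nat
  have hσlim' : Tendsto σ atTop (𝓝[>] 0) :=
    tendsto_nhdsWithin_iff.2 ⟨hσlim, Eventually.of_forall hσ0⟩
  have hcauchy : UniformCauchySeqOn (fun m x => - Q x (σ m)) atTop (closure D) := by
    rw [Metric.uniformCauchySeqOn_iff]
    intro ε hε
    have h1 : Tendsto (fun m => 2 * C * √(σ m)) atTop (𝓝 0) := by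
      have := (Real.continuous_sqrt.tendsto 0).comp hσlim
      rw [Real.sqrt_zero] at this
      simpa using this.const_mul (2 * C)
    obtain ⟨N, hN⟩ := (h1.eventually (gt_mem_nhds hε)).exists_forall_of_atTop
    have key : ∀ x ∈ closure D, ∀ a b, σ a ≤ σ b → 2 * C * √(σ b) < ε →
        dist (- Q x (σ a)) (- Q x (σ b)) < ε := by
      intro x hx a b hab hb
      rw [dist_eq_norm, neg_sub_neg]
      refine (hQb x hx (σ a) (σ b) (hσ0 a) hab (hσ1 b)).trans_lt (lt_of_le_of_lt ?_ hb)
      have : 0 ≤ √(σ a) := Real.sqrt_nonneg _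
      gcongr
      linarith
    refine ⟨N, fun a ha b hb x hx => ?_⟩
    rcases le_total (σ a) (σ b) with hab | hab
    · exact key x hx a b hab (hN b hb)
    · rw [dist_comm]
      exact key x hx b a hab (hN a ha)
  have hlim : ∀ x ∈ closure D, ∃ y, Tendsto (fun m => - Q x (σ m)) atTop (𝓝 y) := fun x hx =>
    cauchySeq_tendsto_of_complete (hcauchy.cauchySeq hx)
  choose! g hg using hlim
  have hunif := hcauchy.tendstoUniformlyOn_of_tendsto hg
  refine ⟨g, hunif.continuousOn (Eventually.of_forall fun m => ?_).frequently, ?_⟩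
  · have hker : Continuous (fun p : (𝔼 n) × (𝔼 n) => scaledKernel ρ p.1 (σ m) p.2) := by
      have := hρ.contDiff.continuous
      unfold scaledKernel
      fun_prop
    have hker' : ∀ i, Continuous (fun p : (𝔼 n) × (𝔼 n) =>
        scaledKernel (coordMul ρ p.1 i) p.1 (σ m) p.2) := by
      intro i
      have := hρ.contDiff.continuous
      unfold scaledKernel coordMul
      fun_prop
    have hc1 : ContinuousOn (fun x => kernelIntegral D v ρ x (σ m)) (closure D) :=
      continuousOn_integral_mul hD.measurableSet hv hker (M := (σ m)⁻¹ ^ n * M)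
        fun x _ ξ _ => norm_scaledKernel_le hM x (hσ0 m) ξ
    have hc2 : ∀ i, ContinuousOn
        (fun x => kernelIntegral D (G i) (coordMul ρ x i) x (σ m)) (closure D) := fun i =>
      continuousOn_integral_mul hD.measurableSet (hG i) (hker' i) (M := (σ m)⁻¹ ^ n * (d * M))
        fun x hx ξ _ => norm_scaledKernel_le
          (fun q => (hcm x hx i ρ hρ q).trans (by gcongr; exact hM q)) x (hσ0 m) ξ
    exact ((continuousOn_const.mul (continuousOn_finsetSum _ fun i _ => hc2 i)).sub hc1).neg
  · have hloc : ∀ f : (𝔼 n) → ℂ, IntegrableOn f D → LocallyIntegrable (D.indicator f) :=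
      fun f hf => (hf.integrable_indicator hD.measurableSet).locallyIntegrable
    have hki : ∀ (f ρ' : (𝔼 n) → ℂ) (x : 𝔼 n) (s : ℝ),
        kernelIntegral D f ρ' x s = ∫ ξ, D.indicator f ξ * scaledKernel ρ' x s ξ := by
      intro f ρ' x s
      rw [kernelIntegral, ← integral_indicator hD.measurableSet]
      congr 1
      ext ξ
      by_cases hξ : ξ ∈ D <;> simp [hξ]
    have h1 := ae_tendsto_integral_scaledKernel (hloc v hv)
    have h2 := ae_all_iff.2 fun i => ae_tendsto_integral_scaledKernel (hloc (G i) (hG i))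
    filter_upwards [ae_restrict_of_ae h1, ae_restrict_of_ae h2, ae_restrict_mem hD.measurableSet]
      with x hx1 hx2 hxD
    refine tendsto_nhds_unique ?_ (hg x (subset_closure hxD))
    have l1 := hx1 ρ hρ.contDiff.continuous hρ.hasCompactSupport σ hσlim'
    have l2 := fun i => hx2 i (coordMul ρ x i) (hρ.coordMul x i).contDiff.continuous
      (hρ.coordMul x i).hasCompactSupport σ hσlim'
    have l3 : Tendsto (fun m => (σ m : ℂ)) atTop (𝓝 0) := by
      have := (Complex.continuous_ofReal.tendsto 0).comp hσlim
      rwa [Complex.ofReal_zero] at this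
    have l4 := (l3.mul (tendsto_finsetSum Finset.univ fun i _ => l2 i)).sub l1
    simp_rw [← hki] at l4
    have l5 := l4.neg
    rw [hρ1, zero_mul, mul_one, zero_sub, neg_neg, indicator_of_mem hxD] at l5
    exact l5

end ConvexSobolev

/-! ### Gluing continuous representatives and extending them to the boundary. -/

section ContinuousRepresentative

variable {n : ℕ}

lemma IsWeakPartial.mono {U U' : Set (𝔼 n)} (hU : MeasurableSet U) (h : U' ⊆ U) {i : Fin n}
    {f g : (𝔼 n) → ℂ} (hfg : IsWeakPartial U i f g) : IsWeakPartial U' i f g := by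
  intro φ hφ
  have h0 : ∀ ψ : (𝔼 n) → ℂ, IsTestFunction U' ψ → ∀ F : (𝔼 n) → ℂ,
      ∫ x in U', F x * ψ x = ∫ x in U, F x * ψ x := by
    intro ψ hψ F
    refine (setIntegral_eq_of_subset_of_forall_sdiff_eq_zero hU h fun x hx => ?_).symm
    rw [image_eq_zero_of_notMem_tsupport fun hx' => hx.2 (hψ.tsupport_subset hx'), mul_zero]
  rw [h0 _ (hφ.partialDeriv i), h0 _ hφ]
  exact hfg φ (hφ.mono h)

lemma HasH2Derivs.mono {U U' : Set (𝔼 n)} (hU : MeasurableSet U) (h : U' ⊆ U)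
    {f : (𝔼 n) → ℂ} {G : Fin n → (𝔼 n) → ℂ} {H : Fin n → Fin n → (𝔼 n) → ℂ}
    (hf : HasH2Derivs U f G H) : HasH2Derivs U' f G H where
  memLp := hf.memLp.mono_measure (Measure.restrict_mono_set _ h)
  memLp_grad i := (hf.memLp_grad i).mono_measure (Measure.restrict_mono_set _ h)
  memLp_hess i j := (hf.memLp_hess i j).mono_measure (Measure.restrict_mono_set _ h)
  weak_grad i := (hf.weak_grad i).mono hU h
  weak_hess i j := (hf.weak_hess i j).mono hU h

lemma MemH2.mono {U U' : Set (𝔼 n)} (hU : MeasurableSet U) (h : U' ⊆ U)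
    {f : (𝔼 n) → ℂ} (hf : MemH2 U f) : MemH2 U' f := by
  obtain ⟨G, H, hf⟩ := hf
  exact ⟨G, H, hf.mono hU h⟩

/-- On every bounded convex open subset of `U`, the function `g` extends continuously to the
boundary. -/
def ExtendsToConvexClosures (U : Set (𝔼 n)) (g : (𝔼 n) → ℂ) : Prop :=
  ∀ D ⊆ U, IsOpen D → Convex ℝ D → Bornology.IsBounded D →
    ∃ g' : (𝔼 n) → ℂ, ContinuousOn g' (closure D) ∧ EqOn g g' D

/-- The function is only given almost everywhere, while one representative must serve every convex
subset. Its value at x is read off a continuous representative on a ball about x. Continuous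
functions that agree almost everywhere on an open set agree everywhere on it, so the choices are
compatible. -/
lemma MemH2.exists_extendsToConvexClosures (hn : n < 4) {U : Set (𝔼 n)} (hU : IsOpen U)
    {v : (𝔼 n) → ℂ} (hv : MemH2 U v) :
    ∃ g, ExtendsToConvexClosures U g ∧ v =ᵐ[volume.restrict U] g := by
  obtain ⟨G, H, hv⟩ := hv
  have hex : ∀ D ⊆ U, IsOpen D → Convex ℝ D → Bornology.IsBounded D →
      ∃ g' : (𝔼 n) → ℂ, ContinuousOn g' (closure D) ∧ v =ᵐ[volume.restrict D] g' :=
    fun D hDU hD hDc hDb =>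
      (hv.mono hU.measurableSet hDU).exists_continuousOn_closure hn hD hDc hDb
  have hball : ∀ x : 𝔼 n, ∃ (r : ℝ) (g' : (𝔼 n) → ℂ), x ∈ U → 0 < r ∧ Metric.ball x r ⊆ U ∧
      ContinuousOn g' (Metric.ball x r) ∧ v =ᵐ[volume.restrict (Metric.ball x r)] g' := by
    intro x
    by_cases hx : x ∈ U
    · obtain ⟨r, hr, hrU⟩ := Metric.isOpen_iff.1 hU x hx
      obtain ⟨g', hg', hvg'⟩ := hex _ hrU Metric.isOpen_ball (convex_ball x r) Metric.isBounded_ball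
      exact ⟨r, g', fun _ => ⟨hr, hrU, hg'.mono subset_closure, hvg'⟩⟩
    · exact ⟨0, 0, fun h => absurd h hx⟩
  choose r g₁ hg₁ using hball
  have hkey : ∀ D ⊆ U, IsOpen D → ∀ g' : (𝔼 n) → ℂ, ContinuousOn g' D →
      v =ᵐ[volume.restrict D] g' → EqOn (fun x => g₁ x x) g' D := by
    intro D hDU hD g' hg' hvg' x hx
    obtain ⟨hr, -, hc, hae⟩ := hg₁ x (hDU hx)
    have h1 : g₁ x =ᵐ[volume.restrict (Metric.ball x (r x) ∩ D)] g' := by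
      filter_upwards [ae_restrict_of_ae_restrict_of_subset inter_subset_left hae,
        ae_restrict_of_ae_restrict_of_subset inter_subset_right hvg'] with y hy hy'
      rw [← hy, hy']
    exact Measure.eqOn_open_of_ae_eq h1 (Metric.isOpen_ball.inter hD)
      (hc.mono inter_subset_left) (hg'.mono inter_subset_right) ⟨Metric.mem_ball_self hr, hx⟩
  refine ⟨fun x => g₁ x x, fun D hDU hD hDc hDb => ?_, ?_⟩
  · obtain ⟨g', hg', hvg'⟩ := hex D hDU hD hDc hDb
    exact ⟨g', hg', hkey D hDU hD g' (hg'.mono subset_closure) hvg'⟩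
  · rw [EventuallyEq, ae_restrict_iff' hU.measurableSet, ae_iff]
    refine measure_null_of_locally_null _ fun x hx => ?_
    have hxU : x ∈ U := by
      by_contra h
      exact hx fun h' => absurd h' h
    obtain ⟨hr, hrU, hc, hae⟩ := hg₁ x hxU
    refine ⟨_ ∩ Metric.ball x (r x),
      inter_mem self_mem_nhdsWithin (mem_nhdsWithin_of_mem_nhds (Metric.ball_mem_nhds x hr)), ?_⟩
    rw [EventuallyEq, ae_restrict_iff' measurableSet_ball, ae_iff] at hae
    refine measure_mono_null (fun y hy => ?_) hae
    have h1 : v y ≠ g₁ y y := fun h => hy.1 fun _ => h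
    exact fun h2 => h1 ((h2 hy.2).trans
      (hkey _ hrU Metric.isOpen_ball (g₁ x) hc (hg₁ x hxU).2.2.2 hy.2).symm)

lemma ExtendsToConvexClosures.exists_tendsto {U D : Set (𝔼 n)} {g : (𝔼 n) → ℂ}
    (hg : ExtendsToConvexClosures U g) (hDU : D ⊆ U) (hD : IsOpen D) (hDc : Convex ℝ D)
    (hDb : Bornology.IsBounded D) {x : 𝔼 n} (hx : x ∈ closure D) :
    ∃ l, Tendsto g (𝓝[D] x) (𝓝 l) := by
  obtain ⟨g', hg', heq⟩ := hg D hDU hD hDc hDb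
  refine ⟨g' x, Tendsto.congr' ?_ ((hg' x hx).mono_left (nhdsWithin_mono x subset_closure))⟩
  filter_upwards [self_mem_nhdsWithin] with y hy using (heq hy).symm

lemma ExtendsToConvexClosures.continuousAt {U : Set (𝔼 n)} (hU : IsOpen U) {g : (𝔼 n) → ℂ}
    (hg : ExtendsToConvexClosures U g) {x : 𝔼 n} (hx : x ∈ U) : ContinuousAt g x := by
  obtain ⟨r, hr, hrU⟩ := Metric.isOpen_iff.1 hU x hx
  obtain ⟨g', hg', heq⟩ := hg _ hrU Metric.isOpen_ball (convex_ball x r) Metric.isBounded_ball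
  exact ((hg'.mono subset_closure).continuousAt (Metric.ball_mem_nhds x hr)).congr
    (heq.eventuallyEq_of_mem (Metric.ball_mem_nhds x hr)).symm

/-- The limits from the two pieces can only disagree at a common closure point x. There the open
segment from a point of D₁ ∩ D₂ to x lies in both pieces by convexity, so the intersection
accumulates at x and forces equality. -/
lemma ExtendsToConvexClosures.exists_tendsto_union {U D₁ D₂ : Set (𝔼 n)} {g : (𝔼 n) → ℂ}
    (hg : ExtendsToConvexClosures U g) (hDU : D₁ ∪ D₂ ⊆ U) (hD₁ : IsOpen D₁) (hD₂ : IsOpen D₂)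
    (hc₁ : Convex ℝ D₁) (hc₂ : Convex ℝ D₂) (hb₁ : Bornology.IsBounded D₁)
    (hb₂ : Bornology.IsBounded D₂) (hne : (D₁ ∩ D₂).Nonempty) {x : 𝔼 n}
    (hx : x ∈ closure (D₁ ∪ D₂)) : ∃ l, Tendsto g (𝓝[D₁ ∪ D₂] x) (𝓝 l) := by
  rw [closure_union] at hx
  rw [nhdsWithin_union]
  have hU₁ : D₁ ⊆ U := subset_union_left.trans hDU
  have hU₂ : D₂ ⊆ U := subset_union_right.trans hDU
  by_cases h₁ : x ∈ closure D₁ <;> by_cases h₂ : x ∈ closure D₂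
  · obtain ⟨l₁, hl₁⟩ := hg.exists_tendsto hU₁ hD₁ hc₁ hb₁ h₁
    obtain ⟨l₂, hl₂⟩ := hg.exists_tendsto hU₂ hD₂ hc₂ hb₂ h₂
    obtain ⟨p, hp₁, hp₂⟩ := hne
    have hxc : x ∈ closure (D₁ ∩ D₂) := by
      have hseg : openSegment ℝ p x ⊆ D₁ ∩ D₂ := by
        refine subset_inter ?_ ?_
        · have := hc₁.openSegment_interior_closure_subset_interior (by rwa [hD₁.interior_eq]) h₁
          rwa [hD₁.interior_eq] at this
        · have := hc₂.openSegment_interior_closure_subset_interior (by rwa [hD₂.interior_eq]) h₂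
          rwa [hD₂.interior_eq] at this
      refine closure_mono hseg ?_
      rw [closure_openSegment]
      exact right_mem_segment ℝ p x
    have := mem_closure_iff_nhdsWithin_neBot.1 hxc
    have heq : l₁ = l₂ := tendsto_nhds_unique
      (hl₁.mono_left (nhdsWithin_mono x inter_subset_left))
      (hl₂.mono_left (nhdsWithin_mono x inter_subset_right))
    exact ⟨l₁, hl₁.sup (heq ▸ hl₂)⟩
  · obtain ⟨l₁, hl₁⟩ := hg.exists_tendsto hU₁ hD₁ hc₁ hb₁ h₁
    rw [mem_closure_iff_nhdsWithin_neBot, not_neBot] at h₂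
    exact ⟨l₁, by rwa [h₂, sup_bot_eq]⟩
  · obtain ⟨l₂, hl₂⟩ := hg.exists_tendsto hU₂ hD₂ hc₂ hb₂ h₂
    rw [mem_closure_iff_nhdsWithin_neBot, not_neBot] at h₁
    exact ⟨l₂, by rwa [h₁, bot_sup_eq]⟩
  · exact absurd hx (not_or.2 ⟨h₁, h₂⟩)

/-- Near `p`, the set `Ω` is a union of two convex open sets whose intersection accumulates
at `p`. -/
def IsLocallyBiconvex (Ω : Set (𝔼 n)) (p : 𝔼 n) : Prop :=
  ∃ D₁ D₂ : Set (𝔼 n), IsOpen D₁ ∧ IsOpen D₂ ∧ Convex ℝ D₁ ∧ Convex ℝ D₂ ∧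
    p ∈ closure (D₁ ∩ D₂) ∧ ∃ r : ℝ, 0 < r ∧ Ω ∩ Metric.ball p r = (D₁ ∪ D₂) ∩ Metric.ball p r

/-- The two convex pieces of a locally biconvex set can be taken in arbitrarily small balls. -/
lemma IsLocallyBiconvex.exists_pieces {Ω : Set (𝔼 n)} {p : 𝔼 n} (h : IsLocallyBiconvex Ω p)
    {R : ℝ} (hR : 0 < R) : ∃ s : ℝ, 0 < s ∧ s ≤ R ∧ ∃ D₁ D₂ : Set (𝔼 n), IsOpen D₁ ∧ IsOpen D₂ ∧
      Convex ℝ D₁ ∧ Convex ℝ D₂ ∧ Bornology.IsBounded D₁ ∧ Bornology.IsBounded D₂ ∧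
      (D₁ ∩ D₂).Nonempty ∧ Ω ∩ Metric.ball p s = D₁ ∪ D₂ := by
  obtain ⟨D₁, D₂, ho₁, ho₂, hc₁, hc₂, hp, r, hr, heq⟩ := h
  refine ⟨min r R, lt_min hr hR, min_le_right _ _, D₁ ∩ Metric.ball p (min r R),
    D₂ ∩ Metric.ball p (min r R), ho₁.inter Metric.isOpen_ball, ho₂.inter Metric.isOpen_ball,
    hc₁.inter (convex_ball _ _), hc₂.inter (convex_ball _ _),
    Metric.isBounded_ball.subset inter_subset_right,
    Metric.isBounded_ball.subset inter_subset_right, ?_, ?_⟩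
  · obtain ⟨q, hq, hq'⟩ := mem_closure_iff.1 hp _ Metric.isOpen_ball
      (Metric.mem_ball_self (lt_min hr hR))
    exact ⟨q, ⟨hq'.1, hq⟩, ⟨hq'.2, hq⟩⟩
  · have hsub : Metric.ball p (min r R) ⊆ Metric.ball p r :=
      Metric.ball_subset_ball (min_le_left _ _)
    calc Ω ∩ Metric.ball p (min r R) = Ω ∩ Metric.ball p r ∩ Metric.ball p (min r R) := by
          rw [inter_assoc, inter_eq_right.2 hsub]
      _ = (D₁ ∪ D₂) ∩ Metric.ball p (min r R) := by rw [heq, inter_assoc, inter_eq_right.2 hsub]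
      _ = _ := union_inter_distrib_right _ _ _

lemma IsLocallyBiconvex.exists_tendsto {Ω : Set (𝔼 n)} {p x : 𝔼 n} {R : ℝ}
    (h : IsLocallyBiconvex Ω p) (hp : p ∈ Metric.ball x R) {g : (𝔼 n) → ℂ}
    (hg : ExtendsToConvexClosures (Ω ∩ Metric.ball x R) g) :
    ∃ s : ℝ, 0 < s ∧ ∀ q ∈ closure Ω ∩ Metric.ball p s,
      ∃ l, Tendsto g (𝓝[Ω ∩ Metric.ball x R] q) (𝓝 l) := by
  obtain ⟨R', hR', hsub⟩ := Metric.isOpen_iff.1 Metric.isOpen_ball p hp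
  obtain ⟨s, hs, hsR, D₁, D₂, ho₁, ho₂, hc₁, hc₂, hb₁, hb₂, hne, heq⟩ := h.exists_pieces hR'
  have hsub' : Metric.ball p s ⊆ Metric.ball x R := (Metric.ball_subset_ball hsR).trans hsub
  refine ⟨s, hs, fun q hq => ?_⟩
  have hnhds : Metric.ball p s ∈ 𝓝 q := Metric.isOpen_ball.mem_nhds hq.2
  have h1 : 𝓝[Ω ∩ Metric.ball x R] q = 𝓝[D₁ ∪ D₂] q := by
    rw [← nhdsWithin_inter_of_mem' (mem_nhdsWithin_of_mem_nhds hnhds), inter_assoc,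
      inter_eq_right.2 hsub', heq]
  rw [h1]
  refine hg.exists_tendsto_union ?_ ho₁ ho₂ hc₁ hc₂ hb₁ hb₂ hne ?_
  · rw [← heq]
    exact inter_subset_inter_right _ hsub'
  · rw [← heq, inter_comm]
    exact Metric.isOpen_ball.inter_closure ⟨hq.2, hq.1⟩

/-- Existence of limits at each nearby closure point is enough: the extension by limits is then
automatically continuous, because ℂ is a regular space. -/
lemma exists_hasValueAt_of_tendsto {Ω : Set (𝔼 n)} (hΩ : IsOpen Ω) {x : 𝔼 n} {R s : ℝ}
    (hs : 0 < s) (hsR : s ≤ R) {v g : (𝔼 n) → ℂ}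
    (hg : ExtendsToConvexClosures (Ω ∩ Metric.ball x R) g)
    (hvg : v =ᵐ[volume.restrict (Ω ∩ Metric.ball x R)] g)
    (hlim : ∀ q ∈ closure Ω ∩ Metric.ball x s,
      ∃ l, Tendsto g (𝓝[Ω ∩ Metric.ball x R] q) (𝓝 l)) : ∃ a, HasValueAt Ω v x a := by
  have hU : IsOpen (Ω ∩ Metric.ball x R) := hΩ.inter Metric.isOpen_ball
  have hsub : Metric.ball x s ⊆ Metric.ball x R := Metric.ball_subset_ball hsR
  refine ⟨_, s, hs, extendFrom (Ω ∩ Metric.ball x R) g, continuousOn_extendFrom ?_ hlim, ?_, rfl⟩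
  · rintro q ⟨hq, hqs⟩
    rw [inter_comm]
    exact Metric.isOpen_ball.inter_closure ⟨hsub hqs, hq⟩
  · have hmem : ∀ᵐ y ∂volume.restrict (Ω ∩ Metric.ball x s), y ∈ Ω ∩ Metric.ball x s :=
      ae_restrict_mem (hΩ.inter Metric.isOpen_ball).measurableSet
    filter_upwards [ae_restrict_of_ae_restrict_of_subset (inter_subset_inter_right Ω hsub) hvg,
      hmem] with y hy hyU
    have hyU' : y ∈ Ω ∩ Metric.ball x R := ⟨hyU.1, hsub hyU.2⟩
    rw [hy]
    exact (extendFrom_eq (subset_closure hyU')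
      ((hg.continuousAt hU hyU').mono_left nhdsWithin_le_nhds)).symm

end ContinuousRepresentative

/-! ### Local convex decompositions of wedges, half-spaces and cones. -/

section Geometry

variable {n : ℕ}

lemma exists_polar_of_pos {a b : ℝ} (hb : 0 < b) :
    ∃ ρ t : ℝ, 0 < ρ ∧ 0 < t ∧ t < Real.pi ∧ a = ρ * Real.cos t ∧ b = ρ * Real.sin t := by
  set z : ℂ := ⟨a, b⟩
  have hz : z ≠ 0 := fun h => hb.ne' (congrArg Complex.im h)
  have hre : ‖z‖ * Real.cos z.arg = a := Complex.norm_mul_cos_arg z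
  have him : ‖z‖ * Real.sin z.arg = b := Complex.norm_mul_sin_arg z
  have hpos : 0 < ‖z‖ := norm_pos_iff.2 hz
  have h0 : 0 ≤ z.arg := Complex.arg_nonneg_iff.2 hb.le
  have hsin : 0 < Real.sin z.arg := by
    by_contra h
    nlinarith [not_lt.1 h]
  refine ⟨‖z‖, z.arg, hpos, lt_of_le_of_ne h0 ?_, lt_of_le_of_ne (Complex.arg_le_pi z) ?_,
    hre.symm, him.symm⟩
  · intro h
    simp [← h] at hsin
  · intro h
    simp [h] at hsin

/-- A wedge is the intersection or the union of two half-spaces. -/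
lemma wedge_eq_union (e₁ e₂ : 𝔼 n) {θ : ℝ} (h0 : 0 < θ) (h2 : θ < 2 * Real.pi)
    (hne : θ ≠ Real.pi) :
    ∃ D₁ D₂ : Set (𝔼 n), IsOpen D₁ ∧ IsOpen D₂ ∧ Convex ℝ D₁ ∧ Convex ℝ D₂ ∧
      wedge e₁ e₂ θ = D₁ ∪ D₂ ∧
      ∀ y : 𝔼 n, inner ℝ e₁ y = Real.cos (θ / 2) → inner ℝ e₂ y = Real.sin (θ / 2) →
        ∀ s : ℝ, 0 < s → s • y ∈ D₁ ∩ D₂ := by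
  set S₁ : Set (𝔼 n) := {y | 0 < inner ℝ e₂ y} with hS₁
  -- In polar coordinates the expression equals ρ sin(θ - t), so this is the half-space bounded by
  -- the second face of the wedge.
  set S₂ : Set (𝔼 n) := {y | 0 < Real.sin θ * inner ℝ e₁ y - Real.cos θ * inner ℝ e₂ y} with hS₂
  have ho₁ : IsOpen S₁ := isOpen_lt continuous_const (by fun_prop)
  have ho₂ : IsOpen S₂ := isOpen_lt continuous_const (by fun_prop)
  have hc₁ : Convex ℝ S₁ := by
    intro y hy z hz a b ha hb hab
    simp only [hS₁, mem_ofPred_eq, inner_add_right, inner_smul_right] at *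
    rcases ha.eq_or_lt with rfl | ha
    · simp only [zero_add] at hab
      subst hab
      linarith
    · nlinarith [mul_pos ha hy, mul_nonneg hb hz.le]
  have hc₂ : Convex ℝ S₂ := by
    intro y hy z hz a b ha hb hab
    simp only [hS₂, mem_ofPred_eq, inner_add_right, inner_smul_right] at *
    rcases ha.eq_or_lt with rfl | ha
    · simp only [zero_add] at hab
      subst hab
      linarith
    · nlinarith [mul_pos ha hy, mul_nonneg hb hz.le]
  have hb : ∀ y : 𝔼 n, inner ℝ e₁ y = Real.cos (θ / 2) → inner ℝ e₂ y = Real.sin (θ / 2) →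
      ∀ s : ℝ, 0 < s → s • y ∈ S₁ ∩ S₂ := by
    intro y h1 h3 s hs
    have hsin : 0 < Real.sin (θ / 2) := Real.sin_pos_of_pos_of_lt_pi (by linarith) (by linarith)
    refine ⟨?_, ?_⟩
    · simp only [hS₁, mem_ofPred_eq, inner_smul_right, h3]
      positivity
    · simp only [hS₂, mem_ofPred_eq, inner_smul_right, h1, h3]
      have : Real.sin θ * (s * Real.cos (θ / 2)) - Real.cos θ * (s * Real.sin (θ / 2)) =
          s * Real.sin (θ - θ / 2) := by rw [Real.sin_sub]; ring
      rw [this, show θ - θ / 2 = θ / 2 by ring]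
      positivity
  have hmem₂ : ∀ (y : 𝔼 n) (ρ t : ℝ), inner ℝ e₁ y = ρ * Real.cos t →
      inner ℝ e₂ y = ρ * Real.sin t →
      Real.sin θ * inner ℝ e₁ y - Real.cos θ * inner ℝ e₂ y = ρ * Real.sin (θ - t) := by
    intro y ρ t h1 h3
    rw [h1, h3, Real.sin_sub]
    ring
  rcases lt_or_gt_of_ne hne with hlt | hgt
  -- For θ < π the wedge is itself convex and serves as both pieces; for θ > π it is the union of
  -- the two half-spaces.
  · refine ⟨S₁ ∩ S₂, S₁ ∩ S₂, ho₁.inter ho₂, ho₁.inter ho₂, hc₁.inter hc₂, hc₁.inter hc₂, ?_,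
      fun y h1 h3 s hs => ⟨hb y h1 h3 s hs, hb y h1 h3 s hs⟩⟩
    rw [union_self]
    ext y
    constructor
    · rintro ⟨ρ, t, hρ, ht0, htθ, h1, h3⟩
      refine ⟨?_, ?_⟩
      · simp only [hS₁, mem_ofPred_eq, h3]
        exact mul_pos hρ (Real.sin_pos_of_pos_of_lt_pi ht0 (by linarith))
      · simp only [hS₂, mem_ofPred_eq]
        rw [hmem₂ y ρ t h1 h3]
        exact mul_pos hρ (Real.sin_pos_of_pos_of_lt_pi (by linarith) (by linarith))
    · rintro ⟨hy₁, hy₂⟩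
      obtain ⟨ρ, t, hρ, ht0, htπ, h1, h3⟩ := exists_polar_of_pos (a := inner ℝ e₁ y) hy₁
      refine ⟨ρ, t, hρ, ht0, ?_, h1, h3⟩
      simp only [hS₂, mem_ofPred_eq] at hy₂
      rw [hmem₂ y ρ t h1 h3] at hy₂
      by_contra hcon
      have := Real.sin_nonpos_of_nonpos_of_neg_pi_le (x := θ - t) (by linarith) (by linarith)
      nlinarith
  · refine ⟨S₁, S₂, ho₁, ho₂, hc₁, hc₂, ?_, hb⟩
    ext y
    constructor
    · rintro ⟨ρ, t, hρ, ht0, htθ, h1, h3⟩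
      rcases lt_or_ge t Real.pi with ht | ht
      · left
        simp only [hS₁, mem_ofPred_eq, h3]
        exact mul_pos hρ (Real.sin_pos_of_pos_of_lt_pi ht0 ht)
      · right
        simp only [hS₂, mem_ofPred_eq]
        rw [hmem₂ y ρ t h1 h3]
        exact mul_pos hρ (Real.sin_pos_of_pos_of_lt_pi (by linarith) (by linarith))
    · rintro (hy₁ | hy₂)
      · obtain ⟨ρ, t, hρ, ht0, htπ, h1, h3⟩ := exists_polar_of_pos (a := inner ℝ e₁ y) hy₁
        exact ⟨ρ, t, hρ, ht0, by linarith, h1, h3⟩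
      -- Angles are measured backwards from the second face, so the actual angle is θ - t, which is
      -- positive because θ > π.
      · obtain ⟨ρ, t, hρ, ht0, htπ, h1, h3⟩ := exists_polar_of_pos
          (a := Real.cos θ * inner ℝ e₁ y + Real.sin θ * inner ℝ e₂ y) hy₂
        refine ⟨ρ, θ - t, hρ, by linarith, by linarith, ?_, ?_⟩
        · rw [Real.cos_sub]
          linear_combination (-(inner ℝ e₁ y : ℝ)) * Real.sin_sq_add_cos_sq θ +
            Real.cos θ * h1 + Real.sin θ * h3
        · rw [Real.sin_sub]
          linear_combination (-(inner ℝ e₂ y : ℝ)) * Real.sin_sq_add_cos_sq θ +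
            Real.sin θ * h1 - Real.cos θ * h3

lemma mem_closure_of_smul_add_mem {S : Set (𝔼 n)} {p y : 𝔼 n}
    (h : ∀ s : ℝ, 0 < s → p + s • y ∈ S) : p ∈ closure S := by
  have h1 : Tendsto (fun s : ℝ => p + s • y) (𝓝[>] 0) (𝓝 p) := by
    have : Tendsto (fun s : ℝ => p + s • y) (𝓝 0) (𝓝 (p + (0 : ℝ) • y)) :=
      Continuous.tendsto (by fun_prop) 0
    rw [zero_smul, add_zero] at this
    exact this.mono_left nhdsWithin_le_nhds
  exact mem_closure_of_tendsto h1 (eventually_mem_nhdsWithin.mono fun s hs => h s hs)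

lemma IsCornerOrEdgePoint.isLocallyBiconvex {Ω : Set (𝔼 n)} {p : 𝔼 n}
    (h : IsCornerOrEdgePoint Ω p) : IsLocallyBiconvex Ω p := by
  obtain ⟨e₁, e₂, θ, r, he₁, he₂, he, h0, h2, hne, hr, heq⟩ := h
  obtain ⟨D₁, D₂, ho₁, ho₂, hc₁, hc₂, hw, hb⟩ := wedge_eq_union e₁ e₂ h0 h2 hne
  have hcont : Continuous fun y : 𝔼 n => y - p := by fun_prop
  have hsub : ∀ D : Set (𝔼 n), Convex ℝ D → Convex ℝ ((fun y : 𝔼 n => y - p) ⁻¹' D) := by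
    intro D hD
    simpa [sub_eq_add_neg] using hD.translate_preimage_left (-p)
  refine ⟨(fun y => y - p) ⁻¹' D₁, (fun y => y - p) ⁻¹' D₂, ho₁.preimage hcont,
    ho₂.preimage hcont, hsub _ hc₁, hsub _ hc₂, ?_, r, hr, ?_⟩
  · refine mem_closure_of_smul_add_mem (y := Real.cos (θ / 2) • e₁ + Real.sin (θ / 2) • e₂)
      fun s hs => ?_
    rw [← preimage_inter, mem_preimage, add_sub_cancel_left]
    refine hb _ ?_ ?_ s hs
    · simp [inner_add_right, inner_smul_right, he, he₁]
    · simp [inner_add_right, inner_smul_right, real_inner_comm, he, he₂]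
  · rw [heq, hw]
    rfl

lemma IsFlatBoundaryPoint.isLocallyBiconvex {Ω : Set (𝔼 n)} {p : 𝔼 n}
    (h : IsFlatBoundaryPoint Ω p) : IsLocallyBiconvex Ω p := by
  obtain ⟨ν, r, hν, hr, heq⟩ := h
  have ho : IsOpen {y : 𝔼 n | 0 < inner ℝ ν (y - p)} := isOpen_lt continuous_const (by fun_prop)
  have hc : Convex ℝ {y : 𝔼 n | 0 < inner ℝ ν (y - p)} := by
    have h1 : {y : 𝔼 n | 0 < inner ℝ ν (y - p)} = {y | inner ℝ ν p < innerₗ (𝔼 n) ν y} := by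
      ext y
      simp [inner_sub_right]
    rw [h1]
    exact convex_halfSpace_gt (innerₗ (𝔼 n) ν).isLinear _
  refine ⟨_, _, ho, ho, hc, hc, ?_, r, hr, by rw [union_self]; exact heq⟩
  rw [inter_self]
  refine mem_closure_of_smul_add_mem (y := ν) fun s hs => ?_
  simp [inner_smul_right, hν, hs]

lemma isLocallyBiconvex_of_mem {Ω : Set (𝔼 n)} (hΩ : IsOpen Ω) {p : 𝔼 n} (hp : p ∈ Ω) :
    IsLocallyBiconvex Ω p := by
  obtain ⟨r, hr, hsub⟩ := Metric.isOpen_iff.1 hΩ p hp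
  refine ⟨Metric.ball p r, Metric.ball p r, Metric.isOpen_ball, Metric.isOpen_ball,
    convex_ball p r, convex_ball p r, ?_, r, hr, ?_⟩
  · rw [inter_self]
    exact subset_closure (Metric.mem_ball_self hr)
  · rw [union_self, inter_self, inter_eq_right.2 hsub]

/-- The positive cone spanned by a set. -/
def coneHull (S : Set (𝔼 n)) : Set (𝔼 n) := {y | ∃ t : ℝ, 0 < t ∧ t • y ∈ S}

lemma coneHull_mono {S T : Set (𝔼 n)} (h : S ⊆ T) : coneHull S ⊆ coneHull T :=
  fun _ ⟨t, ht, hy⟩ => ⟨t, ht, h hy⟩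

lemma subset_coneHull (S : Set (𝔼 n)) : S ⊆ coneHull S :=
  fun y hy => ⟨1, one_pos, by rwa [one_smul]⟩

lemma coneHull_union (S T : Set (𝔼 n)) : coneHull (S ∪ T) = coneHull S ∪ coneHull T := by
  ext y
  constructor
  · rintro ⟨t, ht, hy | hy⟩
    exacts [Or.inl ⟨t, ht, hy⟩, Or.inr ⟨t, ht, hy⟩]
  · rintro (⟨t, ht, hy⟩ | ⟨t, ht, hy⟩)
    exacts [⟨t, ht, Or.inl hy⟩, ⟨t, ht, Or.inr hy⟩]

lemma smul_mem_coneHull {S : Set (𝔼 n)} {t : ℝ} (ht : 0 < t) {y : 𝔼 n} (hy : y ∈ coneHull S) :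
    t • y ∈ coneHull S := by
  obtain ⟨s, hs, hy⟩ := hy
  exact ⟨s * t⁻¹, by positivity, by rwa [smul_smul, mul_assoc, inv_mul_cancel₀ ht.ne', mul_one]⟩

lemma coneHull_subset {S K : Set (𝔼 n)} (hK : ∀ t : ℝ, 0 < t → ∀ y ∈ K, t • y ∈ K) (h : S ⊆ K) :
    coneHull S ⊆ K := by
  rintro y ⟨t, ht, hy⟩
  simpa [smul_smul, ht.ne'] using hK t⁻¹ (by positivity) _ (h hy)

lemma isOpen_coneHull {S : Set (𝔼 n)} (hS : IsOpen S) : IsOpen (coneHull S) := by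
  have : coneHull S = ⋃ t ∈ Ioi (0 : ℝ), (fun y => t • y) ⁻¹' S := by
    ext y
    simp [coneHull]
  rw [this]
  exact isOpen_biUnion fun t _ => hS.preimage (continuous_const_smul t)

lemma convex_coneHull {S : Set (𝔼 n)} (hS : Convex ℝ S) : Convex ℝ (coneHull S) := by
  rintro y ⟨s, hs, hy⟩ z ⟨t, ht, hz⟩ a b ha hb hab
  -- Writing y = s⁻¹(s y) and z = t⁻¹(t z) expresses a y + b z through points of `S` with this total
  -- weight; dividing by it gives a convex combination.
  have hpos : 0 < a * s⁻¹ + b * t⁻¹ := by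
    rcases ha.eq_or_lt with rfl | ha
    · simp only [zero_add] at hab
      subst hab
      simpa using ht
    · positivity
  refine ⟨(a * s⁻¹ + b * t⁻¹)⁻¹, inv_pos.2 hpos, ?_⟩
  have := hS hy hz (a := (a * s⁻¹ + b * t⁻¹)⁻¹ * (a * s⁻¹))
    (b := (a * s⁻¹ + b * t⁻¹)⁻¹ * (b * t⁻¹)) (by positivity) (by positivity)
    (by rw [← mul_add, inv_mul_cancel₀ hpos.ne'])
  convert this using 1
  simp only [smul_add, smul_smul]
  congr 2 <;> field_simp

end Geometry

/-! ### Boundary values at the apex of a polyhedral cone. -/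

section Vertex

variable {n : ℕ}

/-- On each open convex subcone the limit at the apex exists by the convex case, and it can be read
along any of its rays. As a function of the ray it is locally constant, hence constant because the
cone is connected. Finitely many convex subcones cover the cone, by compactness of its closed link,
so the common ray limit is a full limit. -/
lemma exists_tendsto_apex {Ω K : Set (𝔼 n)} (hΩ : IsOpen Ω) {x : 𝔼 n} {r R : ℝ} (hR : 0 < R)
    (hRr : R ≤ r) (hKc : IsConnected K) (hK : ∀ t : ℝ, 0 < t → ∀ y ∈ K, t • y ∈ K)
    (heq : Ω ∩ Metric.ball x r = {y | y - x ∈ K} ∩ Metric.ball x r) (hx : x ∉ Ω)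
    (hbi : ∀ p ∈ closure Ω ∩ Metric.ball x r, p ≠ x → IsLocallyBiconvex Ω p) {g : (𝔼 n) → ℂ}
    (hg : ExtendsToConvexClosures (Ω ∩ Metric.ball x R) g) :
    ∃ a, Tendsto g (𝓝[Ω ∩ Metric.ball x R] x) (𝓝 a) := by
  have hsubR : Metric.ball x R ⊆ Metric.ball x r := Metric.ball_subset_ball hRr
  have hU : Ω ∩ Metric.ball x R = {y | y - x ∈ K} ∩ Metric.ball x R := by
    rw [← inter_eq_right.2 hsubR, ← inter_assoc, heq, inter_assoc]
  have hcone : ∀ C ⊆ K, IsOpen C → Convex ℝ C → C.Nonempty →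
      (∀ t : ℝ, 0 < t → ∀ y ∈ C, t • y ∈ C) → ∃ l, Tendsto g (𝓝[{y | y - x ∈ C}] x) (𝓝 l) := by
    rintro C hCK hC hCc ⟨y, hy⟩ hCt
    have hcont : Continuous fun y : 𝔼 n => y - x := by fun_prop
    have hconv : Convex ℝ ((fun y : 𝔼 n => y - x) ⁻¹' C) := by
      simpa [sub_eq_add_neg] using hCc.translate_preimage_left (-x)
    have hopen : IsOpen {y : 𝔼 n | y - x ∈ C} := hC.preimage hcont
    rw [← nhdsWithin_inter_of_mem' (mem_nhdsWithin_of_mem_nhds (Metric.ball_mem_nhds x hR))]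
    refine hg.exists_tendsto ?_ (hopen.inter Metric.isOpen_ball) (hconv.inter (convex_ball x R))
      (Metric.isBounded_ball.subset inter_subset_right) ?_
    · rw [hU]
      exact inter_subset_inter_left _ fun z hz => hCK hz
    · rw [inter_comm]
      refine Metric.isOpen_ball.inter_closure ⟨Metric.mem_ball_self hR,
        mem_closure_of_smul_add_mem (y := y) fun s hs => ?_⟩
      rw [mem_ofPred_eq, add_sub_cancel_left]
      exact hCt s hs y hy
  have hray : ∀ (C : Set (𝔼 n)) (l : ℂ), (∀ t : ℝ, 0 < t → ∀ y ∈ C, t • y ∈ C) →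
      Tendsto g (𝓝[{y | y - x ∈ C}] x) (𝓝 l) → ∀ y ∈ C,
      Tendsto (fun t : ℝ => g (x + t • y)) (𝓝[>] 0) (𝓝 l) := by
    intro C l hCt hl y hy
    refine hl.comp (tendsto_nhdsWithin_iff.2 ⟨?_, ?_⟩)
    · have : Tendsto (fun s : ℝ => x + s • y) (𝓝 0) (𝓝 (x + (0 : ℝ) • y)) :=
        Continuous.tendsto (by fun_prop) 0
      rw [zero_smul, add_zero] at this
      exact this.mono_left nhdsWithin_le_nhds
    · refine eventually_mem_nhdsWithin.mono fun t ht => ?_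
      rw [mem_ofPred_eq, add_sub_cancel_left]
      exact hCt t ht y hy
  have hcoh : ∀ S : Set (𝔼 n), ∀ t : ℝ, 0 < t → ∀ y ∈ coneHull S, t • y ∈ coneHull S :=
    fun S t ht y hy => smul_mem_coneHull ht hy
  have hKo : IsOpen K := by
    rw [isOpen_iff_mem_nhds]
    intro y hy
    obtain ⟨t, ht, hty⟩ : ∃ t : ℝ, 0 < t ∧ x + t • y ∈ Metric.ball x R := by
      have h1 : Tendsto (fun s : ℝ => x + s • y) (𝓝[>] 0) (𝓝 x) := by
        have : Tendsto (fun s : ℝ => x + s • y) (𝓝 0) (𝓝 (x + (0 : ℝ) • y)) :=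
          Continuous.tendsto (by fun_prop) 0
        rw [zero_smul, add_zero] at this
        exact this.mono_left nhdsWithin_le_nhds
      obtain ⟨t, ht, ht'⟩ := ((h1.eventually (Metric.ball_mem_nhds x hR)).and
        eventually_mem_nhdsWithin).exists
      exact ⟨t, ht', ht⟩
    have hcont : Continuous fun z : 𝔼 n => x + t • z := by fun_prop
    have hmem : x + t • y ∈ Ω ∩ Metric.ball x R := by
      rw [hU]
      refine ⟨?_, hty⟩
      rw [mem_ofPred_eq, add_sub_cancel_left]
      exact hK t ht y hy
    filter_upwards [((hΩ.inter Metric.isOpen_ball).preimage hcont).mem_nhds hmem] with z hz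
    have hz' : x + t • z ∈ Ω ∩ Metric.ball x R := hz
    rw [hU] at hz'
    have h2 : x + t • z - x ∈ K := hz'.1
    rw [add_sub_cancel_left] at h2
    simpa [smul_smul, ht.ne'] using hK t⁻¹ (by positivity) _ h2
  have hloc : ∀ y : K, ∃ (s : ℝ) (l : ℂ), 0 < s ∧ Tendsto g
      (𝓝[{z | z - x ∈ coneHull (Metric.ball (y : 𝔼 n) s)}] x) (𝓝 l) := by
    rintro ⟨y, hy⟩
    obtain ⟨s, hs, hsub⟩ := Metric.isOpen_iff.1 hKo y hy
    obtain ⟨l, hl⟩ := hcone (coneHull (Metric.ball y s)) (coneHull_subset hK hsub)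
      (isOpen_coneHull Metric.isOpen_ball) (convex_coneHull (convex_ball y s))
      ⟨y, subset_coneHull _ (Metric.mem_ball_self hs)⟩ (hcoh _)
    exact ⟨s, l, hs, hl⟩
  choose s l hs hl using hloc
  have hlray : ∀ y : K, Tendsto (fun t : ℝ => g (x + t • (y : 𝔼 n))) (𝓝[>] 0) (𝓝 (l y)) :=
    fun y => hray _ _ (hcoh _) (hl y) y (subset_coneHull _ (Metric.mem_ball_self (hs y)))
  have hconst : IsLocallyConstant l := by
    rw [IsLocallyConstant.iff_eventually_eq]
    intro y
    have h1 : ∀ᶠ z : K in 𝓝 y, (z : 𝔼 n) ∈ Metric.ball (y : 𝔼 n) (s y) :=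
      continuous_subtype_val.continuousAt.eventually (Metric.ball_mem_nhds _ (hs y))
    filter_upwards [h1] with z hz
    exact tendsto_nhds_unique (hlray z) (hray _ _ (hcoh _) (hl y) z (subset_coneHull _ hz))
  obtain ⟨y₀, hy₀⟩ := hKc.nonempty
  have : PreconnectedSpace K := Subtype.preconnectedSpace hKc.isPreconnected
  set a := l ⟨y₀, hy₀⟩
  have hla : ∀ y : K, l y = a := fun y => hconst.apply_eq_of_preconnectedSpace _ _
  have hconea : ∀ C ⊆ K, IsOpen C → Convex ℝ C → C.Nonempty →
      (∀ t : ℝ, 0 < t → ∀ y ∈ C, t • y ∈ C) → Tendsto g (𝓝[{y | y - x ∈ C}] x) (𝓝 a) := by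
    rintro C hCK hC hCc ⟨y, hy⟩ hCt
    obtain ⟨m, hm⟩ := hcone C hCK hC hCc ⟨y, hy⟩ hCt
    have h1 := tendsto_nhds_unique (hray C m hCt hm y hy) (hlray ⟨y, hCK hy⟩)
    rwa [h1, hla] at hm
  -- The closure is needed for compactness. At a point of the link on the boundary of the cone, the
  -- two convex pieces of the local structure span two convex subcones that cover the nearby part.
  set T := closure K ∩ Metric.sphere 0 (R / 2) with hT
  have hTc : IsCompact T := (isCompact_sphere 0 (R / 2)).inter_left isClosed_closure
  have hmain : Tendsto g (𝓝[{y | y - x ∈ coneHull (T ∩ K)}] x) (𝓝 a) := by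
    refine hTc.induction_on
      (p := fun S => Tendsto g (𝓝[{y | y - x ∈ coneHull (S ∩ K)}] x) (𝓝 a)) ?_ ?_ ?_ ?_
    · simp [coneHull]
    · intro S S' hSS' h
      exact h.mono_left (nhdsWithin_mono x fun y hy =>
        coneHull_mono (inter_subset_inter_left K hSS') hy)
    · intro S S' h h'
      have h1 : {y | y - x ∈ coneHull ((S ∪ S') ∩ K)} =
          {y | y - x ∈ coneHull (S ∩ K)} ∪ {y | y - x ∈ coneHull (S' ∩ K)} := by
        rw [union_inter_distrib_right, coneHull_union]
        rfl
      rw [h1, nhdsWithin_union]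
      exact h.sup h'
    · rintro p ⟨hpK, hpR⟩
      have hpR' : ‖p‖ = R / 2 := by simpa using hpR
      have hxp : x + p ∈ Metric.ball x r := by
        rw [Metric.mem_ball, dist_eq_norm, add_sub_cancel_left, hpR']
        linarith
      have hxpΩ : x + p ∈ closure Ω := by
        have h1 : x + p ∈ closure {y : 𝔼 n | y - x ∈ K} := by
          refine map_mem_closure (f := fun q => x + q) (by fun_prop) hpK fun q hq => ?_
          rw [mem_ofPred_eq, add_sub_cancel_left]
          exact hq
        have h2 := Metric.isOpen_ball.inter_closure ⟨hxp, h1⟩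
        rw [inter_comm, ← heq] at h2
        exact closure_mono inter_subset_left h2
      have hp0 : x + p ≠ x := by
        intro h
        rw [add_eq_left] at h
        rw [h, norm_zero] at hpR'
        linarith
      -- The link has radius R / 2, so pieces in balls of radius at most R / 2 stay inside the ball
      -- of radius R about the apex.
      obtain ⟨t, ht, htR, D₁, D₂, ho₁, ho₂, hc₁, hc₂, -, -, ⟨q, hq₁, hq₂⟩, hD⟩ :=
        (hbi _ ⟨hxpΩ, hxp⟩ hp0).exists_pieces (R := R / 2) (by positivity)
      have hcont : Continuous fun z : 𝔼 n => x + z := by fun_prop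
      have hball : Metric.ball (x + p) t ⊆ Metric.ball x R := by
        refine Metric.ball_subset_ball' ?_
        rw [dist_eq_norm, add_sub_cancel_left, hpR']
        linarith
      have hDK : ∀ z, x + z ∈ D₁ ∪ D₂ → z ∈ K := by
        intro z hz
        rw [← hD] at hz
        have h3 : x + z ∈ Ω ∩ Metric.ball x R := ⟨hz.1, hball hz.2⟩
        rw [hU] at h3
        have h4 : x + z - x ∈ K := h3.1
        rwa [add_sub_cancel_left] at h4
      have hpiece : ∀ D ⊆ D₁ ∪ D₂, IsOpen D → Convex ℝ D → q ∈ D →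
          Tendsto g (𝓝[{y | y - x ∈ coneHull ((fun z => x + z) ⁻¹' D)}] x) (𝓝 a) := by
        intro D hDD hDo hDc hq
        refine hconea _ (coneHull_subset hK fun z hz => hDK z (hDD hz))
          (isOpen_coneHull (hDo.preimage hcont))
          (convex_coneHull (hDc.translate_preimage_right x)) ⟨q - x, subset_coneHull _ ?_⟩ (hcoh _)
        simpa using hq
      have h5 := (hpiece D₁ subset_union_left ho₁ hc₁ hq₁).sup
        (hpiece D₂ subset_union_right ho₂ hc₂ hq₂)
      rw [← nhdsWithin_union] at h5
      refine ⟨Metric.ball p t, mem_nhdsWithin_of_mem_nhds (Metric.ball_mem_nhds p ht),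
        h5.mono_left (nhdsWithin_mono x fun y hy => ?_)⟩
      have h6 : Metric.ball p t ∩ K ⊆
          ((fun z => x + z) ⁻¹' D₁) ∪ ((fun z => x + z) ⁻¹' D₂) := by
        rintro z ⟨hz, hzK⟩
        rw [← preimage_union, ← hD]
        have hz' : x + z ∈ Metric.ball (x + p) t := by simpa using hz
        refine ⟨?_, hz'⟩
        have h7 : x + z ∈ {y | y - x ∈ K} ∩ Metric.ball x R := by
          refine ⟨?_, hball hz'⟩
          rw [mem_ofPred_eq, add_sub_cancel_left]
          exact hzK
        rw [← hU] at h7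
        exact h7.1
      have h8 := coneHull_mono h6 hy
      rwa [coneHull_union] at h8
  refine ⟨a, hmain.mono_left (nhdsWithin_mono x fun y hy => ?_)⟩
  have hyx : y ≠ x := fun h => hx (h ▸ hy.1)
  rw [hU] at hy
  have hpos : 0 < ‖y - x‖ := norm_pos_iff.2 (sub_ne_zero.2 hyx)
  have hmem : (R / 2 / ‖y - x‖) • (y - x) ∈ K := hK _ (by positivity) _ hy.1
  refine ⟨R / 2 / ‖y - x‖, by positivity, ⟨subset_closure hmem, ?_⟩, hmem⟩
  rw [mem_sphere_zero_iff_norm, norm_smul, Real.norm_of_nonneg (by positivity)]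
  field_simp

/-- `H²` functions have boundary values at corners, edges and vertices. -/
theorem exists_hasValueAt (hn : n < 4) {Ω : Set (𝔼 n)} (hΩ : IsOpen Ω) {x : 𝔼 n}
    (hx : IsCornerOrEdgePoint Ω x ∨ IsPolyhedralVertex Ω x) {v : (𝔼 n) → ℂ}
    (hv : ∃ r : ℝ, 0 < r ∧ MemH2 (Ω ∩ Metric.ball x r) v) : ∃ a, HasValueAt Ω v x a := by
  obtain ⟨R₀, hR₀, hv⟩ := hv
  have hsmall : ∀ R ≤ R₀, ∃ g, ExtendsToConvexClosures (Ω ∩ Metric.ball x R) g ∧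
      v =ᵐ[volume.restrict (Ω ∩ Metric.ball x R)] g := fun R hR =>
    (hv.mono (hΩ.inter Metric.isOpen_ball).measurableSet (inter_subset_inter_right Ω
      (Metric.ball_subset_ball hR))).exists_extendsToConvexClosures hn
        (hΩ.inter Metric.isOpen_ball)
  -- The locally biconvex case covers all corners and edge points, and also some vertices. In the
  -- remaining case the point is a vertex, and it lies outside Ω because interior points are locally
  -- biconvex.
  by_cases hxbi : IsLocallyBiconvex Ω x
  · obtain ⟨g, hg, hvg⟩ := hsmall R₀ le_rfl
    obtain ⟨s, hs, hlim⟩ := hxbi.exists_tendsto (Metric.mem_ball_self hR₀) hg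
    exact exists_hasValueAt_of_tendsto hΩ (lt_min hs hR₀) (min_le_right _ _) hg hvg
      fun q hq => hlim q ⟨hq.1, Metric.ball_subset_ball (min_le_left _ _) hq.2⟩
  · rcases hx with hx | ⟨-, K, r, hKc, hK, hr, heq, hfr, -⟩
    · exact absurd hx.isLocallyBiconvex hxbi
    have hxΩ : x ∉ Ω := fun h => hxbi (isLocallyBiconvex_of_mem hΩ h)
    have hbi : ∀ p ∈ closure Ω ∩ Metric.ball x r, p ≠ x → IsLocallyBiconvex Ω p := by
      rintro p ⟨hp, hpr⟩ hpx
      by_cases hpΩ : p ∈ Ω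
      · exact isLocallyBiconvex_of_mem hΩ hpΩ
      · have hpf : p ∈ frontier Ω := ⟨hp, by rwa [hΩ.interior_eq]⟩
        rcases hfr p ⟨hpf, hpr⟩ hpx with h | h
        exacts [h.isLocallyBiconvex, h.isLocallyBiconvex]
    have hR : 0 < min r R₀ := lt_min hr hR₀
    obtain ⟨g, hg, hvg⟩ := hsmall (min r R₀) (min_le_right _ _)
    refine exists_hasValueAt_of_tendsto hΩ hR le_rfl hg hvg fun q hq => ?_
    by_cases hqx : q = x
    · rw [hqx]
      exact exists_tendsto_apex hΩ hR (min_le_left _ _) hKc hK heq hxΩ hbi hg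
    · have hqr : q ∈ Metric.ball x r := Metric.ball_subset_ball (min_le_left _ _) hq.2
      obtain ⟨s, hs, hlim⟩ := (hbi q ⟨hq.1, hqr⟩ hqx).exists_tendsto hq.2 hg
      exact hlim q ⟨hq.1, Metric.mem_ball_self hs⟩

end Vertex

/-! ### The harmonic function that is homogeneous of degree -n. -/

section SingularHarmonic

variable {n : ℕ}

/-- The complex coordinate `⟪b, x⟫ + i ⟪b', x⟫`. -/
noncomputable def planeCoord (b b' : 𝔼 n) : (𝔼 n) →L[ℝ] ℂ :=
  Complex.ofRealCLM.comp (innerSL ℝ b) + (Complex.I • Complex.ofRealCLM).comp (innerSL ℝ b')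

lemma planeCoord_apply (b b' x : 𝔼 n) :
    planeCoord b b' x = (inner ℝ b x : ℝ) + (inner ℝ b' x : ℝ) * Complex.I := by
  simp [planeCoord, mul_comm]

lemma norm_planeCoord_sq (b b' x : 𝔼 n) :
    ‖planeCoord b b' x‖ ^ 2 = inner ℝ b x ^ 2 + inner ℝ b' x ^ 2 := by
  rw [planeCoord_apply, ← Complex.normSq_eq_norm_sq, Complex.normSq_add_mul_I]

lemma norm_planeCoord_le {b b' : 𝔼 n} (hb : ‖b‖ = 1) (hb' : ‖b'‖ = 1) (hbb' : inner ℝ b b' = 0)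
    (x : 𝔼 n) : ‖planeCoord b b' x‖ ≤ ‖x‖ := by
  refine abs_le_of_sq_le_sq' ?_ (norm_nonneg _) |>.2
  rw [norm_planeCoord_sq]
  have h1 : inner ℝ b' b = 0 := by rw [real_inner_comm, hbb']
  have h0 : 0 ≤ inner ℝ (x - (inner ℝ b x : ℝ) • b - (inner ℝ b' x : ℝ) • b')
      (x - (inner ℝ b x : ℝ) • b - (inner ℝ b' x : ℝ) • b') := real_inner_self_nonneg
  have h2 : inner ℝ (x - (inner ℝ b x : ℝ) • b - (inner ℝ b' x : ℝ) • b')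
      (x - (inner ℝ b x : ℝ) • b - (inner ℝ b' x : ℝ) • b') =
      ‖x‖ ^ 2 - inner ℝ b x ^ 2 - inner ℝ b' x ^ 2 := by
    simp only [inner_sub_left, inner_sub_right, inner_smul_left, inner_smul_right,
      real_inner_self_eq_norm_sq, hb, hb', hbb', h1, real_inner_comm b x, real_inner_comm b' x]
    simp
    ring
  linarith

/-- The complex vector b + i b' is isotropic: the sum is ‖b‖² - ‖b'‖² + 2i⟪b, b'⟫. Equivalently, the
gradient of ζ has square zero, so ζ² is harmonic. -/
lemma sum_planeCoord_single_sq {b b' : 𝔼 n} (hb : ‖b‖ = 1) (hb' : ‖b'‖ = 1)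
    (hbb' : inner ℝ b b' = 0) :
    ∑ i, planeCoord b b' (EuclideanSpace.single i 1) ^ 2 = 0 := by
  have h1 : ∑ i, b i ^ 2 = 1 := by rw [← EuclideanSpace.real_norm_sq_eq, hb, one_pow]
  have h2 : ∑ i, b' i ^ 2 = 1 := by rw [← EuclideanSpace.real_norm_sq_eq, hb', one_pow]
  have h3 : ∑ i, b i * b' i = 0 := by
    rw [← hbb', PiLp.inner_apply]
    exact Finset.sum_congr rfl fun i _ => by simp [mul_comm]
  have h4 : ∀ i, planeCoord b b' (EuclideanSpace.single i 1) ^ 2 =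
      ((b i ^ 2 : ℝ) : ℂ) - ((b' i ^ 2 : ℝ) : ℂ) + 2 * Complex.I * ((b i * b' i : ℝ) : ℂ) := by
    intro i
    rw [planeCoord_apply]
    simp only [EuclideanSpace.inner_single_right]
    push_cast
    simp only [one_mul, conj_trivial]
    linear_combination ((b' i : ℂ) ^ 2) * Complex.I_sq
  simp_rw [h4]
  rw [Finset.sum_add_distrib, Finset.sum_sub_distrib, ← Finset.mul_sum, ← Complex.ofReal_sum,
    ← Complex.ofReal_sum, ← Complex.ofReal_sum, h1, h2, h3]
  simp

lemma sum_mul_planeCoord_single (b b' x : 𝔼 n) :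
    ∑ i, (x i : ℂ) * planeCoord b b' (EuclideanSpace.single i 1) = planeCoord b b' x := by
  conv_rhs => rw [← (EuclideanSpace.basisFun (Fin n) ℝ).sum_repr x]
  simp [map_sum]

/-- The radial function `‖x‖ ^ (-m)`, with complex values. -/
noncomputable def invNormPow (m : ℕ) (x : 𝔼 n) : ℂ := (((‖x‖ ^ m)⁻¹ : ℝ) : ℂ)

lemma contDiffAt_invNormPow (m : ℕ) {x : 𝔼 n} (hx : x ≠ 0) :
    ContDiffAt ℝ ∞ (invNormPow (n := n) m) x := by
  have h : ContDiffAt ℝ ∞ (fun x : 𝔼 n => (‖x‖ ^ m)⁻¹) x :=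
    ((contDiffAt_norm ℝ hx).pow m).inv (pow_ne_zero m (norm_ne_zero_iff.2 hx))
  exact Complex.ofRealCLM.contDiff.contDiffAt.comp x h

lemma partialDeriv_invNormPow (m : ℕ) {x : 𝔼 n} (hx : x ≠ 0) (i : Fin n) :
    partialDeriv i (invNormPow m) x = -m * x i * invNormPow (m + 2) x := by
  have hx0 : ‖x‖ ≠ 0 := norm_ne_zero_iff.2 hx
  have h1 : HasDerivAt (fun t : ℝ => x + t • EuclideanSpace.single i (1 : ℝ))
      (EuclideanSpace.single i (1 : ℝ)) 0 := by
    simpa using ((hasDerivAt_id (0 : ℝ)).smul_const (EuclideanSpace.single i (1 : ℝ))).const_add x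
  have h2 : HasDerivAt (fun t : ℝ => ‖x + t • EuclideanSpace.single i (1 : ℝ)‖ ^ 2)
      (2 * x i) 0 := by
    have := h1.norm_sq
    simpa [EuclideanSpace.inner_single_right] using this
  have h3 : HasDerivAt (fun t : ℝ => ‖x + t • EuclideanSpace.single i (1 : ℝ)‖)
      (x i / ‖x‖) 0 := by
    have h4 := h2.sqrt (by simpa using hx0)
    simp only [Real.sqrt_sq (norm_nonneg _), zero_smul, add_zero] at h4
    refine h4.congr_deriv ?_
    field_simp
  have h5 : HasDerivAt (fun t : ℝ => (((‖x + t • EuclideanSpace.single i (1 : ℝ)‖ ^ m)⁻¹ : ℝ) : ℂ))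
      ((-(m * ‖x‖ ^ (m - 1) * (x i / ‖x‖)) / (‖x‖ ^ m) ^ 2 : ℝ) : ℂ) 0 := by
    have h6 := (h3.fun_pow m).fun_inv (by simpa using pow_ne_zero m hx0)
    simp only [zero_smul, add_zero] at h6
    exact h6.ofReal_comp
  have h7 : HasFDerivAt (invNormPow (n := n) m) (fderiv ℝ (invNormPow m) x)
      (x + (0 : ℝ) • EuclideanSpace.single i (1 : ℝ)) := by
    rw [zero_smul, add_zero]
    exact ((contDiffAt_invNormPow m hx).differentiableAt (by simp)).hasFDerivAt
  have h8 := h7.comp_hasDerivAt (0 : ℝ) h1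
  rw [partialDeriv, h8.unique h5, invNormPow]
  rw [← Complex.ofReal_natCast, ← Complex.ofReal_neg, ← Complex.ofReal_mul, ← Complex.ofReal_mul]
  congr 1
  rcases m with _ | m
  · simp
  · rw [Nat.add_sub_cancel]
    field_simp
    ring

/-- The function `(⟪b, x⟫ + i ⟪b', x⟫)² / ‖x‖ ^ (n + 2)`, which is homogeneous of degree `-n`, and
harmonic if `b`, `b'` are orthonormal. -/
noncomputable def singularHarmonic (b b' x : 𝔼 n) : ℂ :=
  planeCoord b b' x * planeCoord b b' x * invNormPow (n + 2) x

lemma contDiffAt_singularHarmonic (b b' : 𝔼 n) {x : 𝔼 n} (hx : x ≠ 0) :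
    ContDiffAt ℝ ∞ (singularHarmonic b b') x :=
  (((planeCoord b b').contDiff.mul (planeCoord b b').contDiff).contDiffAt).mul
    (contDiffAt_invNormPow _ hx)

lemma partialDeriv_planeCoord (b b' x : 𝔼 n) (i : Fin n) :
    partialDeriv i (planeCoord b b') x = planeCoord b b' (EuclideanSpace.single i 1) := by
  rw [partialDeriv, ContinuousLinearMap.fderiv]

lemma partialDeriv_coord (x : 𝔼 n) (i : Fin n) :
    partialDeriv i (fun y : 𝔼 n => (y i : ℂ)) x = 1 := by
  have h : HasFDerivAt (fun q : 𝔼 n => (q i : ℂ))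
      (Complex.ofRealCLM ∘L (EuclideanSpace.proj i : (𝔼 n) →L[ℝ] ℝ)) x :=
    Complex.ofRealCLM.hasFDerivAt.comp x
      (EuclideanSpace.proj i : (𝔼 n) →L[ℝ] ℝ).hasFDerivAt
  rw [partialDeriv, h.fderiv]
  simp

lemma differentiable_coord (i : Fin n) : Differentiable ℝ (fun y : 𝔼 n => (y i : ℂ)) := by
  have h : Differentiable ℝ (fun y : 𝔼 n => y i) := by fun_prop
  exact Complex.ofRealCLM.differentiable.comp h

lemma partialDeriv_congr {f g : (𝔼 n) → ℂ} {x : 𝔼 n} (h : f =ᶠ[𝓝 x] g) (i : Fin n) :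
    partialDeriv i f x = partialDeriv i g x := by
  rw [partialDeriv, partialDeriv, h.fderiv_eq]

lemma partialDeriv_congr_eventually {f g : (𝔼 n) → ℂ} {x : 𝔼 n} (h : f =ᶠ[𝓝 x] g) (i : Fin n) :
    partialDeriv i f =ᶠ[𝓝 x] partialDeriv i g :=
  h.eventuallyEq_nhds.mono fun _ hy => partialDeriv_congr hy i

lemma partialDeriv_singularHarmonic (b b' : 𝔼 n) {x : 𝔼 n} (hx : x ≠ 0) (i : Fin n) :
    partialDeriv i (singularHarmonic b b') x =
      2 * planeCoord b b' (EuclideanSpace.single i 1) *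
        (planeCoord b b' x * invNormPow (n + 2) x) -
      (n + 2) * (planeCoord b b' x * planeCoord b b' x * (x i * invNormPow (n + 4) x)) := by
  have hζ : DifferentiableAt ℝ (planeCoord b b') x := (planeCoord b b').differentiableAt
  have hr : DifferentiableAt ℝ (invNormPow (n := n) (n + 2)) x :=
    (contDiffAt_invNormPow _ hx).differentiableAt (by simp)
  have h1 : partialDeriv i (singularHarmonic b b') x = _ :=
    partialDeriv_mul (hζ.fun_mul hζ) hr i
  rw [h1, partialDeriv_mul hζ hζ, partialDeriv_planeCoord, partialDeriv_invNormPow _ hx]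
  push_cast
  ring

/-- The function is the Kelvin transform of the harmonic quadratic polynomial ζ². Explicitly,
isotropy removes the first term, Euler's identity evaluates the mixed one, and the coefficients of
ζ² / ‖x‖^(n+4) add up to -4(n+2) - n(n+2) + (n+2)(n+4) = 0. -/
lemma sum_partialDeriv_partialDeriv_singularHarmonic {b b' : 𝔼 n} (hb : ‖b‖ = 1) (hb' : ‖b'‖ = 1)
    (hbb' : inner ℝ b b' = 0) {x : 𝔼 n} (hx : x ≠ 0) :
    ∑ i, partialDeriv i (partialDeriv i (singularHarmonic b b')) x = 0 := by
  set ζ := planeCoord b b' with hζdef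
  have hζ : DifferentiableAt ℝ ζ x := ζ.differentiableAt
  have hr : ∀ m, DifferentiableAt ℝ (invNormPow (n := n) m) x := fun m =>
    (contDiffAt_invNormPow _ hx).differentiableAt (by simp)
  have hnear : ∀ᶠ y in 𝓝 x, y ≠ 0 := isOpen_ne.mem_nhds hx
  have h1 : ∀ i, partialDeriv i (partialDeriv i (singularHarmonic b b')) x =
      2 * invNormPow (n + 2) x * ζ (EuclideanSpace.single i 1) ^ 2
      - 4 * (n + 2) * ζ x * invNormPow (n + 4) x * (x i * ζ (EuclideanSpace.single i 1))
      - (n + 2) * ζ x ^ 2 * invNormPow (n + 4) x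
      + (n + 2) * (n + 4) * ζ x ^ 2 * invNormPow (n + 6) x * (x i) ^ 2 := by
    intro i
    have h2 : partialDeriv i (singularHarmonic b b') =ᶠ[𝓝 x] fun y =>
        2 * ζ (EuclideanSpace.single i 1) * (ζ y * invNormPow (n + 2) y) +
        (-(n + 2)) * (ζ y * ζ y * (y i * invNormPow (n + 4) y)) := by
      filter_upwards [hnear] with y hy
      rw [partialDeriv_singularHarmonic b b' hy i]
      ring
    rw [partialDeriv_congr h2]
    have hc := differentiable_coord i x
    have hA : DifferentiableAt ℝ (fun y => ζ y * invNormPow (n + 2) y) x := hζ.fun_mul (hr _)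
    have hB₁ : DifferentiableAt ℝ (fun y => ζ y * ζ y) x := hζ.fun_mul hζ
    have hB₂ : DifferentiableAt ℝ (fun y : 𝔼 n => (y i : ℂ) * invNormPow (n + 4) y) x :=
      hc.fun_mul (hr _)
    have hB := hB₁.fun_mul hB₂
    have hadd : ∀ (f g : (𝔼 n) → ℂ), DifferentiableAt ℝ f x → DifferentiableAt ℝ g x →
        ∀ α β : ℂ, partialDeriv i (fun y => α * f y + β * g y) x =
          α * partialDeriv i f x + β * partialDeriv i g x := by
      intro f g hf hg α β
      simp only [partialDeriv]
      rw [fderiv_fun_add (hf.const_mul α) (hg.const_mul β), fderiv_const_mul hf,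
        fderiv_const_mul hg]
      simp
    rw [hadd _ _ hA hB, partialDeriv_mul hζ (hr _), partialDeriv_mul hB₁ hB₂,
      partialDeriv_mul hζ hζ, partialDeriv_mul hc (hr _), partialDeriv_coord,
      hζdef, partialDeriv_planeCoord, partialDeriv_invNormPow _ hx, partialDeriv_invNormPow _ hx,
      ← hζdef]
    push_cast
    ring
  have hsq : ∑ i, ((x i : ℂ)) ^ 2 = ((‖x‖ ^ 2 : ℝ) : ℂ) := by
    rw [EuclideanSpace.real_norm_sq_eq]
    push_cast
    rfl
  have hx0 : ‖x‖ ≠ 0 := norm_ne_zero_iff.2 hx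
  have hr6 : invNormPow (n + 6) x * ((‖x‖ ^ 2 : ℝ) : ℂ) = invNormPow (n + 4) x := by
    rw [invNormPow, invNormPow, ← Complex.ofReal_mul]
    congr 1
    field_simp
    ring
  simp_rw [h1]
  rw [Finset.sum_add_distrib, Finset.sum_sub_distrib, Finset.sum_sub_distrib, Finset.sum_const,
    Finset.card_univ, Fintype.card_fin, nsmul_eq_mul, ← Finset.mul_sum,
    ← Finset.mul_sum, ← Finset.mul_sum, hζdef, sum_planeCoord_single_sq hb hb' hbb',
    sum_mul_planeCoord_single, hsq, mul_assoc _ (invNormPow (n + 6) x), hr6]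
  ring

lemma norm_invNormPow (m : ℕ) (x : 𝔼 n) : ‖invNormPow m x‖ = (‖x‖ ^ m)⁻¹ := by
  rw [invNormPow, Complex.norm_real, Real.norm_of_nonneg (by positivity)]

lemma norm_singularHarmonic_le {b b' : 𝔼 n} (hb : ‖b‖ = 1) (hb' : ‖b'‖ = 1)
    (hbb' : inner ℝ b b' = 0) (x : 𝔼 n) : ‖singularHarmonic b b' x‖ ≤ (‖x‖ ^ n)⁻¹ := by
  rcases eq_or_ne x 0 with rfl | hx
  · simp [singularHarmonic]
  have hx0 : 0 < ‖x‖ := norm_pos_iff.2 hx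
  rw [singularHarmonic, norm_mul, norm_mul, norm_invNormPow]
  have h := norm_planeCoord_le hb hb' hbb' x
  calc ‖planeCoord b b' x‖ * ‖planeCoord b b' x‖ * (‖x‖ ^ (n + 2))⁻¹
      ≤ ‖x‖ * ‖x‖ * (‖x‖ ^ (n + 2))⁻¹ := by gcongr
    _ = (‖x‖ ^ n)⁻¹ := by
      field_simp
      ring

lemma norm_partialDeriv_singularHarmonic_le {b b' : 𝔼 n} (hb : ‖b‖ = 1) (hb' : ‖b'‖ = 1)
    (hbb' : inner ℝ b b' = 0) {x : 𝔼 n} (hx : x ≠ 0) (i : Fin n) :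
    ‖partialDeriv i (singularHarmonic b b') x‖ ≤ (n + 4) * (‖x‖ ^ (n + 1))⁻¹ := by
  have hx0 : 0 < ‖x‖ := norm_pos_iff.2 hx
  have h := norm_planeCoord_le hb hb' hbb' x
  have h1 : ‖planeCoord b b' (EuclideanSpace.single i 1)‖ ≤ 1 := by
    simpa using norm_planeCoord_le hb hb' hbb' (EuclideanSpace.single i 1)
  have h2 : |x i| ≤ ‖x‖ := PiLp.norm_apply_le x i
  rw [partialDeriv_singularHarmonic b b' hx]
  refine (norm_sub_le _ _).trans ?_
  simp only [norm_mul, norm_invNormPow, Complex.norm_real, Real.norm_eq_abs, Complex.norm_ofNat]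
  have h3 : ‖((n : ℂ) + 2)‖ = n + 2 := by
    rw [show ((n : ℂ) + 2) = ((n + 2 : ℕ) : ℂ) by push_cast; rfl, Complex.norm_natCast]
    push_cast
    rfl
  rw [h3]
  calc 2 * ‖planeCoord b b' (EuclideanSpace.single i 1)‖ *
        (‖planeCoord b b' x‖ * (‖x‖ ^ (n + 2))⁻¹) +
        (n + 2) * (‖planeCoord b b' x‖ * ‖planeCoord b b' x‖ * (|x i| * (‖x‖ ^ (n + 4))⁻¹))
      ≤ 2 * 1 * (‖x‖ * (‖x‖ ^ (n + 2))⁻¹) +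
        (n + 2) * (‖x‖ * ‖x‖ * (‖x‖ * (‖x‖ ^ (n + 4))⁻¹)) := by gcongr
    _ = (n + 4) * (‖x‖ ^ (n + 1))⁻¹ := by
      field_simp
      ring

lemma singularHarmonic_smul (b b' : 𝔼 n) {t : ℝ} (ht : 0 < t) (x : 𝔼 n) :
    singularHarmonic b b' (t • x) = ((t ^ n : ℝ) : ℂ)⁻¹ * singularHarmonic b b' x := by
  have h : invNormPow (n + 2) (t • x) = ((t ^ (n + 2) : ℝ) : ℂ)⁻¹ * invNormPow (n + 2) x := by
    rw [invNormPow, invNormPow, norm_smul, Real.norm_of_nonneg ht.le, mul_pow, mul_inv]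
    push_cast
    rfl
  have ht' : (t : ℂ) ≠ 0 := Complex.ofReal_ne_zero.2 ht.ne'
  simp only [singularHarmonic, map_smul, h, Complex.real_smul]
  push_cast
  field_simp
  ring

end SingularHarmonic

/-! ### The angular integral over a sector. -/

section SectorIntegral

variable {n : ℕ}

/-- The open sector of the complex plane that is bisected by the positive real axis and has
opening angle `θ`. -/
def planarSector (θ : ℝ) : Set ℂ := {z | z ≠ 0 ∧ |z.arg| < θ / 2}

lemma measurableSet_planarSector (θ : ℝ) : MeasurableSet (planarSector θ) :=
  (measurableSet_singleton 0).compl.inter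
    (measurableSet_lt Complex.measurable_arg.abs measurable_const)

lemma real_mul_mem_planarSector {θ r : ℝ} (hr : 0 < r) {z : ℂ} :
    (r : ℂ) * z ∈ planarSector θ ↔ z ∈ planarSector θ := by
  simp [planarSector, Complex.arg_real_mul z hr, hr.ne']

/-- On the unit circle this is the integral of e^(2is) over (-θ/2, θ/2). The frequency two,
inherited from ζ², is what produces sin θ, whose only zero in (0, 2π) is π. -/
lemma integral_planarSector_exp {θ : ℝ} (h0 : 0 < θ) (h2 : θ < 2 * Real.pi) :
    ∫ s in (-Real.pi)..Real.pi, (planarSector θ).indicator (fun z => z ^ 2)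
      (Complex.exp (s * Complex.I)) = Real.sin θ := by
  have hpi := Real.pi_pos
  rw [intervalIntegral.integral_of_le (by linarith)]
  have h1 : ∀ s ∈ Ioc (-Real.pi) Real.pi, (planarSector θ).indicator (fun z => z ^ 2)
      (Complex.exp (s * Complex.I)) =
      (Ioo (-(θ / 2)) (θ / 2)).indicator (fun s : ℝ => Complex.exp ((2 * Complex.I) * s)) s := by
    intro s hs
    have harg : (Complex.exp (s * Complex.I)).arg = s := by
      rw [Complex.exp_mul_I]
      exact Complex.arg_cos_add_sin_mul_I hs
    have hiff : Complex.exp (s * Complex.I) ∈ planarSector θ ↔ s ∈ Ioo (-(θ / 2)) (θ / 2) := by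
      simp [planarSector, harg, abs_lt]
    by_cases hmem : s ∈ Ioo (-(θ / 2)) (θ / 2)
    · rw [indicator_of_mem hmem, indicator_of_mem (hiff.2 hmem), ← Complex.exp_nat_mul]
      congr 1
      push_cast
      ring
    · rw [indicator_of_notMem hmem, indicator_of_notMem (fun h => hmem (hiff.1 h))]
  have hsub : Ioo (-(θ / 2)) (θ / 2) ⊆ Ioc (-Real.pi) Real.pi := fun s hs =>
    ⟨by linarith [hs.1], by linarith [hs.2]⟩
  rw [setIntegral_congr_fun measurableSet_Ioc h1, setIntegral_indicator measurableSet_Ioo,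
    inter_eq_right.2 hsub,
    ← integral_Ioc_eq_integral_Ioo, ← intervalIntegral.integral_of_le (by linarith),
    integral_exp_mul_complex (by simp)]
  have e1 : 2 * Complex.I * ((θ / 2 : ℝ) : ℂ) = (θ : ℂ) * Complex.I := by push_cast; ring
  have e2 : 2 * Complex.I * ((-(θ / 2) : ℝ) : ℂ) = -(θ : ℂ) * Complex.I := by push_cast; ring
  rw [e1, e2, Complex.ofReal_sin, Complex.sin]
  field_simp
  rw [Complex.I_sq]
  ring

lemma integral_rotate_planarSector {θ : ℝ} (h0 : 0 < θ) (h2 : θ < 2 * Real.pi) (z : ℂ) :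
    ∫ t in (0 : ℝ)..2 * Real.pi, (planarSector θ).indicator (fun z => z ^ 2)
      (Complex.exp (t * Complex.I) * z) = ((Real.sin θ * ‖z‖ ^ 2 : ℝ) : ℂ) := by
  rcases eq_or_ne z 0 with rfl | hz
  · simp [planarSector]
  set k : ℝ → ℂ := fun s => (planarSector θ).indicator (fun z => z ^ 2)
    (Complex.exp (s * Complex.I)) with hk
  have hper : Function.Periodic k (2 * Real.pi) := by
    intro s
    simp only [hk]
    rw [show ((s + 2 * Real.pi : ℝ) : ℂ) * Complex.I = s * Complex.I + 2 * Real.pi * Complex.I by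
      push_cast; ring, Complex.exp_periodic]
  have hpos : 0 < ‖z‖ := norm_pos_iff.2 hz
  have h1 : ∀ t : ℝ, (planarSector θ).indicator (fun z => z ^ 2)
      (Complex.exp (t * Complex.I) * z) = ((‖z‖ ^ 2 : ℝ) : ℂ) * k (t + z.arg) := by
    intro t
    have h3 : Complex.exp (t * Complex.I) * z =
        (‖z‖ : ℂ) * Complex.exp (((t + z.arg : ℝ) : ℂ) * Complex.I) := by
      conv_lhs => rw [← Complex.norm_mul_exp_arg_mul_I z]
      rw [show ((t + z.arg : ℝ) : ℂ) * Complex.I = t * Complex.I + z.arg * Complex.I by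
        push_cast; ring, Complex.exp_add]
      ring
    rw [h3, hk]
    by_cases hmem : Complex.exp (((t + z.arg : ℝ) : ℂ) * Complex.I) ∈ planarSector θ
    · rw [indicator_of_mem ((real_mul_mem_planarSector hpos).2 hmem)]
      simp only [indicator_of_mem hmem]
      push_cast
      ring
    · rw [indicator_of_notMem (fun h => hmem ((real_mul_mem_planarSector hpos).1 h))]
      simp only [indicator_of_notMem hmem, mul_zero]
  simp_rw [h1]
  rw [intervalIntegral.integral_const_mul, intervalIntegral.integral_comp_add_right k, zero_add,
    add_comm (2 * Real.pi), hper.intervalIntegral_add_eq z.arg (-Real.pi),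
    show -Real.pi + 2 * Real.pi = Real.pi by ring, integral_planarSector_exp h0 h2]
  push_cast
  ring

/-- A rank-two perturbation of the identity: it rotates the plane of b and b' and fixes the
orthogonal complement. Such isometries replace cylindrical coordinates in the computation of sector
integrals. -/
lemma exists_rotation {b b' : 𝔼 n} (hb : ‖b‖ = 1) (hb' : ‖b'‖ = 1) (hbb' : inner ℝ b b' = 0)
    (t : ℝ) : ∃ T : (𝔼 n) ≃ₗᵢ[ℝ] (𝔼 n), ∀ x,
      planeCoord b b' (T x) = Complex.exp (t * Complex.I) * planeCoord b b' x := by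
  have h1 : inner ℝ b' b = 0 := by rw [real_inner_comm, hbb']
  have hbsq : inner ℝ b b = 1 := by rw [real_inner_self_eq_norm_sq, hb, one_pow]
  have hbsq' : inner ℝ b' b' = 1 := by rw [real_inner_self_eq_norm_sq, hb', one_pow]
  let A : (𝔼 n) →ₗ[ℝ] (𝔼 n) := LinearMap.id +
    (((Real.cos t - 1) • innerₗ (𝔼 n) b - Real.sin t • innerₗ (𝔼 n) b').smulRight b +
      (Real.sin t • innerₗ (𝔼 n) b + (Real.cos t - 1) • innerₗ (𝔼 n) b').smulRight b')
  have hA : ∀ x, A x = x + ((((Real.cos t - 1) * inner ℝ b x - Real.sin t * inner ℝ b' x) • b) +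
      ((Real.sin t * inner ℝ b x + (Real.cos t - 1) * inner ℝ b' x) • b')) := by
    intro x
    simp [A]
  have hi : ∀ x, inner ℝ b (A x) = Real.cos t * inner ℝ b x - Real.sin t * inner ℝ b' x := by
    intro x
    rw [hA]
    simp only [inner_add_right, inner_smul_right, hbsq, hbb']
    ring
  have hi' : ∀ x, inner ℝ b' (A x) = Real.sin t * inner ℝ b x + Real.cos t * inner ℝ b' x := by
    intro x
    rw [hA]
    simp only [inner_add_right, inner_smul_right, hbsq', h1]
    ring
  have hnorm : ∀ x, ‖A x‖ = ‖x‖ := by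
    intro x
    rw [← sq_eq_sq₀ (norm_nonneg _) (norm_nonneg _), ← real_inner_self_eq_norm_sq,
      ← real_inner_self_eq_norm_sq]
    conv_lhs => rw [hA x]
    simp only [inner_add_left, inner_add_right, inner_smul_left, inner_smul_right, hbsq, hbsq',
      hbb', h1, real_inner_comm b x, real_inner_comm b' x, conj_trivial]
    linear_combination (inner ℝ b x ^ 2 + inner ℝ b' x ^ 2) * Real.sin_sq_add_cos_sq t
  refine ⟨LinearIsometry.toLinearIsometryEquiv ⟨A, hnorm⟩ rfl, fun x => ?_⟩
  have h3 : planeCoord b b' (A x) = Complex.exp (t * Complex.I) * planeCoord b b' x := by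
    rw [planeCoord_apply, planeCoord_apply, hi, hi', Complex.exp_mul_I]
    push_cast
    linear_combination (-(Complex.sin t * (inner ℝ b' x : ℝ) : ℂ)) * Complex.I_sq
  exact h3

/-- The integral of a radial function times the square of the complex coordinate over a solid
sector. -/
lemma integral_solidSector {b b' : 𝔼 n} (hb : ‖b‖ = 1) (hb' : ‖b'‖ = 1) (hbb' : inner ℝ b b' = 0)
    {θ : ℝ} (h0 : 0 < θ) (h2 : θ < 2 * Real.pi) {q : (𝔼 n) → ℝ} (hqm : Measurable q)
    (hq : ∀ x y, ‖x‖ = ‖y‖ → q x = q y) (hqi : Integrable (fun x => q x * ‖planeCoord b b' x‖ ^ 2)) :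
    2 * Real.pi * ∫ x in planeCoord b b' ⁻¹' planarSector θ, q x * planeCoord b b' x ^ 2 =
      ((Real.sin θ * ∫ x, q x * ‖planeCoord b b' x‖ ^ 2 : ℝ) : ℂ) := by
  set ζ := planeCoord b b'
  have hS := measurableSet_planarSector θ
  set f : ℂ → ℂ := (planarSector θ).indicator (fun z => z ^ 2) with hf
  have hfm : Measurable f := (measurable_id.pow_const 2).indicator hS
  have hfn : ∀ z, ‖f z‖ ≤ ‖z‖ ^ 2 := by
    intro z
    by_cases hz : z ∈ planarSector θ
    · rw [hf, indicator_of_mem hz, norm_pow]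
    · rw [hf, indicator_of_notMem hz, norm_zero]
      positivity
  have hζm : Measurable ζ := ζ.continuous.measurable
  have h1 : ∫ x in ζ ⁻¹' planarSector θ, q x * ζ x ^ 2 = ∫ x, q x * f (ζ x) := by
    rw [← integral_indicator (hζm hS)]
    congr 1
    ext x
    by_cases hx : ζ x ∈ planarSector θ
    · rw [indicator_of_mem (show x ∈ ζ ⁻¹' planarSector θ from hx), hf, indicator_of_mem hx]
    · rw [indicator_of_notMem (show x ∉ ζ ⁻¹' planarSector θ from hx), hf,
        indicator_of_notMem hx, mul_zero]
  -- Since `q` is radial, rotating the plane coordinate leaves the integral unchanged. Averaging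
  -- over all angles and exchanging the integrals reduces it to `integral_rotate_planarSector` at
  -- each point; the factor 2π is the length of the angle interval.
  have hrot : ∀ t : ℝ, ∫ x, q x * f (Complex.exp (t * Complex.I) * ζ x) =
      ∫ x, q x * f (ζ x) := by
    intro t
    obtain ⟨T, hT⟩ := exists_rotation hb hb' hbb' t
    rw [← T.measurePreserving.integral_comp T.toHomeomorph.measurableEmbedding
      (fun x => (q x : ℂ) * f (ζ x))]
    refine integral_congr_ae (Eventually.of_forall fun x => ?_)
    simp only
    rw [hT, hq (T x) x (T.norm_map x)]
  have hint : Integrable (Function.uncurry fun (t : ℝ) (x : 𝔼 n) =>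
      (q x : ℂ) * f (Complex.exp (t * Complex.I) * ζ x))
      ((volume.restrict (Ioc 0 (2 * Real.pi))).prod volume) := by
    refine Integrable.mono' (g := fun p : ℝ × (𝔼 n) => |q p.2 * ‖ζ p.2‖ ^ 2|)
      (hqi.abs.comp_snd (volume.restrict (Ioc 0 (2 * Real.pi)))) ?_
      (Eventually.of_forall fun p => ?_)
    · refine Measurable.aestronglyMeasurable ?_
      refine (Complex.measurable_ofReal.comp (hqm.comp measurable_snd)).mul (hfm.comp ?_)
      refine Measurable.mul ?_ (hζm.comp measurable_snd)
      fun_prop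
    · simp only [Function.uncurry, norm_mul, Complex.norm_real, Real.norm_eq_abs, abs_mul]
      gcongr
      refine (hfn _).trans (le_of_eq ?_)
      rw [norm_mul, Complex.norm_exp_ofReal_mul_I, one_mul, abs_of_nonneg (by positivity)]
  have h3 := integral_integral_swap hint
  simp_rw [hrot] at h3
  rw [h1, ← integral_const_mul (Real.sin θ), ← integral_complex_ofReal]
  rw [integral_const] at h3
  have h4 : (volume.restrict (Ioc 0 (2 * Real.pi))).real univ = 2 * Real.pi := by
    simp [Real.pi_pos.le]
  rw [h4] at h3
  calc (2 * Real.pi * ∫ x, q x * f (ζ x) : ℂ) = (2 * Real.pi) • ∫ x, q x * f (ζ x) := by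
        rw [Complex.real_smul]
        push_cast
        rfl
    _ = _ := h3
    _ = _ := by
      refine integral_congr_ae (Eventually.of_forall fun x => ?_)
      simp only
      rw [integral_const_mul, ← intervalIntegral.integral_of_le (by positivity),
        integral_rotate_planarSector h0 h2]
      push_cast
      ring

end SectorIntegral

/-! ### Radial cutoffs and their dyadic differences. -/

section Cutoff

variable {n : ℕ}

/-- A smooth radial cutoff function between the balls of radius `R` and `2 * R` about the
origin. -/
structure IsRadialCutoff (R : ℝ) (χ : (𝔼 n) → ℝ) : Prop where
  contDiff : ContDiff ℝ ∞ χ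
  nonneg : ∀ x, 0 ≤ χ x
  le_one : ∀ x, χ x ≤ 1
  eq_one : ∀ x, ‖x‖ ≤ R → χ x = 1
  eq_zero : ∀ x, 2 * R ≤ ‖x‖ → χ x = 0
  radial : ∀ x y, ‖x‖ = ‖y‖ → χ x = χ y

lemma exists_isRadialCutoff {R : ℝ} (hR : 0 < R) : ∃ χ : (𝔼 n) → ℝ, IsRadialCutoff R χ := by
  -- The quotient is at least 1 for ‖x‖ ≤ R and at most 0 for ‖x‖ ≥ 2R; using the squared norm keeps
  -- it smooth at the origin.
  refine ⟨fun x => Real.smoothTransition ((4 * R ^ 2 - ‖x‖ ^ 2) / (3 * R ^ 2)), ?_, ?_, ?_, ?_, ?_,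
    ?_⟩
  · refine Real.smoothTransition.contDiff.comp ?_
    exact (contDiff_const.sub (contDiff_norm_sq ℝ)).div_const _
  · exact fun x => Real.smoothTransition.nonneg _
  · exact fun x => Real.smoothTransition.le_one _
  · intro x hx
    refine Real.smoothTransition.one_of_one_le ?_
    rw [one_le_div (by positivity)]
    nlinarith [norm_nonneg x]
  · intro x hx
    refine Real.smoothTransition.zero_of_nonpos (div_nonpos_of_nonpos_of_nonneg ?_ (by positivity))
    nlinarith [norm_nonneg x]
  · intro x y hxy
    simp only [hxy]

lemma IsRadialCutoff.isTestFunction {R : ℝ} {χ : (𝔼 n) → ℝ} (hχ : IsRadialCutoff R χ) :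
    IsTestFunction univ (fun x => (χ x : ℂ)) where
  contDiff := Complex.ofRealCLM.contDiff.comp hχ.contDiff
  hasCompactSupport := HasCompactSupport.intro (isCompact_closedBall 0 (2 * R)) fun x hx => by
    rw [hχ.eq_zero x (by simpa using (not_le.1 fun h => hx (by simpa using h)).le),
      Complex.ofReal_zero]
  tsupport_subset := subset_univ _

/-- Either ‖x‖ ≤ R, where χ x = 1, or ‖2x‖ ≥ 2R, where the subtracted term vanishes. The difference
is the dyadic shell that one halving of scale contributes to the logarithmic growth. -/
lemma IsRadialCutoff.sub_nonneg {R : ℝ} {χ : (𝔼 n) → ℝ} (hχ : IsRadialCutoff R χ) (x : 𝔼 n) :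
    0 ≤ χ x - χ ((2 : ℝ) • x) := by
  rcases le_total ‖x‖ R with h | h
  · rw [hχ.eq_one x h]
    linarith [hχ.le_one ((2 : ℝ) • x)]
  · rw [hχ.eq_zero ((2 : ℝ) • x) (by rw [norm_smul]; simpa using h)]
    linarith [hχ.nonneg x]

lemma IsRadialCutoff.abs_sub_le {R : ℝ} {χ : (𝔼 n) → ℝ} (hχ : IsRadialCutoff R χ) (x : 𝔼 n) :
    |χ x - χ ((2 : ℝ) • x)| ≤ 1 := by
  rw [abs_of_nonneg (hχ.sub_nonneg x)]
  linarith [hχ.le_one x, hχ.nonneg ((2 : ℝ) • x)]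

lemma IsRadialCutoff.sub_eq_zero_of_le {R : ℝ} {χ : (𝔼 n) → ℝ} (hR : 0 < R)
    (hχ : IsRadialCutoff R χ) {x : 𝔼 n} (hx : ‖x‖ ≤ R / 2) : χ x - χ ((2 : ℝ) • x) = 0 := by
  have h : ‖(2 : ℝ) • x‖ ≤ R := by
    rw [norm_smul, Real.norm_two]
    linarith
  rw [hχ.eq_one x (by linarith), hχ.eq_one _ h, sub_self]

lemma IsRadialCutoff.sub_eq_zero_of_ge {R : ℝ} {χ : (𝔼 n) → ℝ} (hR : 0 < R)
    (hχ : IsRadialCutoff R χ) {x : 𝔼 n} (hx : 2 * R ≤ ‖x‖) : χ x - χ ((2 : ℝ) • x) = 0 := by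
  have h : 2 * R ≤ ‖(2 : ℝ) • x‖ := by
    rw [norm_smul, Real.norm_two]
    linarith
  rw [hχ.eq_zero x hx, hχ.eq_zero _ h, sub_self]

lemma integrableOn_of_bounded_of_eq_zero {f : (𝔼 n) → ℂ} {W : Set (𝔼 n)} (hW : MeasurableSet W)
    (hf : Measurable f) {M ρ : ℝ} (hM : ∀ x ∈ W, ‖f x‖ ≤ M) (h0 : ∀ x ∈ W, ρ < ‖x‖ → f x = 0) :
    IntegrableOn f W := by
  refine Integrable.mono' (g := (Metric.closedBall (0 : 𝔼 n) ρ).indicator fun _ => M) ?_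
    hf.aestronglyMeasurable ?_
  · exact (integrable_indicator_iff measurableSet_closedBall).2
      (integrableOn_const ((Measure.restrict_apply_le _ _).trans_lt
        (isCompact_closedBall _ _).measure_lt_top).ne)
  · filter_upwards [ae_restrict_mem hW] with x hx
    by_cases hxρ : x ∈ Metric.closedBall (0 : 𝔼 n) ρ
    · rw [indicator_of_mem hxρ]
      exact hM x hx
    · rw [indicator_of_notMem hxρ, h0 x hx (by simpa using hxρ), norm_zero]

end Cutoff

/-! ### Logarithmic growth of integrals of degree -n. -/

section Scaling

variable {n : ℕ}

/-- `W` is a cone that stays away, uniformly in scale, from the points `-ε • b`, `ε > 0`. -/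
structure IsShiftedCone (W : Set (𝔼 n)) (b : 𝔼 n) (c : ℝ) : Prop where
  measurableSet : MeasurableSet W
  smul_mem_iff : ∀ t : ℝ, 0 < t → ∀ y, t • y ∈ W ↔ y ∈ W
  ne_zero : ∀ x ∈ W, x ≠ 0
  pos : 0 < c
  le_norm : ∀ x ∈ W, ∀ ε : ℝ, 0 ≤ ε → c * ‖x‖ ≤ ‖x + ε • b‖
  le_norm' : ∀ x ∈ W, ∀ ε : ℝ, 0 ≤ ε → c * ε ≤ ‖x + ε • b‖

lemma IsShiftedCone.integrableOn {W : Set (𝔼 n)} {b : 𝔼 n} {c R : ℝ} (hW : IsShiftedCone W b c)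
    {χ : (𝔼 n) → ℝ} (hχ : IsRadialCutoff R χ) {g : (𝔼 n) → ℂ} (hgm : Measurable g)
    (hgb : ∀ y, ‖g y‖ ≤ (‖y‖ ^ n)⁻¹) {ε : ℝ} (hε : 0 < ε) :
    IntegrableOn (fun x => χ x * g (x + ε • b)) W := by
  have hc := hW.pos
  refine integrableOn_of_bounded_of_eq_zero (M := ((c * ε) ^ n)⁻¹) (ρ := 2 * R) hW.measurableSet
    ?_ (fun x hx => ?_) (fun x hx h => ?_)
  · exact (Complex.measurable_ofReal.comp hχ.contDiff.continuous.measurable).mul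
      (hgm.comp (measurable_id.add_const _))
  · rw [norm_mul, Complex.norm_real, Real.norm_of_nonneg (hχ.nonneg x)]
    calc χ x * ‖g (x + ε • b)‖ ≤ 1 * (‖x + ε • b‖ ^ n)⁻¹ := by
          gcongr
          exacts [hχ.le_one x, hgb _]
      _ ≤ ((c * ε) ^ n)⁻¹ := by
          rw [one_mul]
          gcongr
          exact hW.le_norm' x hx ε hε.le
  · rw [hχ.eq_zero x h.le]
    simp

open scoped Pointwise in
/-- Integrals of homogeneous functions of degree `-n` over truncated cones grow logarithmically
in the distance of the singularity. -/
lemma IsShiftedCone.tendsto_div {W : Set (𝔼 n)} {b : 𝔼 n} {c R : ℝ} (hW : IsShiftedCone W b c)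
    (hR : 0 < R) {χ : (𝔼 n) → ℝ} (hχ : IsRadialCutoff R χ) {g : (𝔼 n) → ℂ} (hgm : Measurable g)
    (hgb : ∀ y, ‖g y‖ ≤ (‖y‖ ^ n)⁻¹) (hgc : ∀ y, y ≠ 0 → ContinuousAt g y)
    (hgh : ∀ t : ℝ, 0 < t → ∀ y, g (t • y) = ((t ^ n : ℝ) : ℂ)⁻¹ * g y) :
    Tendsto (fun j : ℕ => (j : ℝ)⁻¹ • ∫ x in W, χ x * g (x + ((1 / 2 : ℝ) ^ j) • b)) atTop
      (𝓝 (∫ x in W, ((χ x - χ ((2 : ℝ) • x) : ℝ) : ℂ) * g x)) := by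
  have hc := hW.pos
  have hχm := hχ.contDiff.continuous.measurable
  set Γ : ℝ → ℂ := fun ε => ∫ x in W, χ x * g (x + ε • b) with hΓ
  have hχ2 : Continuous fun x : 𝔼 n => χ ((2 : ℝ) • x) :=
    hχ.contDiff.continuous.comp (continuous_const_smul _)
  have hscale : ∀ ε : ℝ, Γ (2 * ε) = ∫ x in W, χ ((2 : ℝ) • x) * g (x + ε • b) := by
    intro ε
    have h1 : (2 : ℝ) • W = W := by
      ext y
      rw [mem_smul_set_iff_inv_smul_mem₀ two_ne_zero, hW.smul_mem_iff _ (by norm_num)]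
    have h2 := Measure.setIntegral_comp_smul volume
      (fun x : 𝔼 n => (χ x : ℂ) * g (x + (2 * ε) • b)) W (R := 2) two_ne_zero
    rw [h1] at h2
    have h3 : ∀ x : 𝔼 n, (χ ((2 : ℝ) • x) : ℂ) * g ((2 : ℝ) • x + (2 * ε) • b) =
        (((2 : ℝ) ^ n : ℝ) : ℂ)⁻¹ * (χ ((2 : ℝ) • x) * g (x + ε • b)) := by
      intro x
      rw [show (2 : ℝ) • x + (2 * ε) • b = (2 : ℝ) • (x + ε • b) by rw [smul_add, smul_smul],
        hgh 2 two_pos]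
      ring
    simp_rw [h3] at h2
    rw [integral_const_mul, finrank_euclideanSpace_fin, abs_of_pos (by positivity),
      Complex.real_smul, Complex.ofReal_inv] at h2
    have h4 : (((2 : ℝ) ^ n : ℝ) : ℂ)⁻¹ ≠ 0 := by
      simp
    exact (mul_left_cancel₀ h4 h2).symm
  have hdiff : ∀ ε : ℝ, 0 < ε → Γ ε - Γ (2 * ε) =
      ∫ x in W, ((χ x - χ ((2 : ℝ) • x) : ℝ) : ℂ) * g (x + ε • b) := by
    intro ε hε
    rw [hscale, hΓ]
    have hi1 := hW.integrableOn hχ hgm hgb hε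
    have hi2 : IntegrableOn (fun x => (χ ((2 : ℝ) • x) : ℂ) * g (x + ε • b)) W := by
      refine integrableOn_of_bounded_of_eq_zero (M := ((c * ε) ^ n)⁻¹) (ρ := R) hW.measurableSet
        ?_ (fun x hx => ?_) (fun x hx h => ?_)
      · exact (Complex.measurable_ofReal.comp hχ2.measurable).mul
          (hgm.comp (measurable_id.add_const _))
      · rw [norm_mul, Complex.norm_real, Real.norm_of_nonneg (hχ.nonneg _)]
        calc χ ((2 : ℝ) • x) * ‖g (x + ε • b)‖ ≤ 1 * (‖x + ε • b‖ ^ n)⁻¹ := by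
              gcongr
              exacts [hχ.le_one _, hgb _]
          _ ≤ ((c * ε) ^ n)⁻¹ := by
              rw [one_mul]
              gcongr
              exact hW.le_norm' x hx ε hε.le
      · rw [hχ.eq_zero _ (by rw [norm_smul, Real.norm_two]; linarith)]
        simp
    rw [← integral_sub hi1 hi2]
    refine integral_congr_ae (Eventually.of_forall fun x => ?_)
    simp only
    push_cast
    ring
  set σ : ℕ → ℝ := fun j => (1 / 2 : ℝ) ^ j with hσ
  have hσ0 : ∀ j, 0 < σ j := fun j => by positivity
  have hσlim : Tendsto (fun j => σ (j + 1)) atTop (𝓝 0) :=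
    (tendsto_add_atTop_iff_nat 1).2 (tendsto_pow_atTop_nhds_zero_of_lt_one (by norm_num)
      (by norm_num))
  have hstep : ∀ j, Γ (σ (j + 1)) - Γ (σ j) =
      ∫ x in W, ((χ x - χ ((2 : ℝ) • x) : ℝ) : ℂ) * g (x + σ (j + 1) • b) := by
    intro j
    rw [← hdiff _ (hσ0 _)]
    congr 2
    rw [hσ]
    ring
  have hlim : Tendsto (fun j => Γ (σ (j + 1)) - Γ (σ j)) atTop
      (𝓝 (∫ x in W, ((χ x - χ ((2 : ℝ) • x) : ℝ) : ℂ) * g x)) := by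
    simp_rw [hstep]
    -- The dyadic difference vanishes for ‖x‖ ≤ R/2, and on the rest of the cone ‖x + εb‖ ≥ cR/2, so
    -- the integrands are bounded uniformly in ε.
    refine tendsto_integral_of_dominated_convergence
      ((Metric.closedBall (0 : 𝔼 n) (2 * R)).indicator fun _ => ((c * (R / 2)) ^ n)⁻¹)
      (fun j => ?_) ?_ (fun j => ?_) ?_
    · refine Measurable.aestronglyMeasurable ?_
      exact (Complex.measurable_ofReal.comp (hχm.sub hχ2.measurable)).mul
        (hgm.comp (measurable_id.add_const _))
    · exact (integrable_indicator_iff measurableSet_closedBall).2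
        (integrableOn_const ((Measure.restrict_apply_le _ _).trans_lt
          (isCompact_closedBall _ _).measure_lt_top).ne)
    · filter_upwards [ae_restrict_mem hW.measurableSet] with x hx
      by_cases hxR : x ∈ Metric.closedBall (0 : 𝔼 n) (2 * R)
      · rw [indicator_of_mem hxR, norm_mul, Complex.norm_real, Real.norm_eq_abs]
        rcases le_total ‖x‖ (R / 2) with h | h
        · rw [hχ.sub_eq_zero_of_le hR h]
          simp only [abs_zero, zero_mul]
          positivity
        · calc |χ x - χ ((2 : ℝ) • x)| * ‖g (x + σ (j + 1) • b)‖
              ≤ 1 * (‖x + σ (j + 1) • b‖ ^ n)⁻¹ := by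
                gcongr
                exacts [hχ.abs_sub_le x, hgb _]
            _ ≤ ((c * (R / 2)) ^ n)⁻¹ := by
                rw [one_mul]
                gcongr
                exact (mul_le_mul_of_nonneg_left h hc.le).trans
                  (hW.le_norm x hx _ (hσ0 _).le)
      · have hx2 : 2 * R ≤ ‖x‖ := by simpa using (not_le.1 fun h => hxR (by simpa using h)).le
        rw [indicator_of_notMem hxR, hχ.sub_eq_zero_of_ge hR hx2]
        simp
    · filter_upwards [ae_restrict_mem hW.measurableSet] with x hx
      refine Tendsto.const_mul _ ((hgc x (hW.ne_zero x hx)).tendsto.comp ?_)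
      have h1 : Tendsto (fun j => x + σ (j + 1) • b) atTop (𝓝 (x + (0 : ℝ) • b)) :=
        tendsto_const_nhds.add (hσlim.smul_const b)
      rwa [zero_smul, add_zero] at h1
  -- The increments converge, so by Cesàro and telescoping the integral at scale 2^(-j), divided by
  -- j, has the same limit.
  have hces := hlim.cesaro_smul
  simp_rw [Finset.sum_range_sub (fun j => Γ (σ j))] at hces
  have h0 : Tendsto (fun j : ℕ => (j : ℝ)⁻¹ • Γ (σ 0)) atTop (𝓝 0) := by
    simpa using (tendsto_inv_atTop_nhds_zero_nat (𝕜 := ℝ)).smul_const (Γ (σ 0))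
  have hsum := hces.add h0
  rw [add_zero] at hsum
  refine hsum.congr fun j => ?_
  rw [← smul_add, sub_add_cancel]

end Scaling

/-! ### Product rule for second derivatives and smoothing near the pole. -/

section GreenBound

variable {n : ℕ}

lemma partialDeriv_partialDeriv_mul {f g : (𝔼 n) → ℂ} {x : 𝔼 n} (hf : ContDiffAt ℝ ∞ f x)
    (hg : ContDiffAt ℝ ∞ g x) (i : Fin n) :
    partialDeriv i (partialDeriv i (fun y => f y * g y)) x =
      partialDeriv i (partialDeriv i f) x * g x + 2 * (partialDeriv i f x * partialDeriv i g x) +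
        f x * partialDeriv i (partialDeriv i g) x := by
  have hnear : ∀ {h : (𝔼 n) → ℂ}, ContDiffAt ℝ ∞ h x → ∀ᶠ y in 𝓝 x, DifferentiableAt ℝ h y := by
    intro h hh
    filter_upwards [(hh.of_le (m := 1) (by exact_mod_cast le_top)).eventually (by simp)] with y hy
    exact hy.differentiableAt (by simp)
  have hd : ∀ {h : (𝔼 n) → ℂ}, ContDiffAt ℝ ∞ h x → DifferentiableAt ℝ (partialDeriv i h) x := by
    intro h hh
    exact ((hh.fderiv_right (m := ∞) (by simp)).clm_apply contDiffAt_const).differentiableAt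
      (by simp)
  have h1 : partialDeriv i (fun y => f y * g y) =ᶠ[𝓝 x]
      fun y => partialDeriv i f y * g y + f y * partialDeriv i g y := by
    filter_upwards [hnear hf, hnear hg] with y hfy hgy using partialDeriv_mul hfy hgy i
  have hf1 := hf.differentiableAt (by simp)
  have hg1 := hg.differentiableAt (by simp)
  rw [partialDeriv_congr h1]
  have h2 : partialDeriv i (fun y => partialDeriv i f y * g y + f y * partialDeriv i g y) x =
      partialDeriv i (fun y => partialDeriv i f y * g y) x +
        partialDeriv i (fun y => f y * partialDeriv i g y) x := by
    simp only [partialDeriv]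
    rw [fderiv_fun_add]
    · simp
    · exact (hd hf).fun_mul hg1
    · exact hf1.fun_mul (hd hg)
  rw [h2, partialDeriv_mul (hd hf) hg1, partialDeriv_mul hf1 (hd hg)]
  ring

lemma partialDeriv_comp_add_right (f : (𝔼 n) → ℂ) (y : 𝔼 n) (i : Fin n) :
    partialDeriv i (fun x => f (x + y)) = fun x => partialDeriv i f (x + y) := by
  ext x
  simp only [partialDeriv, fderiv_comp_add_right]

/-- A function that is smooth off the origin agrees away from the origin with a smooth function. -/
lemma exists_contDiff_eventuallyEq {h : (𝔼 n) → ℂ} (hh : ∀ y, y ≠ 0 → ContDiffAt ℝ ∞ h y) {δ : ℝ}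
    (hδ : 0 < δ) : ∃ h' : (𝔼 n) → ℂ, ContDiff ℝ ∞ h' ∧ ∀ y, δ < ‖y‖ → h' =ᶠ[𝓝 y] h := by
  let β : ContDiffBump (0 : 𝔼 n) := ⟨δ / 2, δ, by positivity, by linarith⟩
  refine ⟨fun y => ((1 - β y : ℝ) : ℂ) * h y, ?_, fun y hy => ?_⟩
  · rw [contDiff_iff_contDiffAt]
    intro y
    rcases eq_or_ne y 0 with rfl | hy
    · refine (contDiffAt_const (c := (0 : ℂ))).congr_of_eventuallyEq ?_
      filter_upwards [Metric.ball_mem_nhds (0 : 𝔼 n) (half_pos hδ)] with z hz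
      rw [β.one_of_mem_closedBall (Metric.ball_subset_closedBall hz)]
      simp
    · have h1 : ContDiffAt ℝ ∞ (fun y => 1 - β y) y := contDiffAt_const.sub β.contDiffAt
      exact (Complex.ofRealCLM.contDiff.contDiffAt.comp y h1).mul (hh y hy)
  · have hopen : IsOpen {z : 𝔼 n | δ < ‖z‖} := isOpen_lt continuous_const continuous_norm
    filter_upwards [hopen.mem_nhds hy] with z hz
    have hz' : δ < ‖z‖ := hz
    rw [β.zero_of_le_dist (by simpa using hz'.le)]
    simp

end GreenBound

/-! ### Sector geometry and the uniform Green bound. -/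

section CornerVanishing

variable {n : ℕ}

/-- The solid sector bisected by `b`, in the plane of `b` and `b'`. -/
abbrev solidSector (b b' : 𝔼 n) (θ : ℝ) : Set (𝔼 n) := planeCoord b b' ⁻¹' planarSector θ

/-- As b bisects the sector, ⟪b, x⟫ ≥ -κ‖x‖ with κ = |cos(θ/2)|, and κ < 1 because 0 < θ < 2π.
Expanding the square gives ‖x + εb‖² ≥ (1 - κ)(‖x‖² + ε²), for convex and non-convex sectors alike.
-/
lemma exists_isShiftedCone_solidSector {b b' : 𝔼 n} (hb : ‖b‖ = 1) (hb' : ‖b'‖ = 1)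
    (hbb' : inner ℝ b b' = 0) {θ : ℝ} (h0 : 0 < θ) (h2 : θ < 2 * Real.pi) :
    ∃ c, IsShiftedCone (solidSector b b' θ) b c := by
  set κ := |Real.cos (θ / 2)| with hκ
  have hκ0 : 0 ≤ κ := abs_nonneg _
  have hsin : 0 < Real.sin (θ / 2) := Real.sin_pos_of_pos_of_lt_pi (by linarith) (by linarith)
  have hκ1 : κ < 1 := by
    refine (sq_lt_one_iff_abs_lt_one _).1 ?_
    nlinarith [Real.sin_sq_add_cos_sq (θ / 2)]
  have hlow : ∀ x ∈ solidSector b b' θ, ∀ ε : ℝ, 0 ≤ ε →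
      (1 - κ) * (‖x‖ ^ 2 + ε ^ 2) ≤ ‖x + ε • b‖ ^ 2 := by
    intro x hx ε hε
    have h1 : -(κ * ‖x‖) ≤ inner ℝ b x := by
      have hre : inner ℝ b x = (planeCoord b b' x).re := by simp [planeCoord_apply]
      have hcos : Real.cos (θ / 2) ≤ Real.cos (planeCoord b b' x).arg := by
        rw [← Real.cos_abs (planeCoord b b' x).arg]
        exact Real.cos_le_cos_of_nonneg_of_le_pi (abs_nonneg _) (by linarith) hx.2.le
      rw [hre, ← Complex.norm_mul_cos_arg]
      have h3 := norm_planeCoord_le hb hb' hbb' x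
      have h4 : -κ ≤ Real.cos (planeCoord b b' x).arg := (neg_abs_le _).trans hcos
      have h5 := norm_nonneg (planeCoord b b' x)
      nlinarith
    rw [norm_add_sq_real, inner_smul_right, norm_smul, hb, real_inner_comm,
      Real.norm_of_nonneg hε]
    have h6 := mul_le_mul_of_nonneg_left h1 hε
    nlinarith [mul_nonneg hκ0 (sq_nonneg (‖x‖ - ε))]
  have hc : 0 < √(1 - κ) := Real.sqrt_pos.2 (by linarith)
  have hsq : √(1 - κ) ^ 2 = 1 - κ := Real.sq_sqrt (by linarith)
  refine ⟨√(1 - κ), ⟨?_, ?_, ?_, hc, ?_, ?_⟩⟩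
  · exact (planeCoord b b').continuous.measurable (measurableSet_planarSector θ)
  · intro t ht y
    rw [mem_preimage, map_smul, Complex.real_smul, real_mul_mem_planarSector ht, mem_preimage]
  · rintro x hx rfl
    exact hx.1 (map_zero _)
  · intro x hx ε hε
    refine (sq_le_sq₀ (by positivity) (norm_nonneg _)).1 (le_trans ?_ (hlow x hx ε hε))
    rw [mul_pow, hsq]
    nlinarith [sq_nonneg ε]
  · intro x hx ε hε
    refine (sq_le_sq₀ (by positivity) (norm_nonneg _)).1 (le_trans ?_ (hlow x hx ε hε))
    rw [mul_pow, hsq]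
    nlinarith [sq_nonneg ‖x‖]

lemma measurable_singularHarmonic (b b' : 𝔼 n) : Measurable (singularHarmonic b b') := by
  have h : Measurable (invNormPow (n := n) (n + 2)) :=
    Complex.measurable_ofReal.comp (measurable_norm.pow_const _).inv
  exact ((planeCoord b b').continuous.measurable.mul
    (planeCoord b b').continuous.measurable).mul h

/-- Up to the factor 2π the integral is sin θ times the integral of a nonnegative
continuous-off-zero density, which is positive at R b: there χ = 1, while χ(2R b) = 0. The
assumption θ ≠ π gives sin θ ≠ 0. -/
lemma integral_sub_mul_singularHarmonic_ne_zero {b b' : 𝔼 n} (hb : ‖b‖ = 1) (hb' : ‖b'‖ = 1)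
    (hbb' : inner ℝ b b' = 0) {θ : ℝ} (h0 : 0 < θ) (h2 : θ < 2 * Real.pi) (hne : θ ≠ Real.pi)
    {R : ℝ} (hR : 0 < R) {χ : (𝔼 n) → ℝ} (hχ : IsRadialCutoff R χ) :
    ∫ x in solidSector b b' θ, ((χ x - χ ((2 : ℝ) • x) : ℝ) : ℂ) * singularHarmonic b b' x ≠ 0 := by
  set q : (𝔼 n) → ℝ := fun x => (χ x - χ ((2 : ℝ) • x)) * (‖x‖ ^ (n + 2))⁻¹ with hq
  have hχ2 : Continuous fun x : 𝔼 n => χ ((2 : ℝ) • x) :=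
    hχ.contDiff.continuous.comp (continuous_const_smul _)
  have hζ := (planeCoord b b').continuous
  have hqm : Measurable q :=
    (hχ.contDiff.continuous.measurable.sub hχ2.measurable).mul (measurable_norm.pow_const _).inv
  have hq0 : ∀ x, 0 ≤ q x := fun x => mul_nonneg (hχ.sub_nonneg x) (by positivity)
  have hqr : ∀ x y, ‖x‖ = ‖y‖ → q x = q y := by
    intro x y hxy
    simp only [hq]
    rw [hxy, hχ.radial x y hxy, hχ.radial ((2 : ℝ) • x) ((2 : ℝ) • y) (by
      rw [norm_smul, norm_smul, hxy])]
  have hqi : Integrable (fun x => q x * ‖planeCoord b b' x‖ ^ 2) := by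
    have h3 : IntegrableOn (fun x => ((q x * ‖planeCoord b b' x‖ ^ 2 : ℝ) : ℂ)) univ := by
      refine integrableOn_of_bounded_of_eq_zero (M := ((R / 2) ^ n)⁻¹) (ρ := 2 * R)
        MeasurableSet.univ ?_ (fun x _ => ?_) (fun x _ hx => ?_)
      · exact Complex.measurable_ofReal.comp (hqm.mul (hζ.measurable.norm.pow_const 2))
      · rw [Complex.norm_real, Real.norm_of_nonneg (mul_nonneg (hq0 x) (by positivity))]
        rcases le_total ‖x‖ (R / 2) with h | h
        · simp only [hq]
          rw [hχ.sub_eq_zero_of_le hR h, zero_mul, zero_mul]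
          positivity
        · have hx0 : 0 < ‖x‖ := by linarith
          calc q x * ‖planeCoord b b' x‖ ^ 2 ≤ (1 * (‖x‖ ^ (n + 2))⁻¹) * ‖x‖ ^ 2 := by
                simp only [hq]
                gcongr
                exacts [(le_abs_self _).trans (hχ.abs_sub_le x), norm_planeCoord_le hb hb' hbb' x]
            _ = (‖x‖ ^ n)⁻¹ := by
                rw [pow_add]
                field_simp
            _ ≤ ((R / 2) ^ n)⁻¹ := by gcongr
      · simp only [hq]
        rw [hχ.sub_eq_zero_of_ge hR hx.le]
        simp
    rw [integrableOn_univ] at h3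
    exact h3.re
  have hpos : 0 < ∫ x, q x * ‖planeCoord b b' x‖ ^ 2 := by
    rw [integral_pos_iff_support_of_nonneg (fun x => mul_nonneg (hq0 x) (by positivity)) hqi]
    have hRb : ‖R • b‖ = R := by rw [norm_smul, hb, mul_one, Real.norm_of_nonneg hR.le]
    have hne0 : R • b ≠ 0 := norm_ne_zero_iff.1 (by rw [hRb]; exact hR.ne')
    have hcont : ContinuousAt (fun x => q x * ‖planeCoord b b' x‖ ^ 2) (R • b) := by
      refine ContinuousAt.mul (ContinuousAt.mul (hχ.contDiff.continuous.sub hχ2).continuousAt ?_)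
        (hζ.norm.pow 2).continuousAt
      exact (continuous_norm.pow _).continuousAt.inv₀ (pow_ne_zero _ (norm_ne_zero_iff.2 hne0))
    have hval : q (R • b) * ‖planeCoord b b' (R • b)‖ ^ 2 ≠ 0 := by
      have h3 : ‖planeCoord b b' (R • b)‖ ^ 2 = R ^ 2 := by
        rw [norm_planeCoord_sq, inner_smul_right, inner_smul_right, real_inner_self_eq_norm_sq,
          hb, real_inner_comm, hbb']
        ring
      have h4 : ‖(2 : ℝ) • R • b‖ = 2 * R := by rw [norm_smul, hRb, Real.norm_two]
      simp only [hq]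
      rw [h3, hRb, hχ.eq_one _ hRb.le, hχ.eq_zero _ h4.ge]
      simp [hR.ne']
    exact Measure.measure_pos_of_mem_nhds _ (hcont.eventually_ne hval)
  have hmain := integral_solidSector hb hb' hbb' h0 h2 hqm hqr hqi
  have heq : ∫ x in solidSector b b' θ,
      ((χ x - χ ((2 : ℝ) • x) : ℝ) : ℂ) * singularHarmonic b b' x =
      ∫ x in planeCoord b b' ⁻¹' planarSector θ, q x * planeCoord b b' x ^ 2 := by
    refine integral_congr_ae (Eventually.of_forall fun x => ?_)
    simp only [hq, singularHarmonic, invNormPow]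
    push_cast
    ring
  rw [heq]
  intro hzero
  rw [hzero, mul_zero] at hmain
  have hsin : Real.sin θ ≠ 0 := by
    intro hs
    rcases lt_or_gt_of_ne hne with h | h
    · exact (Real.sin_pos_of_pos_of_lt_pi h0 h).ne' hs
    · have := Real.sin_pos_of_pos_of_lt_pi (x := θ - Real.pi) (by linarith) (by linarith)
      rw [Real.sin_sub_pi, hs] at this
      simp at this
  exact (mul_ne_zero hsin hpos.ne') (Complex.ofReal_eq_zero.1 hmain.symm)

/-- Green's formula against the shifted singular harmonic function. -/
lemma exists_norm_integral_mul_singularHarmonic_le {b b' : 𝔼 n} (hb : ‖b‖ = 1) (hb' : ‖b'‖ = 1)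
    (hbb' : inner ℝ b b' = 0) {W : Set (𝔼 n)} {c : ℝ} (hW : IsShiftedCone W b c)
    {R r : ℝ} (hR : 0 < R) (hRr : 2 * R < r) {χ : (𝔼 n) → ℝ} (hχ : IsRadialCutoff R χ)
    {U F : (𝔼 n) → ℂ} (hU : Integrable U)
    (hzero : ∀ x, ‖x‖ < r → x ∉ W → U x = 0 ∧ F x = 0)
    (hgreen : ∀ ψ, IsTestFunction univ ψ →
      ∫ x, U x * ∑ i, partialDeriv i (partialDeriv i ψ) x = ∫ x, F x * ψ x) :
    ∃ C, ∀ ε : ℝ, 0 < ε →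
      ‖∫ x in W, F x * (χ x * singularHarmonic b b' (x + ε • b))‖ ≤ C := by
  have hc := hW.pos
  have hχt := hχ.isTestFunction
  choose M₁ hM₁0 hM₁ using fun i => (hχt.partialDeriv i).exists_bound
  choose M₂ hM₂0 hM₂ using fun i => ((hχt.partialDeriv i).partialDeriv i).exists_bound
  set h := singularHarmonic b b' with hh
  set K : ℝ := ∑ i, (M₂ i * ((c * R) ^ n)⁻¹ +
    2 * (M₁ i * ((n + 4) * ((c * R) ^ (n + 1))⁻¹))) with hK
  have hK0 : 0 ≤ K := Finset.sum_nonneg fun i _ => by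
    have := hM₁0 i
    have := hM₂0 i
    positivity
  refine ⟨K * ∫ x, ‖U x‖, fun ε hε => ?_⟩
  -- The pole is smoothed out at distance cε/2. The cone stays at distance at least cε from it, so
  -- nothing changes near points of the cone and the product with χ becomes an admissible test
  -- function.
  obtain ⟨h', hh'c, hh'⟩ := exists_contDiff_eventuallyEq
    (fun y hy => contDiffAt_singularHarmonic b b' hy) (δ := c * ε / 2) (by positivity)
  set ψ : (𝔼 n) → ℂ := fun x => χ x * h' (x + ε • b) with hψ
  have hψt : IsTestFunction univ ψ := by
    refine ⟨hχt.contDiff.mul (hh'c.comp (contDiff_id.add contDiff_const)), ?_, subset_univ _⟩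
    exact hχt.hasCompactSupport.mul_right
  have hnear : ∀ x ∈ W, ∀ᶠ y in 𝓝 x, h' (y + ε • b) = h (y + ε • b) := by
    intro x hx
    have h1 := hh' (x + ε • b) (by
      have := hW.le_norm' x hx ε hε.le
      have : 0 < c * ε := by positivity
      linarith)
    exact (Continuous.tendsto (f := fun y : 𝔼 n => y + ε • b) (by fun_prop) x).eventually h1
  have hF : ∫ x in W, F x * (χ x * h (x + ε • b)) = ∫ x, F x * ψ x := by
    have h1 : ∫ x in W, F x * (χ x * h (x + ε • b)) = ∫ x in W, F x * ψ x := by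
      refine setIntegral_congr_fun hW.measurableSet fun x hx => ?_
      simp only [hψ]
      rw [(hnear x hx).self_of_nhds]
    rw [h1]
    refine setIntegral_eq_integral_of_forall_compl_eq_zero fun x hx => ?_
    rcases lt_or_ge ‖x‖ r with hxr | hxr
    · rw [(hzero x hxr hx).2, zero_mul]
    · simp only [hψ]
      rw [hχ.eq_zero x (hRr.le.trans hxr)]
      simp
  rw [hF, ← hgreen ψ hψt]
  -- Since h is harmonic, every surviving term contains a derivative of χ, hence is zero for ‖x‖ <
  -- R. For ‖x‖ ≥ R on the cone, ‖x + εb‖ ≥ cR, so the bound does not depend on ε.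
  have hbound : ∀ x, ‖U x * ∑ i, partialDeriv i (partialDeriv i ψ) x‖ ≤ ‖U x‖ * K := by
    intro x
    rw [norm_mul]
    by_cases hx : x ∈ W
    · gcongr
      set y := x + ε • b with hy
      have hyR : c * ‖x‖ ≤ ‖y‖ := hW.le_norm x hx ε hε.le
      have hx0 : 0 < ‖x‖ := norm_pos_iff.2 (hW.ne_zero x hx)
      have hy0 : y ≠ 0 := norm_pos_iff.1 (lt_of_lt_of_le (by positivity) hyR)
      have hhy : ContDiffAt ℝ ∞ h y := contDiffAt_singularHarmonic b b' hy0
      have hhx : ContDiffAt ℝ ∞ (fun x => h (x + ε • b)) x := by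
        have h3 : ContDiffAt ℝ ∞ (fun x : 𝔼 n => x + ε • b) x := by fun_prop
        exact ContDiffAt.comp x hhy h3
      have h1 : ψ =ᶠ[𝓝 x] fun x => (χ x : ℂ) * h (x + ε • b) := by
        filter_upwards [hnear x hx] with z hz
        simp only [hψ]
        rw [hz]
      have h2 : ∀ i, partialDeriv i (partialDeriv i ψ) x =
          (partialDeriv i (partialDeriv i fun x => (χ x : ℂ)) x * h y +
            2 * (partialDeriv i (fun x => (χ x : ℂ)) x * partialDeriv i h y)) +
          χ x * partialDeriv i (partialDeriv i h) y := by
        intro i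
        rw [partialDeriv_congr (partialDeriv_congr_eventually h1 i),
          partialDeriv_partialDeriv_mul hχt.contDiff.contDiffAt hhx, partialDeriv_comp_add_right,
          partialDeriv_comp_add_right]
      simp_rw [h2]
      rw [Finset.sum_add_distrib, ← Finset.mul_sum,
        sum_partialDeriv_partialDeriv_singularHarmonic hb hb' hbb' hy0, mul_zero, add_zero]
      rcases lt_or_ge ‖x‖ R with hxR | hxR
      · have hev : (fun x => (χ x : ℂ)) =ᶠ[𝓝 x] fun _ => 1 := by
          have hopen : IsOpen {z : 𝔼 n | ‖z‖ < R} := isOpen_lt continuous_norm continuous_const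
          filter_upwards [hopen.mem_nhds hxR] with z hz
          have hz' : ‖z‖ < R := hz
          rw [hχ.eq_one z hz'.le, Complex.ofReal_one]
        have hconst : ∀ (i : Fin n) (a : ℂ), partialDeriv i (fun _ : 𝔼 n => a) = fun _ => 0 := by
          intro i a
          ext z
          simp [partialDeriv]
        have h3 : ∀ i, partialDeriv i (fun x => (χ x : ℂ)) x = 0 := fun i => by
          rw [partialDeriv_congr hev, hconst]
        have h4 : ∀ i, partialDeriv i (partialDeriv i fun x => (χ x : ℂ)) x = 0 := fun i => by
          rw [partialDeriv_congr (partialDeriv_congr_eventually hev i), hconst, hconst]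
        simp [h3, h4, hK0]
      · refine (norm_sum_le _ _).trans (Finset.sum_le_sum fun i _ => ?_)
        have hcR : c * R ≤ ‖y‖ := (mul_le_mul_of_nonneg_left hxR hc.le).trans hyR
        refine (norm_add_le _ _).trans ?_
        simp only [norm_mul, Complex.norm_ofNat]
        have e1 : ‖h y‖ ≤ ((c * R) ^ n)⁻¹ :=
          (norm_singularHarmonic_le hb hb' hbb' y).trans (by gcongr)
        have e2 : ‖partialDeriv i h y‖ ≤ (n + 4) * ((c * R) ^ (n + 1))⁻¹ :=
          (norm_partialDeriv_singularHarmonic_le hb hb' hbb' hy0 i).trans (by gcongr)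
        have e3 := hM₁0 i
        have e4 := hM₂0 i
        gcongr
        exacts [hM₂ i x, hM₁ i x]
    · rcases lt_or_ge ‖x‖ r with hxr | hxr
      · rw [(hzero x hxr hx).1, norm_zero, zero_mul, zero_mul]
      · have hsupp : x ∉ tsupport ψ := by
          intro hx'
          have hsub : tsupport ψ ⊆ Metric.closedBall 0 (2 * R) := by
            refine closure_minimal (fun z hz => ?_) Metric.isClosed_closedBall
            by_contra hz'
            refine hz ?_
            have hz2 : 2 * R ≤ ‖z‖ := by simpa using (not_le.1 fun h => hz' (by simpa using h)).le
            simp only [hψ]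
            rw [hχ.eq_zero z hz2]
            simp
          have := hsub hx'
          rw [mem_closedBall_zero_iff] at this
          linarith
        have h3 : ∀ i, partialDeriv i (partialDeriv i ψ) x = 0 := fun i =>
          image_eq_zero_of_notMem_tsupport fun hx' => hsupp
            (tsupport_partialDeriv_subset ψ i (tsupport_partialDeriv_subset _ i hx'))
        simp only [h3, Finset.sum_const_zero, norm_zero, mul_zero]
        positivity
  refine (norm_integral_le_of_norm_le (hU.norm.mul_const K)
    (Eventually.of_forall hbound)).trans (le_of_eq ?_)
  rw [integral_mul_const, mul_comm]

end CornerVanishing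

/-! ### The vanishing theorem on a sector. -/

section CornerVanishing

variable {n : ℕ}

/-- If `Δ U = F` holds across a solid sector of opening angle different from `π`, outside of which
both functions vanish, then the boundary value of `F` at the apex is zero. -/
theorem eq_zero_of_solidSector {b b' : 𝔼 n} (hb : ‖b‖ = 1) (hb' : ‖b'‖ = 1)
    (hbb' : inner ℝ b b' = 0) {θ : ℝ} (h0 : 0 < θ) (h2 : θ < 2 * Real.pi) (hne : θ ≠ Real.pi)
    {r : ℝ} (hr : 0 < r) {U F : (𝔼 n) → ℂ} (hU : Integrable U) (hF : Integrable F)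
    (hzero : ∀ x, ‖x‖ < r → x ∉ solidSector b b' θ → U x = 0 ∧ F x = 0)
    (hgreen : ∀ ψ, IsTestFunction univ ψ →
      ∫ x, U x * ∑ i, partialDeriv i (partialDeriv i ψ) x = ∫ x, F x * ψ x) {f₀ : ℂ}
    (hlim : ∀ δ : ℝ, 0 < δ → ∃ r₀ : ℝ, 0 < r₀ ∧
      ∀ᵐ x : 𝔼 n, x ∈ solidSector b b' θ → ‖x‖ < r₀ → ‖F x - f₀‖ ≤ δ) : f₀ = 0 := by
  obtain ⟨c, hW⟩ := exists_isShiftedCone_solidSector hb hb' hbb' h0 h2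
  set W := solidSector b b' θ with hWdef
  have hc := hW.pos
  set R := r / 3 with hRdef
  have hR : 0 < R := by positivity
  obtain ⟨χ, hχ⟩ := exists_isRadialCutoff (n := n) hR
  set h := singularHarmonic b b' with hh
  have hhm : Measurable h := measurable_singularHarmonic b b'
  have hhb : ∀ y, ‖h y‖ ≤ (‖y‖ ^ n)⁻¹ := norm_singularHarmonic_le hb hb' hbb'
  have hhc : ∀ y, y ≠ 0 → ContinuousAt h y := fun y hy =>
    (contDiffAt_singularHarmonic b b' hy).continuousAt
  have hhm' : Measurable fun y => (‖h y‖ : ℂ) := Complex.measurable_ofReal.comp hhm.norm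
  have hhb' : ∀ y, ‖(‖h y‖ : ℂ)‖ ≤ (‖y‖ ^ n)⁻¹ := fun y => by
    rw [Complex.norm_real, norm_norm]
    exact hhb y
  obtain ⟨C, hC⟩ := exists_norm_integral_mul_singularHarmonic_le hb hb' hbb' hW hR
    (by linarith : 2 * R < r) hχ hU hzero hgreen
  have hL := hW.tendsto_div hR hχ hhm hhb hhc fun t ht y => singularHarmonic_smul b b' ht y
  have hL' := hW.tendsto_div hR hχ hhm' hhb'
    (fun y hy => Complex.continuous_ofReal.continuousAt.comp (hhc y hy).norm)
    (fun t ht y => by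
      rw [hh, singularHarmonic_smul b b' ht y, norm_mul, norm_inv, Complex.norm_real,
        Real.norm_of_nonneg (by positivity)]
      push_cast
      rfl)
  have hLne : ∫ x in W, ((χ x - χ ((2 : ℝ) • x) : ℝ) : ℂ) * h x ≠ 0 :=
    integral_sub_mul_singularHarmonic_ne_zero hb hb' hbb' h0 h2 hne hR hχ
  set L := ∫ x in W, ((χ x - χ ((2 : ℝ) • x) : ℝ) : ℂ) * h x
  set L' := ∫ x in W, ((χ x - χ ((2 : ℝ) • x) : ℝ) : ℂ) * (‖h x‖ : ℂ)
  -- The growth rate of the f₀ term is compared with that of the error F - f₀, which near the apex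
  -- is at most δ times the growth rate of the integral of ‖h‖. Bounded contributions disappear
  -- after division by j.
  have hkey : ∀ δ : ℝ, 0 < δ → ‖f₀‖ * ‖L‖ ≤ δ * ‖L'‖ := by
    intro δ hδ
    obtain ⟨r₀, hr₀, hF₀⟩ := hlim δ hδ
    -- Controls the error away from the apex: for ‖x‖ ≥ r₀ on the cone the shifted h is at most (c
    -- r₀)^(-n), uniformly in ε.
    set B : (𝔼 n) → ℝ := fun x =>
      (‖F x‖ + (Metric.closedBall (0 : 𝔼 n) (2 * R)).indicator (fun _ => ‖f₀‖) x) *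
        ((c * r₀) ^ n)⁻¹ with hB
    have hBi : Integrable B := by
      refine (hF.norm.add ?_).mul_const _
      exact (integrable_indicator_iff measurableSet_closedBall).2
        (integrableOn_const (isCompact_closedBall _ _).measure_lt_top.ne)
    have hB0 : ∀ x, 0 ≤ B x := by
      intro x
      have : 0 ≤ (Metric.closedBall (0 : 𝔼 n) (2 * R)).indicator (fun _ => ‖f₀‖) x :=
        indicator_nonneg (fun _ _ => norm_nonneg _) x
      positivity
    have hstep : ∀ ε : ℝ, 0 < ε → ‖f₀‖ * ‖∫ x in W, χ x * h (x + ε • b)‖ ≤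
        (C + ∫ x in W, B x) + δ * ‖∫ x in W, χ x * (‖h (x + ε • b)‖ : ℂ)‖ := by
      intro ε hε
      have hi1 : IntegrableOn (fun x => χ x * h (x + ε • b)) W := hW.integrableOn hχ hhm hhb hε
      have hi2 : IntegrableOn (fun x => χ x * (‖h (x + ε • b)‖ : ℂ)) W :=
        hW.integrableOn hχ hhm' hhb' hε
      have hi3 : IntegrableOn (fun x => χ x * ‖h (x + ε • b)‖) W := by
        have := hi2.re
        refine this.congr (Eventually.of_forall fun x => ?_)
        simp
      have hi4 : IntegrableOn (fun x => F x * (χ x * h (x + ε • b))) W := by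
        refine hF.integrableOn.mul_bdd (c := ((c * ε) ^ n)⁻¹) hi1.aestronglyMeasurable ?_
        filter_upwards [ae_restrict_mem hW.measurableSet] with x hx
        rw [norm_mul, Complex.norm_real, Real.norm_of_nonneg (hχ.nonneg x)]
        calc χ x * ‖h (x + ε • b)‖ ≤ 1 * (‖x + ε • b‖ ^ n)⁻¹ := by
              gcongr
              exacts [hχ.le_one x, hhb _]
          _ ≤ ((c * ε) ^ n)⁻¹ := by
              rw [one_mul]
              gcongr
              exact hW.le_norm' x hx ε hε.le
      have h3 : f₀ * ∫ x in W, χ x * h (x + ε • b) =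
          (∫ x in W, F x * (χ x * h (x + ε • b))) -
            ∫ x in W, (F x - f₀) * (χ x * h (x + ε • b)) := by
        simp_rw [sub_mul]
        rw [integral_sub hi4 (hi1.const_mul f₀), integral_const_mul]
        ring
      have h4 : ‖∫ x in W, (F x - f₀) * (χ x * h (x + ε • b))‖ ≤
          ∫ x in W, (δ * (χ x * ‖h (x + ε • b)‖) + B x) := by
        refine norm_integral_le_of_norm_le ((hi3.const_mul δ).add hBi.integrableOn) ?_
        filter_upwards [ae_restrict_mem hW.measurableSet, ae_restrict_of_ae hF₀] with x hx hFx
        rw [norm_mul, norm_mul, Complex.norm_real, Real.norm_of_nonneg (hχ.nonneg x)]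
        have hχ0 := hχ.nonneg x
        rcases lt_or_ge ‖x‖ r₀ with hxr | hxr
        · have := hFx hx hxr
          have : ‖F x - f₀‖ * (χ x * ‖h (x + ε • b)‖) ≤ δ * (χ x * ‖h (x + ε • b)‖) := by gcongr
          linarith [hB0 x]
        · have h5 : ‖F x - f₀‖ * χ x ≤
              ‖F x‖ + (Metric.closedBall (0 : 𝔼 n) (2 * R)).indicator (fun _ => ‖f₀‖) x := by
            by_cases hxR : x ∈ Metric.closedBall (0 : 𝔼 n) (2 * R)
            · rw [indicator_of_mem hxR]
              calc ‖F x - f₀‖ * χ x ≤ ‖F x - f₀‖ * 1 := by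
                    gcongr
                    exact hχ.le_one x
                _ ≤ _ := by
                    rw [mul_one]
                    exact norm_sub_le _ _
            · rw [indicator_of_notMem hxR, hχ.eq_zero x
                (by simpa using (not_le.1 fun h => hxR (by simpa using h)).le), mul_zero, add_zero]
              exact norm_nonneg _
          have h6 : ‖h (x + ε • b)‖ ≤ ((c * r₀) ^ n)⁻¹ := by
            refine (hhb _).trans ?_
            gcongr
            exact (mul_le_mul_of_nonneg_left hxr hc.le).trans (hW.le_norm x hx ε hε.le)
          have h7 : ‖F x - f₀‖ * (χ x * ‖h (x + ε • b)‖) ≤ B x := by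
            rw [← mul_assoc]
            have h0' : 0 ≤ (Metric.closedBall (0 : 𝔼 n) (2 * R)).indicator (fun _ => ‖f₀‖) x :=
              indicator_nonneg (fun _ _ => norm_nonneg _) x
            exact mul_le_mul h5 h6 (norm_nonneg _) (add_nonneg (norm_nonneg _) h0')
          have : 0 ≤ δ * (χ x * ‖h (x + ε • b)‖) := by positivity
          linarith
      have h8 : ∫ x in W, (δ * (χ x * ‖h (x + ε • b)‖) + B x) ≤
          δ * ‖∫ x in W, χ x * (‖h (x + ε • b)‖ : ℂ)‖ + ∫ x in W, B x := by
        rw [integral_add (hi3.const_mul δ) hBi.integrableOn, integral_const_mul]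
        have h9 : ∫ x in W, χ x * (‖h (x + ε • b)‖ : ℂ) =
            ((∫ x in W, χ x * ‖h (x + ε • b)‖ : ℝ) : ℂ) := by
          rw [← integral_complex_ofReal]
          simp
        rw [h9, Complex.norm_real]
        gcongr
        exact le_abs_self _
      rw [← norm_mul, h3]
      refine (norm_sub_le _ _).trans ?_
      linarith [hC ε hε]
    have hl1 := hL.norm.const_mul ‖f₀‖
    have hl2 : Tendsto (fun j : ℕ => (j : ℝ)⁻¹ * (C + ∫ x in W, B x) +
        δ * ‖(j : ℝ)⁻¹ • ∫ x in W, χ x * (‖h (x + ((1 / 2 : ℝ) ^ j) • b)‖ : ℂ)‖) atTop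
        (𝓝 (0 * (C + ∫ x in W, B x) + δ * ‖L'‖)) :=
      ((tendsto_inv_atTop_nhds_zero_nat (𝕜 := ℝ)).mul_const _).add (hL'.norm.const_mul δ)
    rw [zero_mul, zero_add] at hl2
    refine le_of_tendsto_of_tendsto' hl1 hl2 fun j => ?_
    have h10 := mul_le_mul_of_nonneg_left (hstep ((1 / 2 : ℝ) ^ j) (by positivity))
      (inv_nonneg.2 (Nat.cast_nonneg (α := ℝ) j))
    simp only [norm_smul, Real.norm_of_nonneg (inv_nonneg.2 (Nat.cast_nonneg (α := ℝ) j))]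
    linarith
  by_contra hf₀
  have hpos : 0 < ‖f₀‖ * ‖L‖ := mul_pos (norm_pos_iff.2 hf₀) (norm_pos_iff.2 hLne)
  -- This δ makes the right side at most half of ‖f₀‖ ‖L‖; the added 1 avoids division by zero.
  have hfin := hkey (‖f₀‖ * ‖L‖ / (2 * (‖L'‖ + 1))) (by positivity)
  have h11 : ‖f₀‖ * ‖L‖ / (2 * (‖L'‖ + 1)) * ‖L'‖ < ‖f₀‖ * ‖L‖ := by
    rw [div_mul_eq_mul_div, div_lt_iff₀ (by positivity)]
    nlinarith [norm_nonneg L']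
  linarith

end CornerVanishing

/-! ### Extension of H²₀ functions by zero. -/

section ZeroExtension

variable {n : ℕ}

lemma tendsto_integral_mul_of_eLpNorm {α : Type*} [MeasurableSpace α] {μ : Measure α}
    {f : ℕ → α → ℂ} {f₀ g : α → ℂ} (hf : ∀ m, MemLp (f m) 2 μ) (hf₀ : MemLp f₀ 2 μ)
    (hg : MemLp g 2 μ) (h : Tendsto (fun m => eLpNorm (f m - f₀) 2 μ) atTop (𝓝 0)) :
    Tendsto (fun m => ∫ x, f m x * g x ∂μ) atTop (𝓝 (∫ x, f₀ x * g x ∂μ)) := by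
  refine tendsto_integral_of_L1' _ (hf₀.integrable_mul hg).aestronglyMeasurable
    (Eventually.of_forall fun m => (hf m).integrable_mul hg) ?_
  have h1 : Tendsto (fun m => eLpNorm (f m - f₀) 2 μ * eLpNorm g 2 μ) atTop (𝓝 0) := by
    simpa using ENNReal.Tendsto.mul_const h (Or.inr hg.eLpNorm_ne_top)
  refine tendsto_of_tendsto_of_tendsto_of_le_of_le tendsto_const_nhds h1 (fun _ => zero_le)
    fun m => ?_
  have h2 := eLpNorm_smul_le_mul_eLpNorm (p := 2) (q := 2) (r := 1) hg.1 ((hf m).sub hf₀).1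
  refine le_trans (le_of_eq ?_) h2
  congr 1
  ext x
  simp [sub_mul]

lemma IsTestFunction.memLp {U : Set (𝔼 n)} {φ : (𝔼 n) → ℂ} (hφ : IsTestFunction U φ)
    (p : ℝ≥0∞) : MemLp φ p :=
  hφ.contDiff.continuous.memLp_of_hasCompactSupport hφ.hasCompactSupport

/-- For the approximating test functions, integration by parts holds against any test function of
the whole space, without boundary terms. Both sides pass to the limit in L². Approximation from
inside Ω thus replaces any regularity of the boundary. -/
lemma isWeakPartial_indicator {Ω : Set (𝔼 n)} (hΩ : MeasurableSet Ω) {f g : (𝔼 n) → ℂ}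
    (hf : MemLp f 2 (volume.restrict Ω)) (hg : MemLp g 2 (volume.restrict Ω)) {i : Fin n}
    {φ : ℕ → (𝔼 n) → ℂ} (hφ : ∀ m, IsTestFunction Ω (φ m))
    (hφf : Tendsto (fun m => eLpNorm (φ m - f) 2 (volume.restrict Ω)) atTop (𝓝 0))
    (hφg : Tendsto (fun m => eLpNorm (partialDeriv i (φ m) - g) 2 (volume.restrict Ω))
      atTop (𝓝 0)) : IsWeakPartial univ i (Ω.indicator f) (Ω.indicator g) := by
  intro ψ hψ
  have hind : ∀ F K : (𝔼 n) → ℂ, ∫ x, Ω.indicator F x * K x = ∫ x in Ω, F x * K x := by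
    intro F K
    rw [← integral_indicator hΩ]
    congr 1
    ext x
    by_cases hx : x ∈ Ω <;> simp [hx]
  rw [setIntegral_univ, setIntegral_univ, hind, hind]
  have l1 := tendsto_integral_mul_of_eLpNorm (fun m => ((hφ m).memLp 2).restrict Ω) hf
    (((hψ.partialDeriv i).memLp 2).restrict Ω) hφf
  have l2 := tendsto_integral_mul_of_eLpNorm
    (fun m => (((hφ m).partialDeriv i).memLp 2).restrict Ω) hg ((hψ.memLp 2).restrict Ω) hφg
  refine tendsto_nhds_unique (l1.congr fun m => ?_) l2.neg
  have hfull : ∀ F : (𝔼 n) → ℂ, IsTestFunction Ω F → ∀ K : (𝔼 n) → ℂ,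
      ∫ x in Ω, F x * K x = ∫ x, F x * K x := by
    intro F hF K
    refine setIntegral_eq_integral_of_forall_compl_eq_zero fun x hx => ?_
    rw [image_eq_zero_of_notMem_tsupport fun hx' => hx (hF.tsupport_subset hx'), zero_mul]
  rw [hfull _ (hφ m), hfull _ ((hφ m).partialDeriv i)]
  have hint : ∀ F K : (𝔼 n) → ℂ, IsTestFunction Ω F → IsTestFunction univ K →
      Integrable fun x => F x * K x := fun F K hF hK =>
    (hF.memLp 2).integrable_mul (hK.memLp 2)
  exact integral_mul_fderiv_eq_neg_fderiv_mul_of_integrable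
    (hint _ _ ((hφ m).partialDeriv i) hψ) (hint _ _ (hφ m) (hψ.partialDeriv i))
    (hint _ _ (hφ m) hψ) (fun x _ => (hφ m).contDiff.differentiable (by simp) x)
    (fun x _ => hψ.contDiff.differentiable (by simp) x)

/-- Functions of `H²₀(Ω)`, extended by zero, belong to `H²` of the whole space. -/
lemma MemH20.exists_hasH2Derivs_indicator {Ω : Set (𝔼 n)} (hΩ : MeasurableSet Ω) {f : (𝔼 n) → ℂ}
    (hf : MemH20 Ω f) : ∃ G H, HasH2Derivs Ω f G H ∧
      HasH2Derivs univ (Ω.indicator f) (fun i => Ω.indicator (G i))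
        (fun i j => Ω.indicator (H i j)) := by
  obtain ⟨G, H, h, φ, hφ, hφf, hφG, hφH⟩ := hf
  refine ⟨G, H, h, ?_, fun i => ?_, fun i j => ?_, fun i => ?_, fun i j => ?_⟩
  · rw [Measure.restrict_univ]
    exact (memLp_indicator_iff_restrict hΩ).2 h.memLp
  · rw [Measure.restrict_univ]
    exact (memLp_indicator_iff_restrict hΩ).2 (h.memLp_grad i)
  · rw [Measure.restrict_univ]
    exact (memLp_indicator_iff_restrict hΩ).2 (h.memLp_hess i j)
  · exact isWeakPartial_indicator hΩ h.memLp (h.memLp_grad i) hφ hφf (hφG i)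
  · exact isWeakPartial_indicator hΩ (h.memLp_grad i) (h.memLp_hess i j)
      (fun m => (hφ m).partialDeriv i) (hφG i) (hφH i j)

end ZeroExtension

/-! ### Boundary values as essential limits. -/

section BoundaryValues

variable {n : ℕ}

lemma exists_ae_of_eventually {Ω : Set (𝔼 n)} {x : 𝔼 n} {P : (𝔼 n) → Prop}
    (h : ∀ᶠ y in 𝓝[Ω] x ⊓ ae volume, P y) :
    ∃ r : ℝ, 0 < r ∧ ∀ᵐ y : 𝔼 n, y ∈ Ω → y ∈ Metric.ball x r → P y := by
  rw [eventually_inf] at h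
  obtain ⟨s, hs, t, ht, hst⟩ := h
  obtain ⟨r, hr, hrs⟩ := Metric.mem_nhdsWithin_iff.1 hs
  refine ⟨r, hr, ?_⟩
  filter_upwards [ht] with y hy hyΩ hyr using hst y ⟨hrs ⟨hyr, hyΩ⟩, hy⟩

/-- Limits along this filter are limits from Ω outside null sets, the right notion for functions
given almost everywhere. They are unique because every ball about a closure point meets the open set
Ω in positive measure. -/
lemma neBot_nhdsWithin_inf_ae {Ω : Set (𝔼 n)} (hΩ : IsOpen Ω) {x : 𝔼 n} (hx : x ∈ closure Ω) :
    NeBot (𝓝[Ω] x ⊓ ae (volume : Measure (𝔼 n))) := by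
  rw [neBot_iff]
  intro hbot
  have h : ∀ᶠ y in 𝓝[Ω] x ⊓ ae (volume : Measure (𝔼 n)), False := by rw [hbot]; exact eventually_bot
  obtain ⟨r, hr, hae⟩ := exists_ae_of_eventually h
  obtain ⟨y, hy⟩ := mem_closure_iff.1 hx _ Metric.isOpen_ball (Metric.mem_ball_self hr)
  have hpos := (hΩ.inter Metric.isOpen_ball).measure_pos volume ⟨y, hy.2, hy.1⟩
  rw [ae_iff] at hae
  refine hpos.ne' (measure_mono_null (fun z hz => ?_) hae)
  exact fun hcon => hcon hz.1 hz.2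

lemma HasValueAt.tendsto {Ω : Set (𝔼 n)} (hΩ : IsOpen Ω) {f : (𝔼 n) → ℂ} {x : 𝔼 n} {a : ℂ}
    (h : HasValueAt Ω f x a) (hx : x ∈ closure Ω) :
    Tendsto f (𝓝[Ω] x ⊓ ae volume) (𝓝 a) := by
  obtain ⟨r, hr, g, hg, hfg, rfl⟩ := h
  have hball := Metric.ball_mem_nhds x hr
  have h1 : Tendsto g (𝓝[Ω] x) (𝓝 (g x)) := by
    have h2 := hg x ⟨hx, Metric.mem_ball_self hr⟩
    refine Tendsto.mono_left h2 ?_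
    rw [← nhdsWithin_inter_of_mem' (mem_nhdsWithin_of_mem_nhds hball) (s := Ω)]
    exact nhdsWithin_mono x (inter_subset_inter_left _ subset_closure)
  refine (h1.mono_left inf_le_left).congr' ?_
  rw [EventuallyEq, ae_restrict_iff' (hΩ.inter Metric.isOpen_ball).measurableSet] at hfg
  have e1 : ∀ᶠ y in 𝓝[Ω] x ⊓ ae (volume : Measure (𝔼 n)), y ∈ Ω :=
    eventually_mem_nhdsWithin.filter_mono inf_le_left
  have e2 : ∀ᶠ y in 𝓝[Ω] x ⊓ ae (volume : Measure (𝔼 n)), y ∈ Metric.ball x r :=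
    Eventually.filter_mono inf_le_left (mem_nhdsWithin_of_mem_nhds hball)
  filter_upwards [e1, e2, hfg.filter_mono inf_le_right] with y h3 h4 h5 using (h5 ⟨h3, h4⟩).symm

/-- The value at a point is the value of a representative that also gives the nearby values. -/
lemma HasValueAt.exists_nearby {Ω : Set (𝔼 n)} {f : (𝔼 n) → ℂ} {x : 𝔼 n} {a : ℂ}
    (h : HasValueAt Ω f x a) : ∃ r : ℝ, 0 < r ∧ ∃ g : (𝔼 n) → ℂ,
      ContinuousOn g (closure Ω ∩ Metric.ball x r) ∧ g x = a ∧
      ∀ y ∈ Metric.ball x r, HasValueAt Ω f y (g y) := by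
  obtain ⟨r, hr, g, hg, hfg, hgx⟩ := h
  refine ⟨r, hr, g, hg, hgx, fun y hy => ?_⟩
  obtain ⟨s, hs, hsub⟩ := Metric.isOpen_iff.1 Metric.isOpen_ball y hy
  exact ⟨s, hs, g, hg.mono (inter_subset_inter_right _ hsub),
    ae_restrict_of_ae_restrict_of_subset (inter_subset_inter_right _ hsub) hfg, rfl⟩

lemma IsLocallyBiconvex.mem_closure {Ω : Set (𝔼 n)} {x : 𝔼 n} (h : IsLocallyBiconvex Ω x) :
    x ∈ closure Ω := by
  rw [Metric.mem_closure_iff]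
  intro ε hε
  obtain ⟨s, hs, hsε, D₁, D₂, -, -, -, -, -, -, ⟨q, hq, -⟩, heq⟩ := h.exists_pieces hε
  have hq' : q ∈ Ω ∩ Metric.ball x s := by
    rw [heq]
    exact Or.inl hq
  exact ⟨q, hq'.1, by
    rw [dist_comm]
    exact (Metric.mem_ball.1 hq'.2).trans_le hsε⟩

end BoundaryValues

/-! ### Corners and edges of Ω. -/

section Corner

variable {n : ℕ}

/-- Turning the frame by θ/2 puts the bisector on the positive real axis. The argument then ranges
over (-θ/2, θ/2), inside (-π, π), so its branch cut is avoided. -/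
lemma wedge_eq_solidSector (e₁ e₂ : 𝔼 n) {θ : ℝ} (h2 : θ < 2 * Real.pi) :
    wedge e₁ e₂ θ = solidSector (Real.cos (θ / 2) • e₁ + Real.sin (θ / 2) • e₂)
      (-Real.sin (θ / 2) • e₁ + Real.cos (θ / 2) • e₂) θ := by
  ext y
  set α := θ / 2 with hα
  have hθ : θ = 2 * α := by rw [hα]; ring
  have hcs := Real.sin_sq_add_cos_sq α
  set z := planeCoord (Real.cos α • e₁ + Real.sin α • e₂) (-Real.sin α • e₁ + Real.cos α • e₂) y
    with hz
  have hre : z.re = Real.cos α * inner ℝ e₁ y + Real.sin α * inner ℝ e₂ y := by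
    simp [hz, planeCoord_apply, inner_add_left, inner_smul_left, -Complex.ofReal_cos,
      -Complex.ofReal_sin]
  have him : z.im = -Real.sin α * inner ℝ e₁ y + Real.cos α * inner ℝ e₂ y := by
    simp [hz, planeCoord_apply, inner_add_left, inner_smul_left, -Complex.ofReal_cos,
      -Complex.ofReal_sin]
  constructor
  · rintro ⟨ρ, t, hρ, ht0, htθ, h3, h4⟩
    have hz' : z = ρ * (Complex.cos ((t - α : ℝ) : ℂ) + Complex.sin ((t - α : ℝ) : ℂ) *
        Complex.I) := by
      apply Complex.ext
      · rw [hre, h3, h4, ← Complex.ofReal_cos, ← Complex.ofReal_sin]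
        simp [Real.cos_sub, -Complex.ofReal_cos, -Complex.ofReal_sin]
        ring
      · rw [him, h3, h4, ← Complex.ofReal_cos, ← Complex.ofReal_sin]
        simp [Real.sin_sub, -Complex.ofReal_cos, -Complex.ofReal_sin]
        ring
    have harg : z.arg = t - α := by
      rw [hz']
      exact Complex.arg_mul_cos_add_sin_mul_I hρ ⟨by linarith, by linarith⟩
    refine ⟨fun h0 => ?_, ?_⟩
    · have h5 : z.re ^ 2 + z.im ^ 2 = ρ ^ 2 := by
        rw [hre, him, h3, h4]
        linear_combination ρ ^ 2 * hcs * (Real.cos t ^ 2 + Real.sin t ^ 2) +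
          ρ ^ 2 * Real.sin_sq_add_cos_sq t
      have h6 : z = 0 := h0
      rw [h6] at h5
      simp only [Complex.zero_re, Complex.zero_im] at h5
      nlinarith [pow_pos hρ 2]
    · change |z.arg| < α
      rw [harg, abs_lt]
      constructor <;> linarith
  · rintro ⟨h0, harg⟩
    change |z.arg| < α at harg
    rw [abs_lt] at harg
    have h3 : ‖z‖ * Real.cos z.arg = z.re := Complex.norm_mul_cos_arg z
    have h4 : ‖z‖ * Real.sin z.arg = z.im := Complex.norm_mul_sin_arg z
    refine ⟨‖z‖, z.arg + α, norm_pos_iff.2 h0, by linarith [harg.1], by linarith [harg.2], ?_, ?_⟩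
    · rw [Real.cos_add, mul_sub, ← mul_assoc, ← mul_assoc, h3, h4, hre, him]
      linear_combination (-(inner ℝ e₁ y : ℝ)) * hcs
    · rw [Real.sin_add, mul_add, ← mul_assoc, ← mul_assoc, h3, h4, hre, him]
      linear_combination (-(inner ℝ e₂ y : ℝ)) * hcs

/-- Corners and edges in terms of solid sectors. -/
lemma IsCornerOrEdgePoint.exists_solidSector {Ω : Set (𝔼 n)} {x : 𝔼 n}
    (h : IsCornerOrEdgePoint Ω x) : ∃ (b b' : 𝔼 n) (θ r : ℝ), ‖b‖ = 1 ∧ ‖b'‖ = 1 ∧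
      inner ℝ b b' = 0 ∧ 0 < θ ∧ θ < 2 * Real.pi ∧ θ ≠ Real.pi ∧ 0 < r ∧
      Ω ∩ Metric.ball x r = {y | y - x ∈ solidSector b b' θ} ∩ Metric.ball x r := by
  obtain ⟨e₁, e₂, θ, r, he₁, he₂, he, h0, h2, hne, hr, heq⟩ := h
  have he' : inner ℝ e₂ e₁ = 0 := by rw [real_inner_comm, he]
  have hcs := Real.sin_sq_add_cos_sq (θ / 2)
  have hn : ∀ y : 𝔼 n, inner ℝ y y = 1 → ‖y‖ = 1 := by
    intro y hy
    rw [real_inner_self_eq_norm_sq] at hy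
    exact (pow_eq_one_iff_of_nonneg (norm_nonneg y) two_ne_zero).1 hy
  refine ⟨Real.cos (θ / 2) • e₁ + Real.sin (θ / 2) • e₂,
    -Real.sin (θ / 2) • e₁ + Real.cos (θ / 2) • e₂, θ, r, hn _ ?_, hn _ ?_, ?_, h0, h2, hne, hr, ?_⟩
  · simp only [inner_add_left, inner_add_right, inner_smul_left, inner_smul_right,
      real_inner_self_eq_norm_sq, he₁, he₂, he, he', conj_trivial]
    linear_combination hcs
  · simp only [inner_add_left, inner_add_right, inner_smul_left, inner_smul_right,
      real_inner_self_eq_norm_sq, he₁, he₂, he, he', conj_trivial]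
    linear_combination hcs
  · simp only [inner_add_left, inner_add_right, inner_smul_left, inner_smul_right,
      real_inner_self_eq_norm_sq, he₁, he₂, he, he', conj_trivial]
    ring
  · rw [heq, wedge_eq_solidSector e₁ e₂ h2]

/-- The complement of a corner contains balls arbitrarily close to the apex. -/
lemma IsCornerOrEdgePoint.exists_exterior_ball {Ω : Set (𝔼 n)} {x : 𝔼 n}
    (h : IsCornerOrEdgePoint Ω x) {s : ℝ} (hs : 0 < s) :
    ∃ (p : 𝔼 n) (ρ : ℝ), 0 < ρ ∧ Metric.ball p ρ ⊆ Metric.ball x s \ Ω := by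
  obtain ⟨b, b', θ, r, hb, hb', hbb', h0, h2, -, hr, heq⟩ := h.exists_solidSector
  obtain ⟨c, hW⟩ := exists_isShiftedCone_solidSector hb hb' hbb' h0 h2
  have hc := hW.pos
  set ε := min s r / 2 with hε
  have hm : 0 < min s r := lt_min hs hr
  have hε0 : 0 < ε := by positivity
  -- The centre lies opposite to the bisector, and the sector keeps distance at least cε from it;
  -- radius ε keeps the ball close to the apex.
  refine ⟨x - ε • b, min ε (c * ε), by positivity, fun y hy => ?_⟩
  have hy1 : dist y (x - ε • b) < ε := (Metric.mem_ball.1 hy).trans_le (min_le_left _ _)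
  have hy2 : dist y (x - ε • b) < c * ε := (Metric.mem_ball.1 hy).trans_le (min_le_right _ _)
  rw [dist_eq_norm, show y - (x - ε • b) = y - x + ε • b by abel] at hy1 hy2
  have hyx : dist y x < min s r := by
    rw [dist_eq_norm]
    calc ‖y - x‖ = ‖(y - x + ε • b) - ε • b‖ := by rw [add_sub_cancel_right]
      _ ≤ ‖y - x + ε • b‖ + ‖ε • b‖ := norm_sub_le _ _
      _ < ε + ε := by
        rw [norm_smul, hb, mul_one, Real.norm_of_nonneg hε0.le]
        linarith
      _ = min s r := by rw [hε]; ring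
  refine ⟨hyx.trans_le (min_le_left _ _), fun hyΩ => ?_⟩
  have hmem : y ∈ Ω ∩ Metric.ball x r := ⟨hyΩ, hyx.trans_le (min_le_right _ _)⟩
  rw [heq] at hmem
  exact absurd hy2 (not_lt.2 (hW.le_norm' _ hmem.1 ε hε0.le))

/-- Functions of `H²₀` vanish at corners and edges. -/
lemma tendsto_zero_of_corner (hn : n < 4) {Ω : Set (𝔼 n)} {x : 𝔼 n}
    (hx : IsCornerOrEdgePoint Ω x) {u : (𝔼 n) → ℂ} (hu : MemH2 univ (Ω.indicator u)) :
    Tendsto u (𝓝[Ω] x ⊓ ae volume) (𝓝 0) := by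
  obtain ⟨G, H, h⟩ := hu.mono MeasurableSet.univ (subset_univ (Metric.ball x 1))
  obtain ⟨g, hg, hug⟩ := h.exists_continuousOn_closure hn Metric.isOpen_ball (convex_ball x 1)
    Metric.isBounded_ball
  have hball := Metric.ball_mem_nhds x one_pos
  have hgc : ContinuousAt g x := (hg.mono subset_closure).continuousAt hball
  rw [EventuallyEq, ae_restrict_iff' measurableSet_ball] at hug
  -- A nonzero value of the continuous representative would persist on a small ball about x. That
  -- ball contains an exterior ball of positive measure, on which the zero extension vanishes.
  have hgx : g x = 0 := by
    by_contra hne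
    obtain ⟨s, hs, hsub⟩ := Metric.mem_nhds_iff.1 (inter_mem (hgc.eventually_ne hne) hball)
    obtain ⟨p, ρ, hρ, hp⟩ := hx.exists_exterior_ball hs
    refine (Metric.measure_ball_pos volume p hρ).ne' (measure_mono_null ?_ (ae_iff.1 hug))
    intro y hy hcon
    have h1 := hsub (hp hy).1
    refine h1.1 ?_
    rw [← hcon h1.2, indicator_of_notMem (hp hy).2]
  rw [← hgx]
  refine (hgc.tendsto.mono_left (inf_le_left.trans nhdsWithin_le_nhds)).congr' ?_
  have e1 : ∀ᶠ y in 𝓝[Ω] x ⊓ ae (volume : Measure (𝔼 n)), y ∈ Ω :=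
    eventually_mem_nhdsWithin.filter_mono inf_le_left
  have e2 : ∀ᶠ y in 𝓝[Ω] x ⊓ ae (volume : Measure (𝔼 n)), y ∈ Metric.ball x 1 :=
    Eventually.filter_mono inf_le_left (mem_nhdsWithin_of_mem_nhds hball)
  filter_upwards [e1, e2, hug.filter_mono inf_le_right] with y h3 h4 h5
  rw [← h5 h4, indicator_of_mem h3]

/-- The boundary value at a corner or an edge of the Laplacian of an `H²₀` function is zero. -/
theorem laplacian_value_eq_zero_of_corner {Ω : Set (𝔼 n)}
    (hΩb : Bornology.IsBounded Ω) (hΩ : IsOpen Ω) {x : 𝔼 n} (hx : IsCornerOrEdgePoint Ω x)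
    {u : (𝔼 n) → ℂ} {G : Fin n → (𝔼 n) → ℂ} {H : Fin n → Fin n → (𝔼 n) → ℂ}
    (h : HasH2Derivs Ω u G H) (h' : HasH2Derivs univ (Ω.indicator u)
      (fun i => Ω.indicator (G i)) (fun i j => Ω.indicator (H i j))) {f₀ : ℂ}
    (hlim : Tendsto (fun y => ∑ i, H i i y) (𝓝[Ω] x ⊓ ae volume) (𝓝 f₀)) : f₀ = 0 := by
  obtain ⟨b, b', θ, r, hb, hb', hbb', h0, h2, hne, hr, heq⟩ := hx.exists_solidSector
  have hΩm := hΩ.measurableSet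
  have hui : Integrable (Ω.indicator u) :=
    (integrable_indicator_iff hΩm).2 (integrable_of_memLp_two hΩb h.memLp)
  have hHi : ∀ i, Integrable (Ω.indicator (H i i)) := fun i =>
    (integrable_indicator_iff hΩm).2 (integrable_of_memLp_two hΩb (h.memLp_hess i i))
  have hFi : Integrable (fun y => ∑ i, Ω.indicator (H i i) y) :=
    integrable_finsetSum _ fun i _ => hHi i
  refine eq_zero_of_solidSector hb hb' hbb' h0 h2 hne hr (hui.comp_add_right x)
    (hFi.comp_add_right x) ?_ ?_ ?_
  · intro y hyr hy
    have hyΩ : y + x ∉ Ω := by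
      intro hcon
      have hmem : y + x ∈ Ω ∩ Metric.ball x r := ⟨hcon, by simpa [dist_eq_norm] using hyr⟩
      rw [heq] at hmem
      have h3 : y + x - x ∈ solidSector b b' θ := hmem.1
      rw [add_sub_cancel_right] at h3
      exact hy h3
    exact ⟨indicator_of_notMem hyΩ _, Finset.sum_eq_zero fun i _ => indicator_of_notMem hyΩ _⟩
  · intro ψ hψ
    -- The sector theorem is stated at the origin, so the translation is moved to the test function;
    -- two weak integrations by parts then give Green's identity.
    set ψ' : (𝔼 n) → ℂ := fun y => ψ (y + -x) with hψ'
    have hψ't : IsTestFunction univ ψ' := by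
      refine ⟨hψ.contDiff.comp (contDiff_id.add contDiff_const), ?_, subset_univ _⟩
      exact hψ.hasCompactSupport.comp_homeomorph (Homeomorph.addRight (-x))
    have e1 : ∀ i, partialDeriv i (partialDeriv i ψ') =
        fun y => partialDeriv i (partialDeriv i ψ) (y + -x) := by
      intro i
      rw [hψ', partialDeriv_comp_add_right, partialDeriv_comp_add_right]
    have e2 : ∫ y, Ω.indicator u (y + x) * ∑ i, partialDeriv i (partialDeriv i ψ) y =
        ∫ y, Ω.indicator u y * ∑ i, partialDeriv i (partialDeriv i ψ') y := by
      rw [← integral_add_right_eq_self (fun y => Ω.indicator u y *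
        ∑ i, partialDeriv i (partialDeriv i ψ') y) x]
      simp [e1]
    have e3 : ∫ y, (∑ i, Ω.indicator (H i i) (y + x)) * ψ y =
        ∫ y, (∑ i, Ω.indicator (H i i) y) * ψ' y := by
      rw [← integral_add_right_eq_self (fun y => (∑ i, Ω.indicator (H i i) y) * ψ' y) x]
      simp [hψ']
    rw [e2, e3]
    have hint : ∀ f φ : (𝔼 n) → ℂ, Integrable f → IsTestFunction univ φ →
        Integrable fun y => f y * φ y := by
      intro f φ hf hφ
      simpa using hφ.integrable_mul (D := univ) (by simpa using hf)
    simp_rw [Finset.mul_sum, Finset.sum_mul]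
    rw [integral_finsetSum _ fun i _ => hint _ _ hui ((hψ't.partialDeriv i).partialDeriv i),
      integral_finsetSum _ fun i _ => hint _ _ (hHi i) hψ't]
    refine Finset.sum_congr rfl fun i _ => ?_
    have e4 := h'.weak_grad i _ (hψ't.partialDeriv i)
    have e5 := h'.weak_hess i i _ hψ't
    rw [setIntegral_univ, setIntegral_univ] at e4 e5
    rw [e4, e5, neg_neg]
  · intro δ hδ
    have hev : ∀ᶠ y in 𝓝[Ω] x ⊓ ae (volume : Measure (𝔼 n)), ‖(∑ i, H i i y) - f₀‖ ≤ δ := by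
      filter_upwards [hlim.eventually (Metric.closedBall_mem_nhds f₀ hδ)] with y hy
      simpa [dist_eq_norm] using hy
    obtain ⟨r₁, hr₁, hae⟩ := exists_ae_of_eventually hev
    refine ⟨min r r₁, lt_min hr hr₁, ?_⟩
    have hae' := (measurePreserving_add_right (volume : Measure (𝔼 n)) x).quasiMeasurePreserving.ae
      hae
    filter_upwards [hae'] with y hy hyW hyr
    have hmem : y + x ∈ Ω ∩ Metric.ball x r := by
      rw [heq]
      refine ⟨?_, ?_⟩
      · rw [mem_ofPred_eq, add_sub_cancel_right]
        exact hyW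
      · simpa [dist_eq_norm] using hyr.trans_le (min_le_left _ _)
    have h3 := hy hmem.1 (by simpa [dist_eq_norm] using hyr.trans_le (min_le_right _ _))
    simpa [indicator_of_mem hmem.1] using h3

end Corner

/-! ### The equation for v - w and vanishing at corners and edges. -/

section Eigenpair

variable {n : ℕ}

lemma HasH2Derivs.sub {U : Set (𝔼 n)} (hUb : Bornology.IsBounded U) {f g : (𝔼 n) → ℂ}
    {G K : Fin n → (𝔼 n) → ℂ} {H L : Fin n → Fin n → (𝔼 n) → ℂ}
    (hf : HasH2Derivs U f G H) (hg : HasH2Derivs U g K L) :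
    HasH2Derivs U (f - g) (fun i => G i - K i) (fun i j => H i j - L i j) := by
  have key : ∀ {i : Fin n} {a b c d : (𝔼 n) → ℂ}, MemLp a 2 (volume.restrict U) →
      MemLp b 2 (volume.restrict U) → MemLp c 2 (volume.restrict U) →
      MemLp d 2 (volume.restrict U) → IsWeakPartial U i a b → IsWeakPartial U i c d →
      IsWeakPartial U i (a - c) (b - d) := by
    intro i a b c d ha hb hc hd hab hcd φ hφ
    have hφ' := hφ.partialDeriv i
    simp only [Pi.sub_apply, sub_mul]
    rw [integral_sub (hφ'.integrable_mul (integrable_of_memLp_two hUb ha))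
        (hφ'.integrable_mul (integrable_of_memLp_two hUb hc)),
      integral_sub (hφ.integrable_mul (integrable_of_memLp_two hUb hb))
        (hφ.integrable_mul (integrable_of_memLp_two hUb hd)), hab φ hφ, hcd φ hφ]
    ring
  exact ⟨hf.memLp.sub hg.memLp, fun i => (hf.memLp_grad i).sub (hg.memLp_grad i),
    fun i j => (hf.memLp_hess i j).sub (hg.memLp_hess i j),
    fun i => key hf.memLp (hf.memLp_grad i) hg.memLp (hg.memLp_grad i) (hf.weak_grad i)
      (hg.weak_grad i),
    fun i j => key (hf.memLp_grad i) (hf.memLp_hess i j) (hg.memLp_grad i) (hg.memLp_hess i j)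
      (hf.weak_hess i j) (hg.weak_hess i j)⟩

lemma MemH2.sub {U : Set (𝔼 n)} (hUb : Bornology.IsBounded U) {f g : (𝔼 n) → ℂ}
    (hf : MemH2 U f) (hg : MemH2 U g) : MemH2 U (f - g) := by
  obtain ⟨G, H, hf⟩ := hf
  obtain ⟨K, L, hg⟩ := hg
  exact ⟨_, _, hf.sub hUb hg⟩

/-- The difference of transmission eigenfunctions solves `(Δ + k²) u = -k² V v` in `L²`. -/
lemma IsTransmissionEigenpair.sum_hess_ae_eq {Ω : Set (𝔼 n)} (hΩ : IsOpen Ω)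
    (hΩb : Bornology.IsBounded Ω) {V : (𝔼 n) → ℂ} (hV : MemLp V ∞ (volume.restrict Ω)) {k : ℝ}
    {v w : (𝔼 n) → ℂ} (hvw : IsTransmissionEigenpair Ω V k v w)
    {G : Fin n → (𝔼 n) → ℂ} {H : Fin n → Fin n → (𝔼 n) → ℂ} (h : HasH2Derivs Ω (v - w) G H) :
    ∀ᵐ x : 𝔼 n, x ∈ Ω → ∑ i, H i i x = -(k : ℂ) ^ 2 * ((v - w) x + V x * v x) := by
  have hVv : MemLp (V * v) 2 (volume.restrict Ω) := hvw.memLp_v.mul hV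
  have iv := integrable_of_memLp_two hΩb hvw.memLp_v
  have iw := integrable_of_memLp_two hΩb hvw.memLp_w
  have iVv := integrable_of_memLp_two hΩb hVv
  have iH := fun i => integrable_of_memLp_two hΩb (h.memLp_hess i i)
  set f : (𝔼 n) → ℂ := fun x => (∑ i, H i i x) + (k : ℂ) ^ 2 * ((v x - w x) + (V * v) x) with hf
  have hfi : IntegrableOn f Ω :=
    (integrable_finsetSum _ fun i _ => iH i).add (((iv.sub iw).add iVv).const_mul _)
  have hzero := hΩ.ae_eq_zero_of_integral_contDiff_smul_eq_zero hfi.locallyIntegrableOn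
    (μ := (volume : Measure (𝔼 n))) ?_
  · filter_upwards [hzero] with x hx hxΩ
    have := hx hxΩ
    simp only [hf, Pi.mul_apply] at this
    simp only [Pi.sub_apply]
    linear_combination this
  · intro g hg hgc hgs
    set φ : (𝔼 n) → ℂ := fun x => (g x : ℂ) with hφ
    have hsupp : Function.support φ = Function.support g := by
      ext x
      simp [hφ]
    have hφt : IsTestFunction Ω φ := by
      refine ⟨Complex.ofRealCLM.contDiff.comp hg, ?_, ?_⟩
      · rw [HasCompactSupport, tsupport, hsupp]
        exact hgc
      · rw [tsupport, hsupp]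
        exact hgs
    have hout : ∀ x, x ∉ Ω → g x • f x = 0 := fun x hx => by
      rw [image_eq_zero_of_notMem_tsupport fun hc => hx (hgs hc), zero_smul]
    rw [← setIntegral_eq_integral_of_forall_compl_eq_zero hout]
    have hi := fun i => (hφt.partialDeriv i).partialDeriv i
    have e1 : ∀ i, ∫ x in Ω, (v - w) x * partialDeriv i (partialDeriv i φ) x =
        ∫ x in Ω, H i i x * φ x := fun i => by
      rw [h.weak_grad i _ (hφt.partialDeriv i), h.weak_hess i i _ hφt, neg_neg]
    have iu : IntegrableOn (v - w) Ω := iv.sub iw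
    have e2 : ∫ x in Ω, ((∑ i, H i i x * φ x) - ∑ i, (v - w) x *
        partialDeriv i (partialDeriv i φ) x) = 0 := by
      rw [integral_sub (integrable_finsetSum _ fun i _ => hφt.integrable_mul (iH i))
          (integrable_finsetSum _ fun i _ => (hi i).integrable_mul iu),
        integral_finsetSum _ fun i _ => hφt.integrable_mul (iH i),
        integral_finsetSum _ fun i _ => (hi i).integrable_mul iu, sub_eq_zero]
      exact Finset.sum_congr rfl fun i _ => (e1 i).symm
    have iΔ : ∀ a : (𝔼 n) → ℂ, IntegrableOn a Ω → IntegrableOn (fun x => a x * Δ φ x) Ω := by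
      intro a ha
      simp only [laplacian_eq_sum_partialDeriv hφt.contDiff, Finset.mul_sum]
      exact integrable_finsetSum _ fun i _ => (hi i).integrable_mul ha
    have i1 : IntegrableOn (fun x => w x * (Δ φ x + (k : ℂ) ^ 2 * φ x)) Ω := by
      refine ((iΔ w iw).add ((hφt.integrable_mul iw).const_mul ((k : ℂ) ^ 2))).congr
        (Eventually.of_forall fun x => ?_)
      simp only [Pi.add_apply]
      ring
    have i2 : IntegrableOn (fun x => v x * (Δ φ x + (k : ℂ) ^ 2 * (1 + V x) * φ x)) Ω := by
      refine (((iΔ v iv).add ((hφt.integrable_mul iv).const_mul ((k : ℂ) ^ 2))).add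
        ((hφt.integrable_mul iVv).const_mul ((k : ℂ) ^ 2))).congr
        (Eventually.of_forall fun x => ?_)
      simp only [Pi.add_apply, Pi.mul_apply]
      ring
    have i3 : IntegrableOn (fun x => (∑ i, H i i x * φ x) - ∑ i, (v - w) x *
        partialDeriv i (partialDeriv i φ) x) Ω :=
      (integrable_finsetSum _ fun i _ => hφt.integrable_mul (iH i)).sub
        (integrable_finsetSum _ fun i _ => (hi i).integrable_mul iu)
    -- The first bracket integrates to zero by the definition of the weak Hessian, the second by the
    -- two eigenfunction equations.
    have e3 : ∀ x, g x • f x = ((∑ i, H i i x * φ x) - ∑ i, (v - w) x *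
        partialDeriv i (partialDeriv i φ) x) + (v x * (Δ φ x + (k : ℂ) ^ 2 * (1 + V x) * φ x) -
        w x * (Δ φ x + (k : ℂ) ^ 2 * φ x)) := by
      intro x
      rw [laplacian_eq_sum_partialDeriv hφt.contDiff, ← Finset.sum_mul, ← Finset.mul_sum,
        Complex.real_smul]
      simp only [hf, Pi.sub_apply, Pi.mul_apply]
      ring
    simp_rw [e3]
    have i4 : IntegrableOn (fun x => v x * (Δ φ x + (k : ℂ) ^ 2 * (1 + V x) * φ x) -
        w x * (Δ φ x + (k : ℂ) ^ 2 * φ x)) Ω := i2.sub i1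
    rw [integral_add i3 i4, e2, integral_sub i2 i1, hvw.eq_v φ hφt, hvw.eq_w φ hφt]
    simp

/-- Transmission eigenfunctions with boundary values vanish at corners and edges where the
potential does not. -/
theorem IsTransmissionEigenpair.value_eq_zero_of_corner (hn : n < 4) {Ω : Set (𝔼 n)}
    (hΩ : IsOpen Ω) (hΩb : Bornology.IsBounded Ω) {V : (𝔼 n) → ℂ}
    (hV : MemLp V ∞ (volume.restrict Ω)) {k : ℝ} (hk : k ≠ 0) {v w : (𝔼 n) → ℂ}
    (hvw : IsTransmissionEigenpair Ω V k v w) {x : 𝔼 n} (hx : IsCornerOrEdgePoint Ω x)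
    {a b c : ℂ} (ha : HasValueAt Ω v x a) (hb : HasValueAt Ω w x b) (hc : HasValueAt Ω V x c)
    (hc0 : c ≠ 0) : a = 0 ∧ b = 0 := by
  obtain ⟨G, H, h, h'⟩ := hvw.sub_memH20.exists_hasH2Derivs_indicator hΩ.measurableSet
  have hxcl := hx.isLocallyBiconvex.mem_closure
  have hu := tendsto_zero_of_corner hn hx ⟨_, _, h'⟩
  have hva := ha.tendsto hΩ hxcl
  have hwb := hb.tendsto hΩ hxcl
  have hVc := hc.tendsto hΩ hxcl
  have := neBot_nhdsWithin_inf_ae hΩ hxcl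
  have hab : a - b = 0 := tendsto_nhds_unique (hva.sub hwb) hu
  -- In -k²(u + V v) the first term tends to 0, so the limit is a nonzero multiple of the common
  -- value a.
  have hlim : Tendsto (fun y => ∑ i, H i i y) (𝓝[Ω] x ⊓ ae volume)
      (𝓝 (-(k : ℂ) ^ 2 * (0 + c * a))) := by
    refine ((hu.add (hVc.mul hva)).const_mul _).congr' ?_
    have e1 : ∀ᶠ y in 𝓝[Ω] x ⊓ ae (volume : Measure (𝔼 n)), y ∈ Ω :=
      eventually_mem_nhdsWithin.filter_mono inf_le_left
    filter_upwards [e1, (hvw.sum_hess_ae_eq hΩ hΩb hV h).filter_mono inf_le_right] with y h1 h2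
      using (h2 h1).symm
  have h0 := laplacian_value_eq_zero_of_corner hΩb hΩ hx h h' hlim
  have ha0 : a = 0 := by simpa [hk, hc0] using h0
  exact ⟨ha0, by rwa [ha0, zero_sub, neg_eq_zero] at hab⟩

end Eigenpair

/-! ### Passing from edges to vertices. -/

section Vertex

variable {n : ℕ}

lemma smul_mem_wedge {e₁ e₂ : 𝔼 n} {θ t : ℝ} (ht : 0 < t) {y : 𝔼 n} (hy : y ∈ wedge e₁ e₂ θ) :
    t • y ∈ wedge e₁ e₂ θ := by
  obtain ⟨ρ, s, hρ, h0, h1, h2, h3⟩ := hy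
  refine ⟨t * ρ, s, mul_pos ht hρ, h0, h1, ?_, ?_⟩
  · rw [inner_smul_right, h2, mul_assoc]
  · rw [inner_smul_right, h3, mul_assoc]

lemma smul_mem_iff_of_cone {K : Set (𝔼 n)} (hK : ∀ t : ℝ, 0 < t → ∀ y ∈ K, t • y ∈ K) {t : ℝ}
    (ht : 0 < t) {y : 𝔼 n} : t • y ∈ K ↔ y ∈ K := by
  refine ⟨fun h => ?_, hK t ht y⟩
  have := hK t⁻¹ (inv_pos.2 ht) _ h
  rwa [inv_smul_smul₀ ht.ne'] at this

/-- The edges of a cone are rays. -/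
lemma IsCornerOrEdgePoint.add_smul_sub {Ω K : Set (𝔼 n)} {x y : 𝔼 n} {r : ℝ}
    (hK : ∀ t : ℝ, 0 < t → ∀ y ∈ K, t • y ∈ K)
    (heq : Ω ∩ Metric.ball x r = {y | y - x ∈ K} ∩ Metric.ball x r)
    (hy : IsCornerOrEdgePoint Ω y) (hyr : y ∈ Metric.ball x r) {t : ℝ} (ht : 0 < t) (ht1 : t ≤ 1) :
    IsCornerOrEdgePoint Ω (x + t • (y - x)) := by
  obtain ⟨e₁, e₂, θ, s, he₁, he₂, he, h0, h2, hne, hs, hw⟩ := hy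
  have hd : 0 < r - dist y x := sub_pos.2 hyr
  -- The homothety of ratio t about the apex carries the wedge structure at y along the ray. The
  -- radius ensures that the preimages of nearby points lie both in the wedge ball at y and in the
  -- ball where Ω is a cone.
  refine ⟨e₁, e₂, θ, t * min s (r - dist y x), he₁, he₂, he, h0, h2, hne,
    mul_pos ht (lt_min hs hd), ?_⟩
  ext z
  simp only [mem_inter_iff, and_congr_left_iff]
  intro hz
  obtain ⟨z', rfl⟩ : ∃ z', z = x + t • (z' - x) :=
    ⟨x + t⁻¹ • (z - x), by rw [add_sub_cancel_left, smul_inv_smul₀ ht.ne', add_sub_cancel]⟩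
  have hsub : x + t • (z' - x) - (x + t • (y - x)) = t • (z' - y) := by
    rw [add_sub_add_left_eq_sub, ← smul_sub, sub_sub_sub_cancel_right]
  rw [Metric.mem_ball, dist_eq_norm, hsub, norm_smul, Real.norm_of_nonneg ht.le,
    mul_lt_mul_iff_right₀ ht, lt_min_iff, ← dist_eq_norm] at hz
  have hz1 : z' ∈ Metric.ball x r := by
    have := dist_triangle z' y x
    rw [Metric.mem_ball]
    linarith [hz.2]
  have hz2 : x + t • (z' - x) ∈ Metric.ball x r := by
    rw [Metric.mem_ball, dist_eq_norm, add_sub_cancel_left, norm_smul, Real.norm_of_nonneg ht.le,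
      ← dist_eq_norm]
    exact (mul_le_of_le_one_left dist_nonneg ht1).trans_lt hz1
  have m1 := Set.ext_iff.1 heq (x + t • (z' - x))
  have m2 := Set.ext_iff.1 heq z'
  have m3 := Set.ext_iff.1 hw z'
  simp only [mem_inter_iff, hz1, hz2, Metric.mem_ball.2 hz.1, and_true, mem_ofPred_eq] at m1 m2 m3
  rw [m1, mem_ofPred_eq, hsub, add_sub_cancel_left, smul_mem_iff_of_cone hK ht, ← m2, m3,
    smul_mem_iff_of_cone (fun t ht y => smul_mem_wedge ht) ht]

/-- At a vertex, transmission eigenfunctions vanish together with their values at the edges. -/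
theorem IsTransmissionEigenpair.value_eq_zero_of_vertex (hn : n < 4) {Ω : Set (𝔼 n)}
    (hΩ : IsOpen Ω) (hΩb : Bornology.IsBounded Ω) {V : (𝔼 n) → ℂ}
    (hV : MemLp V ∞ (volume.restrict Ω)) {k : ℝ} (hk : k ≠ 0) {v w : (𝔼 n) → ℂ}
    (hvw : IsTransmissionEigenpair Ω V k v w) {x : 𝔼 n} (hx : IsPolyhedralVertex Ω x)
    {a b c : ℂ} (ha : HasValueAt Ω v x a) (hb : HasValueAt Ω w x b) (hc : HasValueAt Ω V x c)
    (hc0 : c ≠ 0) : a = 0 ∧ b = 0 := by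
  obtain ⟨-, K, r, -, hK, hr, heq, -, y, hyr, -, hy⟩ := hx
  obtain ⟨r₁, hr₁, g₁, hg₁, rfl, hval₁⟩ := ha.exists_nearby
  obtain ⟨r₂, hr₂, g₂, hg₂, rfl, hval₂⟩ := hb.exists_nearby
  obtain ⟨r₃, hr₃, g₃, hg₃, rfl, hval₃⟩ := hc.exists_nearby
  have hray : Tendsto (fun t : ℝ => x + t • (y - x)) (𝓝[>] 0) (𝓝 x) := by
    have h1 : Continuous fun t : ℝ => x + t • (y - x) := by fun_prop
    simpa using (h1.tendsto 0).mono_left nhdsWithin_le_nhds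
  have hedge : ∀ᶠ t : ℝ in 𝓝[>] 0, IsCornerOrEdgePoint Ω (x + t • (y - x)) := by
    filter_upwards [Ioc_mem_nhdsGT one_pos] with t ht
    exact hy.add_smul_sub hK heq hyr ht.1 ht.2
  have hcl : ∀ᶠ t : ℝ in 𝓝[>] 0, x + t • (y - x) ∈ closure Ω :=
    hedge.mono fun t ht => ht.isLocallyBiconvex.mem_closure
  have hxcl : x ∈ closure Ω := isClosed_closure.mem_of_tendsto hray hcl
  have hball : ∀ {s : ℝ}, 0 < s → ∀ᶠ t : ℝ in 𝓝[>] 0, x + t • (y - x) ∈ Metric.ball x s :=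
    fun hs => hray.eventually (Metric.ball_mem_nhds x hs)
  have hlim : ∀ {g : (𝔼 n) → ℂ} {s : ℝ}, 0 < s → ContinuousOn g (closure Ω ∩ Metric.ball x s) →
      Tendsto (fun t : ℝ => g (x + t • (y - x))) (𝓝[>] 0) (𝓝 (g x)) := by
    intro g s hs hg
    exact (hg x ⟨hxcl, Metric.mem_ball_self hs⟩).tendsto.comp
      (tendsto_nhdsWithin_iff.2 ⟨hray, hcl.and (hball hs)⟩)
  -- By continuity the boundary value of V stays nonzero at points of the edge close to the apex, so
  -- the edge case applies there.
  have hzero : ∀ᶠ t : ℝ in 𝓝[>] 0, g₁ (x + t • (y - x)) = 0 ∧ g₂ (x + t • (y - x)) = 0 := by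
    filter_upwards [hedge, hball hr₁, hball hr₂, hball hr₃,
      (hlim hr₃ hg₃).eventually_ne hc0] with t h1 h2 h3 h4 h5
    exact hvw.value_eq_zero_of_corner hn hΩ hΩb hV hk h1 (hval₁ _ h2) (hval₂ _ h3) (hval₃ _ h4) h5
  constructor
  · exact tendsto_nhds_unique (hlim hr₁ hg₁)
      (tendsto_const_nhds.congr' (hzero.mono fun t ht => ht.1.symm))
  · exact tendsto_nhds_unique (hlim hr₂ hg₂)
      (tendsto_const_nhds.congr' (hzero.mono fun t ht => ht.2.symm))

end Vertex

/-! ### The main theorem. -/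

theorem theorem4p2 (n : ℕ) (hn : n = 2 ∨ n = 3)
    (Ω : Set (EuclideanSpace ℝ (Fin n)))
    (hΩ_open : IsOpen Ω) (hΩ_conn : IsConnected Ω) (hΩ_bdd : Bornology.IsBounded Ω)
    (V : EuclideanSpace ℝ (Fin n) → ℂ) (hV : MemLp V ∞ (volume.restrict Ω))
    (k : ℝ) (hk : 0 < k)
    (v w : EuclideanSpace ℝ (Fin n) → ℂ) (hvw : IsTransmissionEigenpair Ω V k v w)
    (x_c : EuclideanSpace ℝ (Fin n))
    (hx_c : IsCornerOrEdgePoint Ω x_c ∨ IsPolyhedralVertex Ω x_c)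
    (α : ℝ≥0) (hα : 0 < α) (hV_holder : IsHolderNear Ω V α x_c)
    (V_c : ℂ) (hV_c : HasValueAt Ω V x_c V_c) (hV_c_ne : V_c ≠ 0)
    (hH2 : (∃ r : ℝ, 0 < r ∧ MemH2 (Ω ∩ Metric.ball x_c r) v) ∨
      (∃ r : ℝ, 0 < r ∧ MemH2 (Ω ∩ Metric.ball x_c r) w)) :
    HasValueAt Ω v x_c 0 ∧ HasValueAt Ω w x_c 0 := by
  have hn4 : n < 4 := by omega
  have hu : ∀ r, MemH2 (Ω ∩ Metric.ball x_c r) (v - w) := by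
    obtain ⟨G, H, h, -⟩ := hvw.sub_memH20
    exact fun r => MemH2.mono hΩ_open.measurableSet inter_subset_left ⟨G, H, h⟩
  have hb : ∀ r, Bornology.IsBounded (Ω ∩ Metric.ball x_c r) :=
    fun r => hΩ_bdd.subset inter_subset_left
  have hH2' : ∃ r : ℝ, 0 < r ∧ MemH2 (Ω ∩ Metric.ball x_c r) v ∧
      MemH2 (Ω ∩ Metric.ball x_c r) w := by
    -- Since v - w is in H², regularity of one eigenfunction passes to the other. Using differences
    -- only, v = w - ((w - w) - (v - w)).
    rcases hH2 with ⟨r, hr, h⟩ | ⟨r, hr, h⟩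
    · refine ⟨r, hr, h, ?_⟩
      have := h.sub (hb r) (hu r)
      rwa [sub_sub_cancel] at this
    · refine ⟨r, hr, ?_, h⟩
      have h1 := (h.sub (hb r) h).sub (hb r) (hu r)
      have h2 := h.sub (hb r) h1
      rwa [sub_self, zero_sub, sub_neg_eq_add, add_sub_cancel] at h2
  obtain ⟨r, hr, hv, hw⟩ := hH2'
  obtain ⟨a, ha⟩ := exists_hasValueAt hn4 hΩ_open hx_c ⟨r, hr, hv⟩
  obtain ⟨b, hb⟩ := exists_hasValueAt hn4 hΩ_open hx_c ⟨r, hr, hw⟩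
  have h0 : a = 0 ∧ b = 0 := by
    rcases hx_c with hx | hx
    · exact hvw.value_eq_zero_of_corner hn4 hΩ_open hΩ_bdd hV hk.ne' hx ha hb hV_c hV_c_ne
    · exact hvw.value_eq_zero_of_vertex hn4 hΩ_open hΩ_bdd hV hk.ne' hx ha hb hV_c hV_c_ne
  rw [← h0.1]
  exact ⟨ha, by rw [h0.1, ← h0.2]; exact hb⟩
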